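/- Let $0<q<1$. Write $(x;q)_n=\prod_{k=0}^{n-1}(1-xq^k)$, $(x_1,\dots,x_m;q)_n=\prod_i(x_i;q)_n$, with the convention $1/(q;q)_n=0$ for $n<0$. Partitions $\lambda$ are identified with Young diagrams; $|\lambda|$ is the size and $\ell(\lambda)$ the number of rows. Let $\mathrm{Sym}$ be the algebra of symmetric functions over $\mathbb C$. **Interpolation functions.** For a sequence $(c_i)_{i\ge0}$ put $(x\mid c_0,c_1,\dots)^m=(x-c_0)\cdots(x-c_{m-1})$ and, for $\ell(\mu)\le N$, $$s_{\mu\mid N}(x_1,\dots,x_N\mid c_0,c_1,\dots)=\frac{\det[(x_j\mid c_0,c_1,\dots)^{\mu_i+N-i}]_{i,j=1}^N}{\prod_{i<j}(x_i-x_j)}.$$ Symmetric polynomials $F_N$ in $N$ variables converge to $F\in\mathrm{Sym}$ if their degrees are bounded and $F_N(x_1,\dots,x_L,0^{N-L})\to F(x_1,\dots,x_L,0,0,\dots)$ for every $L$ and every $(x_1,\dots,x_L)\in\mathbb C^L$. In this sense put $$I^A_\mu(\,\cdot\,;q)=\lim_{N\to\infty}s_{\mu\mid N}(\,\cdot\mid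 c^{(N)}),\quad c^{(N)}_i=q^{N-i-1},\qquad I^{BC}_\mu(\,\cdot\,;q;s)=\lim_{N\to\infty}s_{\mu\mid N}(\,\cdot\mid c^{(N)}),\quad c^{(N)}_i=s^{-1}q^{N-i-1}-sq^i .$$ **$q$-Racah and big $q$-Jacobi symmetric functions.** Writing $n_{jk}=\lambda_j-j-\mu_k+k$, let $$\Phi^{qR}_\lambda(\,\cdot\,;q;s_0,s_1,s_2,s_3)=\sum_{\mu\subseteq\lambda}s_0^{|\mu|-|\lambda|}\det\!\left[\frac{(-s_0s_1q^{\mu_k+1-k},-s_0s_2q^{\mu_k+1-k},-s_0s_3q^{\mu_k+1-k};q)_{n_{jk}}}{q^{(\mu_k+1-k)n_{jk}}\,(q,\,s_0s_1s_2s_3q^{\lambda_j+\mu_k+1-j-k};q)_{n_{jk}}}\right]_{j,k=1}^{\ell(\lambda)}I^{BC}_\mu(\,\cdot\,;q;s_0),$$ $$\Phi^{bqJ}_\lambda(X;q;a,b,c,d)=\sum_{\mu\subseteq\lambda}c^{-|\lambda|}\det\!\left[\frac{(\frac caq^{\mu_k+2-k},\frac cbq^{\mu_k+2-k};q)_{n_{jk}}}{q^{(\mu_k+1-k)n_{jk}}\,(q,\,\frac{cd}{ab}q^{\lambda_j+\mu_k+3-j-k};q)_{n_{jk}}}\right]_{j,k=1}^{\ell(\lambda)}I^{A}_\mu(Xc;q),$$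 where $Xc$ means that all variables are multiplied by $c$. **Admissible parameters.** $(a,b,c,d)$ is admissible if $a>0>b$ and one of the following holds: $d=\bar c\in\mathbb C\setminus\mathbb R$; or $c,d$ are real and $aq^m<c,d<aq^{m-1}$ for some $m\in\mathbb Z$; or $c,d$ are real and $bq^{m-1}<c,d<bq^m$ for some $m\in\mathbb Z$. **Configurations.** For a countable set $\Delta\subset\mathbb R$ let $\Omega(\Delta)=\{0,1\}^\Delta$ be the space of subsets $X\subseteq\Delta$ with the product topology. On the grids $$\Delta^{qR}_{L,R}=\{-\zeta^{-1}q^{-L},-\zeta^{-1}q^{1-L},\dots\}\sqcup\{\dots,\zeta q^{R+1},\zeta q^R\},\qquad \Delta^{bqJ}_{a,b}=\{b^{-1}q,b^{-1}q^2,\dots\}\sqcup\{\dots,a^{-1}q^2,a^{-1}q\}$$ a symmetric function $F$ is viewed as the function $X\mapsto F(X)$ on $\Omega(\Delta)$ determined by the power sums $p_k(X)=\sum_{x\in X}x^k$, $k\ge1$. **Theorem.** Let $(a,b,c,d)$ be admissible. For $M\in\mathbb Z_{\ge0}$ put $$\varepsilon=\frac{q^{M+1}}{\sqrt{-ab}},\quad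 \zeta=\sqrt{-b/a},\quad L=M,\quad R=-M,\quad (s_0,s_1,s_2,s_3)=\Bigl(\varepsilon c,\ \varepsilon d,\ -\frac q{\varepsilon a},\ -\frac q{\varepsilon b}\Bigr).$$ 1. For every $M$ there is a unique probability measure $M^{qR}_{q,\zeta,s_0,s_1,s_2,s_3}$ on $\Omega(\Delta^{qR}_{M,-M})$ with $\int\Phi^{qR}_\lambda(X;q;s_0,s_1,s_2,s_3)\,dM^{qR}(X)=\delta_{\lambda,\emptyset}$ for all partitions $\lambda$. 2. There is a unique probability measure $M^{bqJ}_{q,a,b,c,d}$ on $\Omega(\Delta^{bqJ}_{a,b})$ such that the functions $\Phi^{bqJ}_\lambda(\,\cdot\,;q;a,b,c,d)$, $\lambda$ ranging over all partitions, form an orthogonal basis of the Hilbert space $L^2(\Omega(\Delta^{bqJ}_{a,b}),M^{bqJ}_{q,a,b,c,d})$. 3. Let $\widetilde M^{qR}_{q,\zeta,s_0,s_1,s_2,s_3}$ be the pushforward of $M^{qR}_{q,\zeta,s_0,s_1,s_2,s_3}$ under the map $X\mapsto\varepsilon X$ from $\Omega(\Delta^{qR}_{M,-M})$ to $\Omega(\Delta^{bqJ}_{a,b})$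 (the homothety $x\mapsto\varepsilon x$ maps the first grid bijectively onto the second). As $M\to\infty$, the measures $\widetilde M^{qR}_{q,\zeta,s_0,s_1,s_2,s_3}$ converge weakly to $M^{bqJ}_{q,a,b,c,d}$. -/

import Mathlib

open MeasureTheory Filter Topology

/-! ### Point configurations on a two-sided `q`-grid -/

/-- The set `{l, l q, l q², …} ∪ {…, r q², r q, r}`. -/
def doubleGrid (q l r : ℝ) : Set ℝ := {x | ∃ n : ℕ, x = l * q ^ n ∨ x = r * q ^ n}

instance doubleGrid_countable (q l r : ℝ) : Countable (doubleGrid q l r) := by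
  have h : doubleGrid q l r ⊆
      Set.range (fun n : ℕ => l * q ^ n) ∪ Set.range (fun n : ℕ => r * q ^ n) := by
    rintro x ⟨n, hn | hn⟩
    · exact Or.inl ⟨n, hn.symm⟩
    · exact Or.inr ⟨n, hn.symm⟩
  exact (((Set.countable_range _).union (Set.countable_range _)).mono h).to_subtype

/-- The `q`-Racah grid `{-ζ⁻¹q^{-L}, -ζ⁻¹q^{1-L}, …} ⊔ {…, ζq^{R+1}, ζq^R}`. -/
abbrev qRacahGrid (q ζ : ℝ) (L R : ℤ) : Set ℝ :=
  doubleGrid q (-(ζ⁻¹ * q ^ (-L))) (ζ * q ^ R)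

/-- The big `q`-Jacobi grid `{b⁻¹q, b⁻¹q², …} ⊔ {…, a⁻¹q², a⁻¹q}`. -/
abbrev bigQJacobiGrid (q a b : ℝ) : Set ℝ := doubleGrid q (b⁻¹ * q) (a⁻¹ * q)

/-- Point configurations (subsets) of `Δ`, identified with `{0,1}^Δ`; the topology and the
σ-algebra are the product ones. -/
abbrev Config (Δ : Set ℝ) : Type := ↥Δ → Bool

open Classical in
/-- The configuration `εX = {εx : x ∈ X}`, as a configuration on `Δ'`. -/
noncomputable def Config.rescale {Δ : Set ℝ} (Δ' : Set ℝ) (ε : ℝ) (X : Config Δ) : Config Δ' :=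
  fun y => decide (∃ x : Δ, X x = true ∧ ε * (x : ℝ) = y)

theorem Config.measurable_rescale {Δ : Set ℝ} [Countable Δ] (Δ' : Set ℝ) (ε : ℝ) :
    Measurable (Config.rescale (Δ := Δ) Δ' ε) := by
  refine measurable_pi_lambda _ fun y => measurable_to_bool ?_
  have h : (fun X : Config Δ => Config.rescale Δ' ε X y) ⁻¹' {true} =
      ⋃ x : Δ, {X : Config Δ | X x = true ∧ ε * (x : ℝ) = y} := by
    ext X
    simp [Config.rescale]
  rw [h]
  refine MeasurableSet.iUnion fun x => ?_
  have hx : MeasurableSet {X : Config Δ | X x = true} :=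
    (measurable_pi_apply (X := fun _ : Δ => Bool) x) (measurableSet_singleton true)
  exact hx.inter (MeasurableSet.const _)

/-! ### The algebra of symmetric functions -/

/-- The algebra of symmetric functions over `ℂ`, as the algebra of polynomials in the power sums
`p₁, p₂, …`; the variable with index `k` is `p_{k+1}`. -/
abbrev SymFun : Type := MvPolynomial ℕ ℂ

/-- `F(x₀, x₁, …)` for a sequence `x` with finitely many nonzero terms. -/
noncomputable def SymFun.evalFin (x : ℕ →₀ ℂ) (F : SymFun) : ℂ :=
  MvPolynomial.aeval (fun k : ℕ => x.sum fun _ t => t ^ (k + 1)) F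

open Classical in
/-- `F(X)` for a point configuration `X`, where `p_k(X) = ∑_{x ∈ X} x^k`. -/
noncomputable def SymFun.evalConfig {Δ : Set ℝ} (X : Config Δ) (F : SymFun) : ℂ :=
  MvPolynomial.aeval
    (fun k : ℕ => ∑' x : Δ, if X x = true then (((x : ℝ) : ℂ)) ^ (k + 1) else 0) F

/-- The automorphism `F(x₁, x₂, …) ↦ F(c x₁, c x₂, …)`. -/
noncomputable def SymFun.dilate (c : ℂ) : SymFun →ₐ[ℂ] SymFun :=
  MvPolynomial.aeval fun k : ℕ => MvPolynomial.C (c ^ (k + 1)) * MvPolynomial.X k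

/-- Convergence of `N`-variate symmetric polynomials `F_N` to `G` as `N → ∞`: the degrees are
bounded, and `F_N(x₁, …, x_L, 0, …, 0) → G(x₁, …, x_L, 0, 0, …)` for every finite tuple. -/
def SymFun.IsLimit (F : ∀ N : ℕ, MvPolynomial (Fin N) ℂ) (G : SymFun) : Prop :=
  (∃ D : ℕ, ∀ N, (F N).totalDegree ≤ D) ∧
    ∀ x : ℕ →₀ ℂ, Tendsto (fun N => MvPolynomial.eval (fun i : Fin N => x i) (F N)) atTop
      (𝓝 (SymFun.evalFin x G))

/-- The limit in the sense of `SymFun.IsLimit`. -/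
noncomputable def SymFun.lim (F : ∀ N : ℕ, MvPolynomial (Fin N) ℂ) : SymFun :=
  Classical.epsilon (SymFun.IsLimit F)

/-! ### Multiparameter Schur polynomials -/

/-- `(x | c₀, c₁, …)^m = (x - c₀) ⋯ (x - c_{m-1})`. -/
noncomputable def newtonPoly {R : Type*} [CommRing R] (c : ℕ → R) (m : ℕ) : Polynomial R :=
  ∏ t ∈ Finset.range m, (Polynomial.X - Polynomial.C (c t))

/-- The Vandermonde product `∏_{i<j} (x_i - x_j)`. -/
def vdm {R : Type*} [CommRing R] {N : ℕ} (x : Fin N → R) : R :=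
  ∏ i : Fin N, ∏ j ∈ Finset.Ioi i, (x i - x j)

theorem vdm_dvd_det {R : Type*} [CommRing R] {N : ℕ} (x : Fin N → R)
    (f : Fin N → Polynomial R) :
    vdm x ∣ (Matrix.of fun i j => (f i).eval (x j)).det := by
  induction N with
  | zero => simp [vdm]
  | succ n ih =>
    have hg : ∀ i, ∃ g : Polynomial R,
        f i - Polynomial.C ((f i).eval (x 0)) = (Polynomial.C (x 0) - Polynomial.X) * g := by
      intro i
      obtain ⟨g, hg⟩ := Polynomial.X_sub_C_dvd_sub_C_eval (p := f i) (a := x 0)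
      exact ⟨-g, by rw [hg]; ring⟩
    choose g hg using hg
    have key : (Matrix.of fun i j => (f i).eval (x j)).det =
        (Matrix.of fun i j : Fin (n + 1) =>
          (Fin.cons 1 (fun k : Fin n => x 0 - x k.succ) : Fin (n + 1) → R) j *
          (Fin.cons ((f i).eval (x 0)) (fun k : Fin n => (g i).eval (x k.succ)) :
            Fin (n + 1) → R) j).det := by
      rw [← Matrix.det_transpose, ← Matrix.det_transpose (Matrix.of fun i j : Fin (n + 1) => _ * _)]
      refine Matrix.det_eq_of_forall_row_eq_smul_add_const (fun j => if j = 0 then 0 else 1) 0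
        (by simp) ?_
      intro j i
      refine Fin.cases ?_ (fun k => ?_) j
      · simp
      · have hk := congrArg (Polynomial.eval (x k.succ)) (hg i)
        simp only [Polynomial.eval_sub, Polynomial.eval_C, Polynomial.eval_mul,
          Polynomial.eval_X] at hk
        simp [← hk]
    have hmul := Matrix.det_mul_row
      (Fin.cons 1 (fun k : Fin n => x 0 - x k.succ) : Fin (n + 1) → R)
      (Matrix.of fun i : Fin (n + 1) => (Fin.cons ((f i).eval (x 0))
        (fun k : Fin n => (g i).eval (x k.succ)) : Fin (n + 1) → R))
    have hv : vdm x = (∏ k : Fin n, (x 0 - x k.succ)) * vdm (fun k : Fin n => x k.succ) := by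
      simp only [vdm, Fin.prod_univ_succ]
      congr 1
      · rw [Fin.Ioi_zero_eq_map, Finset.prod_map]
        rfl
      · refine Finset.prod_congr rfl fun i _ => ?_
        rw [Fin.Ioi_succ, Finset.prod_map]
        rfl
    have hprod : (∏ i, (Fin.cons 1 (fun k : Fin n => x 0 - x k.succ) : Fin (n + 1) → R) i) =
        ∏ k : Fin n, (x 0 - x k.succ) := by
      simp [Fin.prod_univ_succ]
    rw [hprod] at hmul
    rw [key, hv]
    refine Dvd.dvd.trans (mul_dvd_mul_left _ ?_) (dvd_of_eq hmul.symm)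
    rw [Matrix.det_succ_column_zero]
    refine Finset.dvd_sum fun i _ => Dvd.dvd.mul_left ?_ _
    exact ih (fun k : Fin n => x k.succ) (fun k => g (i.succAbove k))

/-- The alternant `det[(x_j | c₀, c₁, …)^{μ_i + N - i}]`, with rows counted from `0`. -/
noncomputable def alternant (c : ℕ → ℂ) (μ : YoungDiagram) (N : ℕ) : MvPolynomial (Fin N) ℂ :=
  (Matrix.of fun i j : Fin N =>
    (newtonPoly (fun t => (MvPolynomial.C (c t) : MvPolynomial (Fin N) ℂ))
      (μ.rowLen i + (N - 1 - i))).eval (MvPolynomial.X j)).det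

/-- The multiparameter Schur polynomial `s_{μ|N}(x₁, …, x_N | c₀, c₁, …)`: the quotient of the
alternant by the Vandermonde product, and `0` if `μ` has more than `N` rows. -/
noncomputable def multiSchur (c : ℕ → ℂ) (μ : YoungDiagram) (N : ℕ) : MvPolynomial (Fin N) ℂ :=
  if μ.colLen 0 ≤ N then
    Classical.choose (show vdm (MvPolynomial.X : Fin N → MvPolynomial (Fin N) ℂ) ∣
      alternant c μ N from vdm_dvd_det _ _)
  else 0

/-! ### Interpolation symmetric functions -/

/-- Type A: the limit of `s_{μ|N}( · | q^{N-1}, q^{N-2}, …)`. -/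
noncomputable def interpA (q : ℝ) (μ : YoungDiagram) : SymFun :=
  SymFun.lim fun N => multiSchur (fun i => (q : ℂ) ^ ((N : ℤ) - i - 1)) μ N

/-- Type BC: the limit of
`s_{μ|N}( · | s⁻¹q^{N-1} - s, s⁻¹q^{N-2} - sq, …)`. The nodes are the rescaled values of
`v - v⁻¹` at the zeros of `(sv, -sv⁻¹; q)_m`. -/
noncomputable def interpBC (q : ℝ) (s : ℂ) (μ : YoungDiagram) : SymFun :=
  SymFun.lim fun N =>
    multiSchur (fun i => s⁻¹ * (q : ℂ) ^ ((N : ℤ) - i - 1) - s * (q : ℂ) ^ i) μ N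

/-! ### `q`-Racah and big `q`-Jacobi symmetric functions -/

/-- The `q`-Pochhammer symbol `(x; q)_n`. -/
def qPoch (x q : ℂ) (n : ℕ) : ℂ := ∏ k ∈ Finset.range n, (1 - x * q ^ k)

theorem YoungDiagram.finite_setOf_le (l : YoungDiagram) : {m : YoungDiagram | m ≤ l}.Finite := by
  refine Set.Finite.of_finite_image (f := YoungDiagram.cells)
    (l.cells.powerset.finite_toSet.subset ?_) ?_
  · rintro _ ⟨m, hm, rfl⟩
    simpa using YoungDiagram.cells_subset_iff.2 hm
  · intro m _ m' _ h
    exact YoungDiagram.ext h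

/-- The coefficient `σ^{qR}(l, m; q; s₀, s₁, s₂, s₃)`. Rows and columns of the determinant are
counted from `0`, and `1/(q; q)_n = 0` for `n < 0`. -/
noncomputable def sigmaQRacah (q : ℝ) (s₀ s₁ s₂ s₃ : ℂ) (l m : YoungDiagram) : ℂ :=
  s₀ ^ ((m.card : ℤ) - l.card) *
    (Matrix.of fun j k : Fin (l.colLen 0) =>
      let n : ℤ := (l.rowLen j : ℤ) - j - m.rowLen k + k
      let u : ℂ := (q : ℂ) ^ ((m.rowLen k : ℤ) - k)
      if n < 0 then 0 else
        (qPoch (-s₀ * s₁ * u) q n.toNat * qPoch (-s₀ * s₂ * u) q n.toNat *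
            qPoch (-s₀ * s₃ * u) q n.toNat) /
          (u ^ n * qPoch q q n.toNat *
            qPoch (s₀ * s₁ * s₂ * s₃ * (q : ℂ) ^ ((l.rowLen j : ℤ) + m.rowLen k - 1 - j - k))
              q n.toNat)).det

/-- The `q`-Racah symmetric function `Φ^{qR}_l( · ; q; s₀, s₁, s₂, s₃)`. -/
noncomputable def qRacahFun (q : ℝ) (s₀ s₁ s₂ s₃ : ℂ) (l : YoungDiagram) : SymFun :=
  ∑ m ∈ (YoungDiagram.finite_setOf_le l).toFinset,
    sigmaQRacah q s₀ s₁ s₂ s₃ l m • interpBC q s₀ m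

/-- The coefficient `σ^{bqJ}(l, m; q; a, b, c, d)`, with the conventions of `sigmaQRacah`. -/
noncomputable def sigmaBigQJacobi (q a b : ℝ) (c d : ℂ) (l m : YoungDiagram) : ℂ :=
  c ^ (-(l.card : ℤ)) *
    (Matrix.of fun j k : Fin (l.colLen 0) =>
      let n : ℤ := (l.rowLen j : ℤ) - j - m.rowLen k + k
      let u : ℂ := (q : ℂ) ^ ((m.rowLen k : ℤ) - k)
      if n < 0 then 0 else
        (qPoch (c / a * q * u) q n.toNat * qPoch (c / b * q * u) q n.toNat) /
          (u ^ n * qPoch q q n.toNat *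
            qPoch (c * d / (a * b) * (q : ℂ) ^ ((l.rowLen j : ℤ) + m.rowLen k + 1 - j - k))
              q n.toNat)).det

/-- The big `q`-Jacobi symmetric function `Φ^{bqJ}_l( · ; q; a, b, c, d)`. -/
noncomputable def bigQJacobiFun (q a b : ℝ) (c d : ℂ) (l : YoungDiagram) : SymFun :=
  ∑ m ∈ (YoungDiagram.finite_setOf_le l).toFinset,
    sigmaBigQJacobi q a b c d l m • SymFun.dilate c (interpA q m)

/-! ### Orthogonality measures -/

/-- Admissible parameters of the big `q`-Jacobi symmetric functions. -/
def BigQJacobiAdmissible (q a b : ℝ) (c d : ℂ) : Prop :=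
  b < 0 ∧ 0 < a ∧
    ((d = (starRingEnd ℂ) c ∧ c.im ≠ 0) ∨
      (∃ c' d' : ℝ, c = c' ∧ d = d' ∧ ∃ m : ℤ,
        c' ∈ Set.Ioo (a * q ^ m) (a * q ^ (m - 1)) ∧
          d' ∈ Set.Ioo (a * q ^ m) (a * q ^ (m - 1))) ∨
      (∃ c' d' : ℝ, c = c' ∧ d = d' ∧ ∃ m : ℤ,
        c' ∈ Set.Ioo (b * q ^ (m - 1)) (b * q ^ m) ∧
          d' ∈ Set.Ioo (b * q ^ (m - 1)) (b * q ^ m)))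

/-- `P` satisfies `⟨P, Φ^{qR}_l⟩ = δ_{l,∅}` for all partitions `l`. -/
def IsQRacahMeasure (q ζ : ℝ) (L R : ℤ) (s₀ s₁ s₂ s₃ : ℂ)
    (P : ProbabilityMeasure (Config (qRacahGrid q ζ L R))) : Prop :=
  ∀ l : YoungDiagram,
    Integrable (fun X : Config (qRacahGrid q ζ L R) => (qRacahFun q s₀ s₁ s₂ s₃ l).evalConfig X) (P : Measure (Config (qRacahGrid q ζ L R))) ∧
    ∫ X, (qRacahFun q s₀ s₁ s₂ s₃ l).evalConfig X ∂(P : Measure (Config (qRacahGrid q ζ L R))) =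
      Set.indicator {⊥} (fun _ => (1 : ℂ)) l

/-- The functions `Φ^{bqJ}_l` form an orthogonal basis of the Hilbert space `L²(P)`. -/
def IsBigQJacobiMeasure (q a b : ℝ) (c d : ℂ)
    (P : ProbabilityMeasure (Config (bigQJacobiGrid q a b))) : Prop :=
  ∃ e : YoungDiagram → Lp ℂ 2 (P : Measure (Config (bigQJacobiGrid q a b))),
    (∀ l, (e l : Config (bigQJacobiGrid q a b) → ℂ) =ᵐ[(P : Measure (Config (bigQJacobiGrid q a b)))]
      fun X => (bigQJacobiFun q a b c d l).evalConfig X) ∧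
    (∀ l, e l ≠ 0) ∧
    (∀ l m, l ≠ m → inner ℂ (e l) (e m) = 0) ∧
    (Submodule.span ℂ (Set.range e)).topologicalClosure = ⊤

/-! ### Parameters of the limit transition -/

/-- `ε = q^{M+1}/√(-ab)`. -/
noncomputable def epsPar (q a b : ℝ) (M : ℕ) : ℝ := q ^ (M + 1) / √(-(a * b))

/-- `ζ = √(-b/a)`. -/
noncomputable def zetaPar (a b : ℝ) : ℝ := √(-b / a)

/-- `P` is the `q`-Racah orthogonality measure with parameters `ζ = √(-b/a)`, `L = M`, `R = -M`,
`(s₀, s₁, s₂, s₃) = (εc, εd, -q/(εa), -q/(εb))`. -/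
def IsQRacahMeasureAt (q a b : ℝ) (c d : ℂ) (M : ℕ)
    (P : ProbabilityMeasure (Config (qRacahGrid q (zetaPar a b) (M : ℤ) (-(M : ℤ))))) : Prop :=
  IsQRacahMeasure q (zetaPar a b) (M : ℤ) (-(M : ℤ))
    (epsPar q a b M * c) (epsPar q a b M * d)
    (-q / (epsPar q a b M * a)) (-q / (epsPar q a b M * b)) P

/-! Both families of symmetric functions belong to one family with a parameter $\delta$. Under the
homothety $x\mapsto\varepsilon x$ the $q$-Racah function becomes, up to the factor
$\varepsilon^{|\lambda|}$, the function `scaledFun` built on the nodes $c^{-1}q^{N-i-1}-\delta cq^i$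
with $\delta=\varepsilon^2$; the value $\delta=0$ gives the big $q$-Jacobi function
(`aeval_qRacahFun`, `aeval_bigQJacobiFun`). The rescaled grid is the same for every $M$, so
everything happens on one compact space of configurations, with $\delta\to0$ as $M\to\infty$.

Interpolation functions are controlled by a Jacobi–Trudi formula (`det_newtonPoly_eq`): an alternant
of Newton polynomials divided by the Vandermonde product is a determinant of complete homogeneous
functions, each row using the power sums of $x$ minus those of an initial segment of the nodes. The
size of the determinant does not grow with $N$, so the limits in $\mathrm{Sym}$ reduce to limits of
power sums of nodes (`isLimit_multiSchur`, `tendsto_nodeSums`). The formula also yields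
unitriangularity against Schur functions, hence `span_scaledFun`; with Stone–Weierstrass, these
functions span a dense subspace of the continuous functions on configurations (`span_scaledMap`).

For fixed $M$ the measure comes from $N$-particle ensembles. The univariate polynomials `racahPoly`
are eigenfunctions of a second-order $q$-difference operator (`racahPoly_operator`). On a grid of
$N+2M$ points its coefficients vanish at the two ends, and admissibility makes them negative
elsewhere. Detailed balance then gives a positive weight, and distinct eigenvalues give
orthogonality (`exists_racah_weight`). Cauchy–Binet and Andréief's identity lift this to $N$-variate
polynomials orthogonal under a probability weight (`exists_racah_ensemble`). Ratios of consecutive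
squared norms are coefficients of the three-term recurrence, which converge when the degree minus
$N$ stays fixed (`tendsto_racahRatio`).

Each point of the finite grid is $O(q^{N/2})$-close to a point of the limit grid, so moving $N$
particles there changes power sums by $O(Nq^{N/2})$. The orthogonality relations therefore survive
as $N\to\infty$ (`tendsto_sum_racah_ensemble`), and compactness together with density produces the
measure (`exists_scaled_measure`). The same argument with $\delta\to0$ gives the big $q$-Jacobi
measure and the weak convergence simultaneously (`exists_limit_measure`). The norms at $\delta=0$
are nonzero because the limiting ratios factor explicitly (`limitRatio_zero_ne_zero`).

Uniqueness holds because $\Phi_\emptyset=1$: either defining condition fixes the integrals of a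
family with dense span. -/

/-! ### Complete homogeneous symmetric functions and the Jacobi–Trudi identity -/

/-- The complete homogeneous symmetric functions, given by Newton's recursion
`k h_k = ∑ p_i h_{k-i}`. -/
noncomputable def hsym : ℕ → SymFun
  | 0 => 1
  | k + 1 => MvPolynomial.C ((k + 1 : ℂ)⁻¹) *
      ∑ i : Fin (k + 1), MvPolynomial.X (i : ℕ) * hsym (k - i)
  decreasing_by omega

/-- The complete homogeneous function with power sums `P`, indexed by integers. -/
noncomputable def hval {R : Type*} [CommRing R] [Algebra ℂ R] (P : ℕ → R) (z : ℤ) : R :=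
  if z < 0 then 0 else MvPolynomial.aeval P (hsym z.toNat)

/-! ### Power series with a prescribed logarithmic derivative -/

section Series

variable {R : Type*} [CommRing R]

/-- The power series `F` is `exp (∑ P_k z^{k+1} / (k+1))`. -/
def IsExpSeries (P : ℕ → R) (F : PowerSeries R) : Prop :=
  PowerSeries.constantCoeff F = 1 ∧ PowerSeries.derivative R F = F * PowerSeries.mk P

theorem IsExpSeries.one : IsExpSeries (0 : ℕ → R) 1 := by
  constructor
  · simp
  · have : PowerSeries.mk (0 : ℕ → R) = 0 := by ext; simp
    rw [this]; simp

theorem IsExpSeries.mul {P Q : ℕ → R} {F G : PowerSeries R} (hF : IsExpSeries P F)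
    (hG : IsExpSeries Q G) : IsExpSeries (P + Q) (F * G) := by
  constructor
  · rw [map_mul, hF.1, hG.1, one_mul]
  · have : PowerSeries.mk (P + Q) = PowerSeries.mk P + PowerSeries.mk Q := by ext; simp
    rw [Derivation.leibniz, hF.2, hG.2, this, smul_eq_mul, smul_eq_mul]
    ring

theorem IsExpSeries.prod {ι : Type*} (s : Finset ι) {P : ι → ℕ → R} {F : ι → PowerSeries R}
    (h : ∀ i ∈ s, IsExpSeries (P i) (F i)) : IsExpSeries (∑ i ∈ s, P i) (∏ i ∈ s, F i) := by
  classical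
  induction s using Finset.induction_on with
  | empty => simpa using IsExpSeries.one
  | insert i s hi ih =>
    rw [Finset.sum_insert hi, Finset.prod_insert hi]
    exact (h i (by simp)).mul (ih fun j hj => h j (by simp [hj]))

/-- The geometric series `1 / (1 - x z)`. -/
noncomputable def geomSeries (x : R) : PowerSeries R := PowerSeries.mk fun n => x ^ n

/-- The series `1 - x z`. -/
noncomputable def linSeries (x : R) : PowerSeries R := 1 - PowerSeries.C x * PowerSeries.X

theorem linSeries_mul_geomSeries (x : R) : linSeries x * geomSeries x = 1 := by
  ext n
  rw [linSeries, sub_mul, one_mul, mul_assoc, map_sub, PowerSeries.coeff_C_mul]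
  cases n with
  | zero => simp [geomSeries]
  | succ n =>
    rw [PowerSeries.coeff_succ_X_mul]
    simp [geomSeries, PowerSeries.coeff_one, pow_succ']

theorem mk_pow_succ (x : R) :
    PowerSeries.mk (fun k => x ^ (k + 1)) = PowerSeries.C x * geomSeries x := by
  ext n
  simp [geomSeries, pow_succ']

/-- A factor $1-xz$ in the numerator acts as a variable whose power sums are counted negatively.
This is how nodes come to be subtracted from variables. -/
theorem isExpSeries_linSeries (x : R) : IsExpSeries (fun k => -x ^ (k + 1)) (linSeries x) := by
  constructor
  · simp [linSeries]
  · have : PowerSeries.mk (fun k => -x ^ (k + 1)) = -(PowerSeries.C x * geomSeries x) := by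
      rw [← mk_pow_succ]; ext; simp
    rw [this, mul_neg, mul_left_comm, linSeries_mul_geomSeries, mul_one, linSeries, map_sub,
      Derivation.leibniz]
    simp

theorem isExpSeries_geomSeries (x : R) : IsExpSeries (fun k => x ^ (k + 1)) (geomSeries x) := by
  constructor
  · simp [geomSeries]
  · have h := congrArg (PowerSeries.derivative R) (linSeries_mul_geomSeries x)
    rw [Derivation.leibniz, (isExpSeries_linSeries x).2] at h
    have h3 : PowerSeries.mk (fun k => -x ^ (k + 1)) = -(PowerSeries.C x * geomSeries x) := by
      rw [← mk_pow_succ]; ext; simp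
    have h4 : PowerSeries.derivative R (1 : PowerSeries R) = 0 := by simp
    rw [h3, h4, smul_eq_mul, smul_eq_mul] at h
    rw [mk_pow_succ]
    have h5 := linSeries_mul_geomSeries x
    calc PowerSeries.derivative R (geomSeries x)
        = (linSeries x * geomSeries x) * PowerSeries.derivative R (geomSeries x) := by
          rw [h5, one_mul]
      _ = geomSeries x * (linSeries x * PowerSeries.derivative R (geomSeries x)) := by ring
      _ = geomSeries x * (linSeries x * geomSeries x * (PowerSeries.C x * geomSeries x)) := by
          congr 1; linear_combination h
      _ = _ := by rw [h5, one_mul]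

/-- Multiplication by $1-c_mz$ subtracts $c_m$ times the preceding coefficient. From degree $m$ on
the coefficients form a geometric progression of ratio $x$, so the effect there is a factor $x-c_m$
and a shift of the starting degree by one. -/
theorem coeff_prod_linSeries_mul_geomSeries (c : ℕ → R) (x : R) (m k : ℕ) :
    PowerSeries.coeff (m + k) ((∏ s ∈ Finset.range m, linSeries (c s)) * geomSeries x) =
      x ^ k * (newtonPoly c m).eval x := by
  induction m generalizing k with
  | zero => simp [newtonPoly, geomSeries]
  | succ m ih =>
    have h : (∏ s ∈ Finset.range (m + 1), linSeries (c s)) * geomSeries x =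
        (∏ s ∈ Finset.range m, linSeries (c s)) * geomSeries x -
        PowerSeries.C (c m) * (PowerSeries.X *
          ((∏ s ∈ Finset.range m, linSeries (c s)) * geomSeries x)) := by
      rw [Finset.prod_range_succ, linSeries]; ring
    rw [h, map_sub, PowerSeries.coeff_C_mul, show m + 1 + k = (m + k) + 1 by ring,
      PowerSeries.coeff_succ_X_mul, ih, show m + k + 1 = m + (k + 1) by ring, ih]
    rw [newtonPoly, newtonPoly, Finset.prod_range_succ, Polynomial.eval_mul, Polynomial.eval_sub,
      Polynomial.eval_X, Polynomial.eval_C]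
    ring

/-- The power sums `p_{k+1}` of a finite family. -/
def psums {ι : Type*} [Fintype ι] (x : ι → R) (k : ℕ) : R := ∑ j, x j ^ (k + 1)

theorem degree_prod_linSeries {ι : Type*} (s : Finset ι) (x : ι → R) {k : ℕ} (hk : s.card < k) :
    PowerSeries.coeff k (∏ i ∈ s, linSeries (x i)) = 0 := by
  classical
  induction s using Finset.induction_on generalizing k with
  | empty =>
    rw [Finset.prod_empty, PowerSeries.coeff_one, if_neg]
    simp at hk; omega
  | insert i s hi ih =>
    rw [Finset.card_insert_of_notMem hi] at hk
    obtain ⟨k, rfl⟩ : ∃ l, k = l + 1 := ⟨k - 1, by omega⟩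
    rw [Finset.prod_insert hi, linSeries, sub_mul, one_mul, mul_assoc, map_sub,
      PowerSeries.coeff_C_mul, PowerSeries.coeff_succ_X_mul, ih (by omega), ih (by omega)]
    simp

theorem isExpSeries_jacobiTrudi {N : ℕ} (x : Fin N → R) (c : ℕ → R) (m : ℕ) :
    IsExpSeries (fun k => psums x k - ∑ s ∈ Finset.range m, c s ^ (k + 1))
      ((∏ s ∈ Finset.range m, linSeries (c s)) * ∏ j, geomSeries (x j)) := by
  have h := (IsExpSeries.prod (Finset.range m) fun s _ => isExpSeries_linSeries (c s)).mul
    (IsExpSeries.prod Finset.univ fun j _ => isExpSeries_geomSeries (x j))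
  convert h using 1
  funext k
  simp [psums, Finset.sum_apply]
  ring

theorem det_pow_eq_vdm {N : ℕ} (x : Fin N → R) :
    (Matrix.of fun i j : Fin N => x j ^ (N - 1 - (i : ℕ))).det = vdm x := by
  have h := Matrix.det_projVandermonde (fun _ => (1 : R)) x
  rw [← Matrix.det_transpose] at h
  rw [vdm]
  convert h using 2
  · ext i j
    simp only [Matrix.of_apply, Matrix.transpose_apply, Matrix.projVandermonde_apply, one_pow,
      one_mul, Fin.val_rev]
    congr 1
    omega
  · simp

/-- Expansion along the last row removes the rows beyond `r` one at a time. All statements that a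
determinant does not depend on the number of rows used go through this lemma. -/
theorem det_eq_of_unitriangular {A : ℕ → ℕ → R} {r : ℕ} (h0 : ∀ j, r ≤ j → ∀ k < j, A j k = 0)
    (h1 : ∀ j, r ≤ j → A j j = 1) {N : ℕ} (hN : r ≤ N) :
    (Matrix.of fun i j : Fin N => A i j).det = (Matrix.of fun i j : Fin r => A i j).det := by
  induction N, hN using Nat.le_induction with
  | base => rfl
  | succ N hN ih =>
    rw [← ih, Matrix.det_succ_row _ (Fin.last N), Finset.sum_eq_single (Fin.last N)]
    · simp only [Matrix.of_apply, Fin.val_last, h1 N hN]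
      rw [← two_mul, pow_mul, neg_one_sq, one_pow, one_mul, one_mul]
      congr 1
      ext i j
      simp [Matrix.submatrix_apply, Fin.succAbove_last]
    · intro k _ hk
      rw [Matrix.of_apply, Fin.val_last, h0 N hN k (Fin.val_lt_last hk)]
      simp
    · simp

variable [Algebra ℂ R]

theorem hval_neg (P : ℕ → R) {z : ℤ} (hz : z < 0) : hval P z = 0 := if_pos hz

theorem hval_natCast (P : ℕ → R) (k : ℕ) : hval P k = MvPolynomial.aeval P (hsym k) := by
  simp [hval]

theorem hval_zero (P : ℕ → R) : hval P 0 = 1 := by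
  simp [hval, hsym]

theorem hval_map {S : Type*} [CommRing S] [Algebra ℂ S] (φ : R →ₐ[ℂ] S) (P : ℕ → R) (z : ℤ) :
    φ (hval P z) = hval (fun k => φ (P k)) z := by
  unfold hval
  split_ifs
  · simp
  · rw [MvPolynomial.aeval_def, MvPolynomial.aeval_def, ← MvPolynomial.coe_eval₂Hom,
      ← MvPolynomial.coe_eval₂Hom, ← RingHom.coe_coe φ, ← RingHom.comp_apply]
    congr 1
    ext <;> simp

theorem aeval_hsym_succ (P : ℕ → R) (k : ℕ) :
    ((k : R) + 1) * MvPolynomial.aeval P (hsym (k + 1)) =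
      ∑ i ∈ Finset.range (k + 1), P i * MvPolynomial.aeval P (hsym (k - i)) := by
  have h : (((k : ℂ) + 1) : ℂ) ≠ 0 := by exact_mod_cast Nat.succ_ne_zero k
  rw [hsym, map_mul, map_sum, MvPolynomial.aeval_C, ← mul_assoc]
  have h2 : ((k : R) + 1) * algebraMap ℂ R ((k + 1 : ℂ)⁻¹) = 1 := by
    have : ((k : R) + 1) = algebraMap ℂ R ((k : ℂ) + 1) := by simp
    rw [this, ← map_mul, mul_inv_cancel₀ h, map_one]
  rw [h2, one_mul, Finset.sum_range]
  simp

/-- The equation $F'=FP$ is Newton's recursion for the coefficients of $F$, and $k+1$ is invertible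
in a $\mathbb C$-algebra. -/
theorem IsExpSeries.coeff_eq {P : ℕ → R} {F : PowerSeries R} (h : IsExpSeries P F) (k : ℕ) :
    PowerSeries.coeff k F = MvPolynomial.aeval P (hsym k) := by
  induction k using Nat.strong_induction_on with
  | _ k ih =>
    cases k with
    | zero => simpa [hsym] using h.1
    | succ k =>
      have h1 := congrArg (PowerSeries.coeff k) h.2
      rw [PowerSeries.coeff_derivative, mul_comm F,
        PowerSeries.coeff_mul, Finset.Nat.sum_antidiagonal_eq_sum_range_succ_mk] at h1
      have h2 : ((k : R) + 1) * PowerSeries.coeff (k + 1) F =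
          ((k : R) + 1) * MvPolynomial.aeval P (hsym (k + 1)) := by
        rw [mul_comm, h1, aeval_hsym_succ]
        refine Finset.sum_congr rfl fun i _ => ?_
        rw [PowerSeries.coeff_mk, ih _ (by omega)]
      have hu : IsUnit ((k : R) + 1) := by
        have : ((k : R) + 1) = algebraMap ℂ R ((k : ℂ) + 1) := by simp
        rw [this]
        exact (IsUnit.mk0 _ (by exact_mod_cast Nat.succ_ne_zero k)).map _
      exact hu.mul_left_cancel h2

/-- The coefficient of `z^k` for an integer `k`. -/
theorem coeff_eq_hval {P : ℕ → R} {F : PowerSeries R} (h : IsExpSeries P F) (k : ℕ) :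
    PowerSeries.coeff k F = hval P k := by
  rw [h.coeff_eq, hval_natCast]

/-- Write $1/(1-x_jz)=\prod_i(1-x_iz)^{-1}\cdot\prod_{i\ne j}(1-x_iz)$ and take the coefficient of
$z^m$ after multiplying by $\prod_{s<m}(1-c_sz)$. The first factor then does not involve $j$ and the
second does not involve $c$ or $m$, so an alternant becomes a product of two matrices. -/
theorem newtonPoly_eval_eq_sum {N : ℕ} (x : Fin N → R) (c : ℕ → R) (m : ℕ) (j : Fin N) :
    (newtonPoly c m).eval (x j) =
      ∑ k : Fin N, hval (fun a => psums x a - ∑ s ∈ Finset.range m, c s ^ (a + 1))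
          ((m : ℤ) + k + 1 - N) *
        PowerSeries.coeff (N - 1 - k) (∏ i ∈ Finset.univ.erase j, linSeries (x i)) := by
  set A := (∏ s ∈ Finset.range m, linSeries (c s)) with hA
  set W := ∏ j, geomSeries (x j) with hW
  set E := ∏ i ∈ Finset.univ.erase j, linSeries (x i) with hE
  have hWE : W * E = geomSeries (x j) := by
    rw [hW, hE, ← Finset.mul_prod_erase _ _ (Finset.mem_univ j), mul_assoc,
      ← Finset.prod_mul_distrib, Finset.prod_eq_one, mul_one]
    intro i _
    rw [mul_comm, linSeries_mul_geomSeries]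
  have h0 := coeff_prod_linSeries_mul_geomSeries c (x j) m 0
  rw [pow_zero, one_mul, add_zero] at h0
  rw [← h0, ← hWE, ← hA, ← mul_assoc, mul_comm, PowerSeries.coeff_mul,
    Finset.Nat.sum_antidiagonal_eq_sum_range_succ_mk]
  have hexp := isExpSeries_jacobiTrudi x c m
  rw [← hA, ← hW] at hexp
  have hcard : (Finset.univ.erase j).card = N - 1 := by simp
  have hpos : 0 < N := j.pos
  have hterm : ∀ r : ℕ, (if r ≤ m then PowerSeries.coeff r E * PowerSeries.coeff (m - r) (A * W)
      else 0) = hval (fun a => psums x a - ∑ s ∈ Finset.range m, c s ^ (a + 1))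
          ((m : ℤ) - r) * PowerSeries.coeff r E := by
    intro r
    split_ifs with h
    · rw [coeff_eq_hval hexp, Nat.cast_sub h, mul_comm]
    · rw [hval_neg _ (by omega), zero_mul]
  -- The Cauchy product runs over $r\le m$ and the claim over $r<N$. Both are compared with a common
  -- longer range: extra terms vanish because $h$ has negative index, or because $E$ has degree at
  -- most $N-1$.
  have h1 : ∑ r ∈ Finset.range m.succ, PowerSeries.coeff r E * PowerSeries.coeff (m - r) (A * W) =
      ∑ r ∈ Finset.range (m + 1 + N), (if r ≤ m then PowerSeries.coeff r E *
        PowerSeries.coeff (m - r) (A * W) else 0) := by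
    rw [← Finset.sum_subset (Finset.range_mono (show m + 1 ≤ m + 1 + N by omega))]
    · refine Finset.sum_congr rfl fun r hr => ?_
      rw [if_pos]
      simpa [Nat.lt_succ_iff] using hr
    · intro r _ hr
      rw [if_neg]
      simpa [Nat.lt_succ_iff] using hr
  have h2 : ∑ k : Fin N, hval (fun a => psums x a - ∑ s ∈ Finset.range m, c s ^ (a + 1))
          ((m : ℤ) + k + 1 - N) * PowerSeries.coeff (N - 1 - k) E =
      ∑ r ∈ Finset.range N, hval (fun a => psums x a - ∑ s ∈ Finset.range m, c s ^ (a + 1))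
          ((m : ℤ) - r) * PowerSeries.coeff r E := by
    rw [← Finset.sum_range_reflect, Finset.sum_range]
    refine Finset.sum_congr rfl fun k _ => ?_
    have := k.2
    congr 2
    omega
  rw [h1, h2, ← Finset.sum_subset (Finset.range_mono (show N ≤ m + 1 + N by omega))]
  · exact Finset.sum_congr rfl fun r _ => hterm r
  · intro r _ hr
    rw [hterm, hE, degree_prod_linSeries _ _ (by rw [hcard]; simp at hr; omega), mul_zero]

theorem det_jacobiTrudi_one (P : ℕ → ℕ → R) (N : ℕ) :
    (Matrix.of fun i k : Fin N => hval (P i) ((k : ℤ) - i)).det = 1 := by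
  have := det_eq_of_unitriangular (A := fun i k => hval (P i) ((k : ℤ) - i)) (r := 0)
    (fun j _ k hk => hval_neg _ (by omega)) (fun j _ => by simp [hval_zero]) (Nat.zero_le N)
  rw [this]; simp

/-- **Jacobi–Trudi** for generalized alternants. -/
theorem det_newtonPoly_eq {N : ℕ} (x : Fin N → R) (c : ℕ → R) (m : Fin N → ℕ) :
    (Matrix.of fun i j : Fin N => (newtonPoly c (m i)).eval (x j)).det =
      vdm x * (Matrix.of fun i k : Fin N =>
        hval (fun a => psums x a - ∑ s ∈ Finset.range (m i), c s ^ (a + 1))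
          ((m i : ℤ) + k + 1 - N)).det := by
  have key : ∀ (c : ℕ → R) (m : Fin N → ℕ),
      (Matrix.of fun i j : Fin N => (newtonPoly c (m i)).eval (x j)).det =
      (Matrix.of fun i k : Fin N =>
        hval (fun a => psums x a - ∑ s ∈ Finset.range (m i), c s ^ (a + 1))
          ((m i : ℤ) + k + 1 - N)).det * (Matrix.of fun k j : Fin N =>
      PowerSeries.coeff (N - 1 - k) (∏ i ∈ Finset.univ.erase j, linSeries (x i))).det := by
    intro c m
    rw [← Matrix.det_mul]
    congr 1
    ext i j
    simp only [Matrix.of_apply, Matrix.mul_apply]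
    exact newtonPoly_eval_eq_sum x c (m i) j
  -- The second matrix factor is the same for all nodes and exponents. Zero nodes and exponents
  -- $N-1-i$ make the first factor unimodular, which identifies the determinant of the second as the
  -- Vandermonde product.
  have h0 := key (fun _ => 0) (fun i => N - 1 - i)
  have h1 : (Matrix.of fun i k : Fin N =>
        hval (fun a => psums x a - ∑ s ∈ Finset.range (N - 1 - (i : ℕ)), (0 : R) ^ (a + 1))
          (((N - 1 - (i : ℕ) : ℕ) : ℤ) + k + 1 - N)).det = 1 := by
    rw [← det_jacobiTrudi_one (fun i a => psums x a - ∑ s ∈ Finset.range (N - 1 - (i : ℕ)),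
      (0 : R) ^ (a + 1)) N]
    congr 1
    ext i k
    simp only [Matrix.of_apply]
    congr 1
    have := i.2
    omega
  rw [h1, one_mul] at h0
  rw [key, ← h0, mul_comm]
  congr 1
  rw [← det_pow_eq_vdm]
  congr 1
  ext i j
  simp [newtonPoly]

end Series


/-! ### Symmetric functions are determined by their values -/

/-- The sequence `(z₀, …, z_{n-1}, 0, 0, …)`. -/
noncomputable def finsuppOfFin {n : ℕ} (z : Fin n → ℂ) : ℕ →₀ ℂ :=
  Finsupp.onFinset (Finset.range n) (fun i => if h : i < n then z ⟨i, h⟩ else 0)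
    (fun i hi => by
      by_contra h
      rw [Finset.mem_range] at h
      simp [h] at hi)

theorem sum_finsuppOfFin {n : ℕ} (z : Fin n → ℂ) (k : ℕ) :
    ((finsuppOfFin z).sum fun _ t => t ^ (k + 1)) = psums z k := by
  rw [finsuppOfFin, Finsupp.onFinset_sum _ (fun _ => by simp), Finset.sum_range, psums]
  refine Finset.sum_congr rfl fun i _ => ?_
  simp

theorem evalFin_finsuppOfFin {n : ℕ} (z : Fin n → ℂ) (F : SymFun) :
    F.evalFin (finsuppOfFin z) = MvPolynomial.aeval (psums z) F := by
  rw [SymFun.evalFin]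
  simp only [sum_finsuppOfFin]

theorem psums_equiv {R ι κ : Type*} [CommRing R] [Fintype ι] [Fintype κ] (e : ι ≃ κ) (x : κ → R) :
    psums (fun i => x (e i)) = psums x := by
  funext k
  exact Equiv.sum_comp e fun j => x j ^ (k + 1)

/-- The matrix $((j+1)^{i+1})$ is a transposed Vandermonde matrix with distinct nodes, times an
invertible diagonal matrix. -/
theorem powerSum_matrix_surjective (D : ℕ) (P : Fin D → ℂ) :
    ∃ n : Fin D → ℂ, ∀ i : Fin D, ∑ j : Fin D, n j * ((j : ℂ) + 1) ^ ((i : ℕ) + 1) = P i := by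
  set y : Fin D → ℂ := fun j => (j : ℂ) + 1 with hy
  have hinj : Function.Injective y := by
    intro a b h
    simpa [hy, Fin.ext_iff] using h
  have hdet : IsUnit (Matrix.vandermonde y).transpose.det := by
    rw [Matrix.det_transpose]
    exact isUnit_iff_ne_zero.2 (Matrix.det_vandermonde_ne_zero_iff.2 hinj)
  refine ⟨fun j => (y j)⁻¹ * ((Matrix.vandermonde y).transpose⁻¹.mulVec P) j, fun i => ?_⟩
  have h := congrFun (congrArg (fun A => A.mulVec P)
    (Matrix.mul_nonsing_inv (Matrix.vandermonde y).transpose hdet)) i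
  simp only [← Matrix.mulVec_mulVec, Matrix.one_mulVec] at h
  rw [← h, Matrix.mulVec, dotProduct]
  refine Finset.sum_congr rfl fun j _ => ?_
  have hne : y j ≠ 0 := by
    have : (((j : ℕ) + 1 : ℕ) : ℂ) ≠ 0 := by exact_mod_cast Nat.succ_ne_zero (j : ℕ)
    simpa [hy] using this
  rw [Matrix.transpose_apply, Matrix.vandermonde_apply, pow_succ]
  change (y j)⁻¹ * _ * (y j ^ (i : ℕ) * y j) = _
  field_simp

/-- Evaluate at $n_j$ copies of the value $j+1$. The first $D$ power sums are then linear in $n$, so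
$F$ becomes a polynomial in $n$ vanishing on $\mathbb N^D$, hence zero. That linear map is onto
$\mathbb C^D$, so $F$ itself vanishes. -/
theorem SymFun.eq_zero_of_aeval_psums {F : SymFun}
    (h : ∀ (n : ℕ) (z : Fin n → ℂ), MvPolynomial.aeval (psums z) F = 0) : F = 0 := by
  obtain ⟨D, hD⟩ : ∃ D : ℕ, ∀ i ∈ F.vars, i < D :=
    ⟨F.vars.sup id + 1, fun i hi => Nat.lt_succ_of_le (Finset.le_sup (f := id) hi)⟩
  obtain ⟨F', rfl⟩ := MvPolynomial.exists_rename_eq_of_vars_subset_range F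
    (Fin.val : Fin D → ℕ) Fin.val_injective (fun i hi => ⟨⟨i, hD i hi⟩, rfl⟩)
  set G : MvPolynomial (Fin D) ℂ := MvPolynomial.aeval
    (fun i : Fin D => ∑ j : Fin D, MvPolynomial.X j *
      MvPolynomial.C (((j : ℂ) + 1) ^ ((i : ℕ) + 1))) F' with hG
  have hev : ∀ n : Fin D → ℂ, MvPolynomial.eval n G = MvPolynomial.eval
      (fun i : Fin D => ∑ j : Fin D, n j * ((j : ℂ) + 1) ^ ((i : ℕ) + 1)) F' := by
    intro n
    rw [hG, ← MvPolynomial.coe_aeval_eq_eval, ← MvPolynomial.coe_aeval_eq_eval,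
      RingHom.coe_coe, RingHom.coe_coe, ← AlgHom.comp_apply]
    congr 1
    ext i
    simp
  have hG0 : G = 0 := by
    refine MvPolynomial.funext_set (fun _ => Set.range (Nat.cast : ℕ → ℂ))
      (fun _ => Set.infinite_range_of_injective Nat.cast_injective) fun n hn => ?_
    rw [map_zero, hev]
    choose m hm using fun i => hn i trivial
    let ι := Σ j : Fin D, Fin (m j)
    let e : Fin (Fintype.card ι) ≃ ι := (Fintype.equivFin ι).symm
    have h1 := h _ (fun s => (fun s : ι => ((s.1 : ℂ) + 1)) (e s))
    rw [psums_equiv e fun s : ι => ((s.1 : ℂ) + 1), MvPolynomial.aeval_rename] at h1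
    rw [← h1, ← MvPolynomial.coe_aeval_eq_eval, RingHom.coe_coe]
    congr 2
    funext i
    simp only [Function.comp, psums, ι, Fintype.sum_sigma, Finset.sum_const, Finset.card_univ,
      Fintype.card_fin, nsmul_eq_mul]
    exact Finset.sum_congr rfl fun j _ => by rw [hm]
  have hF : F' = 0 := by
    refine MvPolynomial.funext fun P => ?_
    obtain ⟨n, hn⟩ := powerSum_matrix_surjective D P
    rw [← funext hn, ← hev, hG0, map_zero, map_zero]
  rw [hF, map_zero]

theorem SymFun.ext_psums {F G : SymFun}
    (h : ∀ (n : ℕ) (z : Fin n → ℂ),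
      MvPolynomial.aeval (psums z) F = MvPolynomial.aeval (psums z) G) : F = G :=
  sub_eq_zero.1 (SymFun.eq_zero_of_aeval_psums fun n z => by rw [map_sub, h, sub_self])

/-- Limits are unique because values at finite tuples determine a symmetric function, so the choice
made by `Classical.epsilon` is immaterial. -/
theorem SymFun.IsLimit.lim_eq {F : ∀ N : ℕ, MvPolynomial (Fin N) ℂ} {G : SymFun}
    (h : SymFun.IsLimit F G) : SymFun.lim F = G := by
  have h' : SymFun.IsLimit F (SymFun.lim F) := Classical.epsilon_spec ⟨G, h⟩
  refine SymFun.ext_psums fun n z => ?_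
  rw [← evalFin_finsuppOfFin, ← evalFin_finsuppOfFin]
  exact tendsto_nhds_unique (h'.2 _) (h.2 _)

/-! ### Interpolation functions as Jacobi–Trudi determinants -/

section JacobiTrudi

variable {R : Type*} [CommRing R] [Algebra ℂ R]

/-- The Jacobi–Trudi determinant of shape `μ`; the power sums used in row `i` (counted from `0`)
are `P (i + 1 - μ_i)`. -/
noncomputable def jtDet (μ : YoungDiagram) (P : ℤ → ℕ → R) : R :=
  (Matrix.of fun i k : Fin (μ.colLen 0) =>
    hval (P ((i : ℤ) + 1 - μ.rowLen i)) ((μ.rowLen i : ℤ) - i + k)).det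

theorem jtDet_map {S : Type*} [CommRing S] [Algebra ℂ S] (φ : R →ₐ[ℂ] S) (μ : YoungDiagram)
    (P : ℤ → ℕ → R) : φ (jtDet μ P) = jtDet μ fun e a => φ (P e a) := by
  rw [jtDet, AlgHom.map_det, jtDet]
  congr 1
  ext i k
  simp [hval_map]

theorem YoungDiagram.rowLen_eq_zero {μ : YoungDiagram} {i : ℕ} (h : μ.colLen 0 ≤ i) :
    μ.rowLen i = 0 := by
  by_contra h0
  have : (i, 0) ∈ μ := YoungDiagram.mem_iff_lt_rowLen.2 (Nat.pos_of_ne_zero h0)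
  rw [YoungDiagram.mem_iff_lt_colLen] at this
  omega

theorem jtDet_eq_det {μ : YoungDiagram} (P : ℤ → ℕ → R) {N : ℕ} (hN : μ.colLen 0 ≤ N) :
    (Matrix.of fun i k : Fin N =>
      hval (P ((i : ℤ) + 1 - μ.rowLen i)) ((μ.rowLen i : ℤ) - i + k)).det = jtDet μ P :=
  det_eq_of_unitriangular
    (A := fun i k => hval (P ((i : ℤ) + 1 - μ.rowLen i)) ((μ.rowLen i : ℤ) - i + k))
    (fun j hj k hk => hval_neg _ (by rw [YoungDiagram.rowLen_eq_zero hj]; omega))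
    (fun j hj => by
      have : (μ.rowLen j : ℤ) - j + j = 0 := by rw [YoungDiagram.rowLen_eq_zero hj]; simp
      rw [this, hval_zero]) hN

/-- The power sums of the nodes `c₀, …, c_{N-e-1}`. -/
def nodeSums (c : ℕ → R) (N : ℕ) (e : ℤ) (a : ℕ) : R :=
  ∑ s ∈ Finset.range (N - e).toNat, c s ^ (a + 1)

/-- Row $i$ has exponent $N-e$ with $e=i+1-\mu_i$, so the number of nodes subtracted in it depends
on the shape only through $e$. The determinant shrinks to the number of rows of $\mu$. -/
theorem det_newtonPoly_rowLen {N : ℕ} (x : Fin N → R) (c : ℕ → R) {μ : YoungDiagram}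
    (hN : μ.colLen 0 ≤ N) :
    (Matrix.of fun i j : Fin N =>
      (newtonPoly c (μ.rowLen i + (N - 1 - i))).eval (x j)).det =
      vdm x * jtDet μ fun e a => psums x a - nodeSums c N e a := by
  rw [det_newtonPoly_eq x c (fun i => μ.rowLen i + (N - 1 - i)), ← jtDet_eq_det _ hN]
  congr 2
  ext i k
  have := i.2
  simp only [Matrix.of_apply, nodeSums]
  have h1 : ((N : ℤ) - (i + 1 - μ.rowLen i)).toNat = μ.rowLen i + (N - 1 - i) := by omega
  rw [h1]
  congr 1
  omega

theorem vdm_X_ne_zero (N : ℕ) : vdm (MvPolynomial.X : Fin N → MvPolynomial (Fin N) ℂ) ≠ 0 := by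
  refine Finset.prod_ne_zero_iff.2 fun i _ => Finset.prod_ne_zero_iff.2 fun j hj => ?_
  rw [sub_ne_zero]
  intro h
  exact (Finset.mem_Ioi.1 hj).ne (MvPolynomial.X_injective h)

theorem multiSchur_eq_jtDet (c : ℕ → ℂ) {μ : YoungDiagram} {N : ℕ} (hN : μ.colLen 0 ≤ N) :
    multiSchur c μ N = jtDet μ fun e a =>
      psums (MvPolynomial.X : Fin N → MvPolynomial (Fin N) ℂ) a -
        MvPolynomial.C (nodeSums c N e a) := by
  have h : vdm (MvPolynomial.X : Fin N → MvPolynomial (Fin N) ℂ) ∣ alternant c μ N :=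
    vdm_dvd_det _ _
  have h2 : multiSchur c μ N = Classical.choose h := by rw [multiSchur, if_pos hN]
  refine mul_left_cancel₀ (vdm_X_ne_zero N) ?_
  rw [h2, ← Classical.choose_spec h, alternant, det_newtonPoly_rowLen _ _ hN]
  simp [nodeSums]

/-! ### Uniform degree bounds and convergence of Jacobi–Trudi determinants -/

theorem totalDegree_hval {σ : Type*} {P : ℕ → MvPolynomial σ ℂ}
    (hP : ∀ a, (P a).totalDegree ≤ a + 1) (z : ℤ) : (hval P z).totalDegree ≤ z.toNat := by
  have key : ∀ k : ℕ, (MvPolynomial.aeval P (hsym k)).totalDegree ≤ k := by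
    intro k
    induction k using Nat.strong_induction_on with
    | _ k ih =>
      cases k with
      | zero => simp [hsym]
      | succ k =>
        rw [hsym, map_mul, MvPolynomial.aeval_C, map_sum, ← Algebra.smul_def]
        refine (MvPolynomial.totalDegree_smul_le _ _).trans
          ((MvPolynomial.totalDegree_finsetSum _ _).trans (Finset.sup_le fun i _ => ?_))
        rw [map_mul, MvPolynomial.aeval_X]
        refine (MvPolynomial.totalDegree_mul _ _).trans ?_
        have h1 := hP i
        have h2 := ih (k - i) (by omega)
        have := i.2
        omega
  unfold hval
  split_ifs
  · simp
  · exact key _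

theorem totalDegree_det_le {σ : Type*} {n D : ℕ} {A : Matrix (Fin n) (Fin n) (MvPolynomial σ ℂ)}
    (hA : ∀ i j, (A i j).totalDegree ≤ D) : A.det.totalDegree ≤ n * D := by
  rw [Matrix.det_apply]
  refine (MvPolynomial.totalDegree_finsetSum _ _).trans (Finset.sup_le fun s _ => ?_)
  have h : (∏ i, A (s i) i).totalDegree ≤ n * D := by
    refine (MvPolynomial.totalDegree_finsetProd _ _).trans ?_
    calc _ ≤ ∑ _i : Fin n, D := Finset.sum_le_sum fun i _ => hA _ _
      _ = n * D := by simp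
  rcases Int.units_eq_one_or (Equiv.Perm.sign s) with hs | hs
  · simpa [hs] using h
  · simpa [hs] using h

/-- The bound is uniform in $N$ because the Jacobi–Trudi determinant has as many rows as $\mu$, and
subtracting constants from power sums does not raise degrees. -/
theorem totalDegree_multiSchur_le (c : ℕ → ℂ) (μ : YoungDiagram) (N : ℕ) :
    (multiSchur c μ N).totalDegree ≤ μ.colLen 0 * (μ.rowLen 0 + μ.colLen 0) := by
  by_cases hN : μ.colLen 0 ≤ N
  · rw [multiSchur_eq_jtDet c hN]
    refine totalDegree_det_le fun i k => ?_
    refine (totalDegree_hval (fun a => ?_) _).trans ?_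
    · refine (MvPolynomial.totalDegree_sub _ _).trans (max_le ?_ (by simp))
      refine (MvPolynomial.totalDegree_finsetSum _ _).trans (Finset.sup_le fun j _ => ?_)
      simp
    · have := μ.rowLen_anti 0 i (Nat.zero_le _)
      have := k.2
      omega
  · rw [multiSchur, if_neg hN]; simp

theorem continuous_aeval (F : SymFun) : Continuous fun P : ℕ → ℂ => MvPolynomial.aeval P F := by
  induction F using MvPolynomial.induction_on with
  | C a => simpa using continuous_const
  | add p q hp hq => simp only [map_add]; exact hp.add hq
  | mul_X p i hp =>
    simp only [map_mul, MvPolynomial.aeval_X]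
    exact hp.mul (continuous_apply i)

theorem continuous_hval (z : ℤ) : Continuous fun P : ℕ → ℂ => hval P z := by
  unfold hval
  split_ifs
  · exact continuous_const
  · exact continuous_aeval _

theorem continuous_jtDet (μ : YoungDiagram) :
    Continuous fun P : ℤ → ℕ → ℂ => jtDet μ P := by
  refine Continuous.matrix_det ?_
  refine continuous_matrix fun i k => ?_
  exact (continuous_hval _).comp (continuous_apply _)

/-- The symmetric function `jtDet μ (p - τ)`. -/
noncomputable def jtFun (μ : YoungDiagram) (τ : ℤ → ℕ → ℂ) : SymFun :=
  jtDet μ fun e a => MvPolynomial.X a - MvPolynomial.C (τ e a)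

theorem aeval_jtFun (μ : YoungDiagram) (τ : ℤ → ℕ → ℂ) (P : ℕ → ℂ) :
    MvPolynomial.aeval P (jtFun μ τ) = jtDet μ fun e a => P a - τ e a := by
  rw [jtFun, jtDet_map]
  simp

theorem eventually_psums_eq (x : ℕ →₀ ℂ) : ∀ᶠ N : ℕ in atTop, ∀ k : ℕ,
    psums (fun i : Fin N => x i) k = x.sum fun _ t => t ^ (k + 1) := by
  filter_upwards [eventually_ge_atTop (x.support.sup id + 1)] with N hN k
  rw [psums, Finsupp.sum, ← Finset.sum_range (fun i => x i ^ (k + 1))]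
  symm
  refine Finset.sum_subset (fun i hi => ?_) fun i _ hi => ?_
  · rw [Finset.mem_range]
    have := Finset.le_sup (f := id) hi
    simp only [id] at this
    omega
  · rw [Finsupp.notMem_support_iff.1 hi]; simp

/-- At a fixed finite tuple, only the node sums depend on $N$ once $N$ is large, and the determinant
is a continuous function of all the power sums it involves. -/
theorem isLimit_multiSchur {c : ℕ → ℕ → ℂ} {τ : ℤ → ℕ → ℂ}
    (h : ∀ e a, Tendsto (fun N => nodeSums (c N) N e a) atTop (𝓝 (τ e a))) (μ : YoungDiagram) :
    SymFun.IsLimit (fun N => multiSchur (c N) μ N) (jtFun μ τ) := by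
  refine ⟨⟨_, fun N => totalDegree_multiSchur_le _ _ _⟩, fun x => ?_⟩
  rw [SymFun.evalFin, aeval_jtFun]
  have h1 : Tendsto (fun N => (fun (e : ℤ) (a : ℕ) =>
      (x.sum fun _ t => t ^ (a + 1)) - nodeSums (c N) N e a)) atTop
      (𝓝 fun e a => (x.sum fun _ t => t ^ (a + 1)) - τ e a) := by
    rw [tendsto_pi_nhds]; intro e
    rw [tendsto_pi_nhds]; intro a
    exact (h e a).const_sub _
  refine (((continuous_jtDet μ).tendsto _).comp h1).congr' ?_
  filter_upwards [eventually_psums_eq x, eventually_ge_atTop (μ.colLen 0)] with N hN hμ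
  rw [multiSchur_eq_jtDet _ hμ, ← MvPolynomial.coe_aeval_eq_eval, RingHom.coe_coe, jtDet_map]
  simp only [Function.comp]
  congr 1
  funext e a
  rw [map_sub, MvPolynomial.aeval_C, ← hN a]
  simp [psums]

end JacobiTrudi


/-! ### Young diagrams and strictly decreasing exponents -/

namespace YoungDiagram

theorem ext_rowLen {μ ν : YoungDiagram} (h : ∀ i, μ.rowLen i = ν.rowLen i) : μ = ν := by
  refine YoungDiagram.ext (Finset.ext fun ⟨i, j⟩ => ?_)
  rw [mem_cells, mem_cells, mem_iff_lt_rowLen, mem_iff_lt_rowLen, h]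

theorem le_iff_rowLen {μ ν : YoungDiagram} : μ ≤ ν ↔ ∀ i, μ.rowLen i ≤ ν.rowLen i := by
  constructor
  · intro h i
    by_contra! hlt
    have h1 : (i, ν.rowLen i) ∈ μ := mem_iff_lt_rowLen.2 hlt
    have h2 : (i, ν.rowLen i) ∈ ν := cells_subset_iff.2 h h1
    exact lt_irrefl _ (mem_iff_lt_rowLen.1 h2)
  · intro h
    rw [← cells_subset_iff]
    rintro ⟨i, j⟩ hij
    rw [mem_cells, mem_iff_lt_rowLen] at hij ⊢
    exact hij.trans_le (h i)

theorem colLen_mono {μ ν : YoungDiagram} (h : μ ≤ ν) (j : ℕ) : μ.colLen j ≤ ν.colLen j := by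
  by_contra! hlt
  have h1 : (ν.colLen j, j) ∈ μ := mem_iff_lt_colLen.2 hlt
  have h2 : (ν.colLen j, j) ∈ ν := cells_subset_iff.2 h h1
  exact lt_irrefl _ (mem_iff_lt_colLen.1 h2)

theorem colLen_le_of_rowLen_eq_zero {μ : YoungDiagram} {N : ℕ} (h : μ.rowLen N = 0) :
    μ.colLen 0 ≤ N := by
  by_contra! hlt
  have := mem_iff_lt_rowLen.1 (mem_iff_lt_colLen.2 hlt)
  omega

theorem card_eq_sum_rowLen {μ : YoungDiagram} {N : ℕ} (hN : μ.colLen 0 ≤ N) :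
    μ.card = ∑ i ∈ Finset.range N, μ.rowLen i := by
  rw [YoungDiagram.card, Finset.card_eq_sum_card_fiberwise (f := Prod.fst) (t := Finset.range N)]
  · refine Finset.sum_congr rfl fun i _ => ?_
    rw [rowLen_eq_card]
    rfl
  · rintro ⟨i, j⟩ hij
    have h1 : (i, j) ∈ μ := hij
    have h2 : (i, 0) ∈ μ := μ.up_left_mem le_rfl (Nat.zero_le _) h1
    rw [mem_iff_lt_colLen] at h2
    exact Finset.mem_coe.2 (Finset.mem_range.2 (by simpa using h2.trans_le hN))

/-- The diagram with row lengths `f 0 ≥ f 1 ≥ … ≥ f (N - 1)`. -/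
def ofAntitone (f : ℕ → ℕ) (hf : Antitone f) (N : ℕ) : YoungDiagram where
  cells := (Finset.range N ×ˢ Finset.range (f 0)).filter fun p => p.2 < f p.1
  isLowerSet := by
    rintro ⟨i, j⟩ ⟨i', j'⟩ hle hij
    simp only [Finset.coe_filter, Finset.mem_product, Finset.mem_range, Set.mem_ofPred_eq] at hij ⊢
    obtain ⟨hi, hj⟩ := Prod.mk_le_mk.1 hle
    have := hf hi
    exact ⟨⟨by omega, by omega⟩, by omega⟩

theorem rowLen_ofAntitone {f : ℕ → ℕ} (hf : Antitone f) {N i : ℕ} (hi : i < N) :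
    (ofAntitone f hf N).rowLen i = f i := by
  refine eq_of_forall_lt_iff fun j => ?_
  rw [← mem_iff_lt_rowLen, ← mem_cells, ofAntitone]
  have := hf (Nat.zero_le i)
  simp only [Finset.mem_filter, Finset.mem_product, Finset.mem_range]
  constructor
  · exact fun h => h.2
  · exact fun h => ⟨⟨hi, by omega⟩, h⟩

theorem colLen_ofAntitone_le {f : ℕ → ℕ} (hf : Antitone f) (N : ℕ) :
    (ofAntitone f hf N).colLen 0 ≤ N := by
  refine colLen_le_of_rowLen_eq_zero ?_
  by_contra h
  have h1 : (N, 0) ∈ ofAntitone f hf N := mem_iff_lt_rowLen.2 (Nat.pos_of_ne_zero h)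
  rw [← mem_cells, ofAntitone] at h1
  simp at h1

/-- The exponents `μ_i + N - i` of an alternant. -/
def exps (μ : YoungDiagram) (N : ℕ) (i : Fin N) : ℕ := μ.rowLen i + (N - 1 - i)

theorem exps_strictAnti (μ : YoungDiagram) (N : ℕ) : StrictAnti (μ.exps N) := by
  intro i j hij
  have h1 := μ.rowLen_anti i j hij.le
  have h2 : (i : ℕ) < j := hij
  have := j.2
  simp only [exps]
  omega

theorem exps_injective (μ : YoungDiagram) (N : ℕ) : Function.Injective (μ.exps N) :=
  (μ.exps_strictAnti N).injective

theorem eq_of_exps_eq {μ ν : YoungDiagram} {N : ℕ} (hμ : μ.colLen 0 ≤ N) (hν : ν.colLen 0 ≤ N)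
    (h : μ.exps N = ν.exps N) : μ = ν := by
  refine ext_rowLen fun i => ?_
  by_cases hi : i < N
  · have := congrFun h ⟨i, hi⟩
    simpa [exps] using this
  · rw [rowLen_eq_zero (by omega), rowLen_eq_zero (by omega)]

theorem exists_exps_eq {N : ℕ} {m : Fin N → ℕ} (hm : StrictAnti m) :
    ∃ μ : YoungDiagram, μ.colLen 0 ≤ N ∧ μ.exps N = m := by
  -- A strictly decreasing integer sequence drops by at least the difference of the indices. So
  -- subtracting $N-1-i$ leaves a weakly decreasing sequence.
  have hstep : ∀ k : ℕ, ∀ i j : Fin N, (j : ℕ) = i + k → m j + k ≤ m i := by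
    intro k
    induction k with
    | zero => intro i j h; have : i = j := Fin.ext (by omega); simp [this]
    | succ k ih =>
      intro i j h
      have hj := j.2
      have h1 := ih i ⟨i + k, by omega⟩ rfl
      have h2 : m j < m ⟨i + k, by omega⟩ := hm (by rw [Fin.lt_def]; simp; omega)
      omega
  set f : ℕ → ℕ := fun i => if h : i < N then m ⟨i, h⟩ - (N - 1 - i) else 0 with hf
  have hfa : Antitone f := by
    intro i j hij
    simp only [hf]
    by_cases hj : j < N
    · have hi : i < N := by omega
      rw [dif_pos hj, dif_pos hi]
      have := hstep (j - i) ⟨i, hi⟩ ⟨j, hj⟩ (by simp; omega)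
      omega
    · rw [dif_neg hj]; exact Nat.zero_le _
  refine ⟨ofAntitone f hfa N, colLen_ofAntitone_le hfa N, funext fun i => ?_⟩
  have hi := i.2
  rw [exps, rowLen_ofAntitone hfa hi]
  -- Comparison with the last index gives $m_i\ge N-1-i$, so the truncated subtraction defining `f`
  -- loses nothing.
  have := hstep (N - 1 - i) i ⟨N - 1, by omega⟩ (by simp; omega)
  simp only [hf, dif_pos hi, Fin.eta]
  omega

theorem exists_exps_comp_perm {N : ℕ} {g : Fin N → ℕ} (hg : Function.Injective g) :
    ∃ (μ : YoungDiagram) (σ : Equiv.Perm (Fin N)), μ.colLen 0 ≤ N ∧ g = μ.exps N ∘ σ := by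
  set τ : Equiv.Perm (Fin N) := Fin.revPerm.trans (Tuple.sort g) with hτ
  have hmono : StrictMono (g ∘ Tuple.sort g) :=
    (Tuple.monotone_sort g).strictMono_of_injective (hg.comp (Tuple.sort g).injective)
  have hanti : StrictAnti (g ∘ τ) := fun i j hij => hmono (Fin.rev_lt_rev.2 hij)
  obtain ⟨μ, hμ, h⟩ := exists_exps_eq hanti
  refine ⟨μ, τ.symm, hμ, ?_⟩
  rw [h]
  funext i
  simp

theorem exps_comp_perm_injective {μ ν : YoungDiagram} {N : ℕ} (hμ : μ.colLen 0 ≤ N)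
    (hν : ν.colLen 0 ≤ N) {σ τ : Equiv.Perm (Fin N)} (h : μ.exps N ∘ σ = ν.exps N ∘ τ) :
    μ = ν ∧ σ = τ := by
  have hr : Set.range (μ.exps N) = Set.range (ν.exps N) := by
    rw [← σ.surjective.range_comp, h, τ.surjective.range_comp]
  have h1 : μ.exps N = ν.exps N := by
    have h2 : StrictMono (OrderDual.toDual ∘ μ.exps N) := fun i j hij => μ.exps_strictAnti N hij
    have h3 : StrictMono (OrderDual.toDual ∘ ν.exps N) := fun i j hij => ν.exps_strictAnti N hij
    have h4 := (h2.range_inj h3).1 (by rw [Set.range_comp, Set.range_comp, hr])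
    exact OrderDual.toDual.injective.comp_left h4
  refine ⟨eq_of_exps_eq hμ hν h1, Equiv.ext fun i => μ.exps_injective N ?_⟩
  have := congrFun h i
  rw [← h1] at this
  exact this

/-- If $l_k<e_k$, then for each $j\le k$ one has $l_{\sigma^{-1}j}\ge e_j\ge e_k>l_k$, so
$\sigma^{-1}$ would inject $\{0,\dots,k\}$ into $\{0,\dots,k-1\}$. -/
theorem exps_le_of_comp_perm_le {N : ℕ} {e l : Fin N → ℕ} (he : StrictAnti e) (hl : StrictAnti l)
    (σ : Equiv.Perm (Fin N)) (h : ∀ i, e (σ i) ≤ l i) (k : Fin N) : e k ≤ l k := by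
  by_contra! hlt
  have h1 : ∀ j ∈ Finset.Iic k, σ.symm j ∈ Finset.Iio k := by
    intro j hj
    rw [Finset.mem_Iic] at hj
    rw [Finset.mem_Iio]
    have h2 := h (σ.symm j)
    rw [Equiv.apply_symm_apply] at h2
    have h3 := he.antitone hj
    exact hl.lt_iff_gt.1 (by omega)
  have h2 := Finset.card_le_card_of_injOn σ.symm h1 σ.symm.injective.injOn
  simp at h2

theorem le_of_exps_le {μ ν : YoungDiagram} {N : ℕ} (hμ : μ.colLen 0 ≤ N)
    (h : ∀ k, μ.exps N k ≤ ν.exps N k) : μ ≤ ν := by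
  rw [le_iff_rowLen]
  intro i
  by_cases hi : i < N
  · have := h ⟨i, hi⟩
    simpa [exps] using this
  · rw [rowLen_eq_zero (by omega)]
    exact Nat.zero_le _

theorem sum_exps {μ : YoungDiagram} {N : ℕ} (hμ : μ.colLen 0 ≤ N) :
    ∑ i, μ.exps N i = μ.card + ∑ i : Fin N, (N - 1 - (i : ℕ)) := by
  rw [card_eq_sum_rowLen hμ, Finset.sum_range, ← Finset.sum_add_distrib]
  rfl

end YoungDiagram

/-! ### The Cauchy–Binet formula for alternants -/

theorem det_perm_rows {R : Type*} [CommRing R] {N : ℕ} (F : ℕ → Fin N → R) (m : Fin N → ℕ)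
    (σ : Equiv.Perm (Fin N)) :
    (Matrix.of fun i j => F ((m ∘ σ) i) j).det =
      ((Equiv.Perm.sign σ : ℤ) : R) * (Matrix.of fun i j => F (m i) j).det :=
  Matrix.det_permute σ (Matrix.of fun i j => F (m i) j)

theorem det_eq_zero_of_not_injective {R : Type*} [CommRing R] {N : ℕ} (F : ℕ → Fin N → R)
    {m : Fin N → ℕ} (hm : ¬ Function.Injective m) : (Matrix.of fun i j => F (m i) j).det = 0 := by
  simp only [Function.Injective, not_forall] at hm
  obtain ⟨i, j, hij, hne⟩ := hm
  refine Matrix.det_zero_of_row_eq hne (funext fun k => ?_)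
  simp [hij]

theorem det_sum_rows {R : Type*} [CommRing R] {N : ℕ} (C : Fin N → ℕ → R) (F : ℕ → Fin N → R)
    (s : Fin N → Finset ℕ) :
    (Matrix.of fun i j => ∑ m ∈ s i, C i m * F m j).det =
      ∑ g ∈ Fintype.piFinset s, (∏ i, C i (g i)) * (Matrix.of fun i j => F (g i) j).det := by
  have h1 : (Matrix.of fun i j => ∑ m ∈ s i, C i m * F m j) =
      (fun i => ∑ m ∈ s i, C i m • F m : Fin N → Fin N → R) := by
    funext i j
    simp
  rw [h1]
  change Matrix.detRowAlternating.toMultilinearMap (fun i => ∑ m ∈ s i, C i m • F m) = _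
  rw [MultilinearMap.map_sum_finset]
  refine Finset.sum_congr rfl fun g _ => ?_
  rw [MultilinearMap.map_smul_univ]
  rfl

/-- Multilinearity expands the left side over all choices of one index per row. Choices with a
repetition contribute zero; the others are uniquely a permutation of some $\mu$ in exponent form,
and triangularity of `C` forces $\mu\subseteq l$. -/
theorem det_cauchyBinet {R : Type*} [CommRing R] {N : ℕ} {l : YoungDiagram}
    (hl : l.colLen 0 ≤ N) {C : ℕ → ℕ → R} (hC : ∀ a b, a < b → C a b = 0) (F : ℕ → Fin N → R) :
    (Matrix.of fun i j => ∑ m ∈ Finset.range (l.exps N i + 1), C (l.exps N i) m * F m j).det =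
      ∑ μ ∈ (YoungDiagram.finite_setOf_le l).toFinset,
        (Matrix.of fun i k => C (l.exps N i) (μ.exps N k)).det *
          (Matrix.of fun k j => F (μ.exps N k) j).det := by
  classical
  have hle : ∀ μ : YoungDiagram, μ ∈ (YoungDiagram.finite_setOf_le l).toFinset → μ ≤ l := by
    intro μ hμ
    simpa using hμ
  have hcol : ∀ μ : YoungDiagram, μ ∈ (YoungDiagram.finite_setOf_le l).toFinset →
      μ.colLen 0 ≤ N := fun μ hμ => (YoungDiagram.colLen_mono (hle μ hμ) 0).trans hl
  rw [det_sum_rows]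
  set f : (Fin N → ℕ) → R := fun g =>
    (∏ i, C (l.exps N i) (g i)) * (Matrix.of fun i j => F (g i) j).det with hf
  have hR : ∀ μ : YoungDiagram, (Matrix.of fun i k => C (l.exps N i) (μ.exps N k)).det *
      (Matrix.of fun k j => F (μ.exps N k) j).det = ∑ σ : Equiv.Perm (Fin N), f (μ.exps N ∘ σ) := by
    intro μ
    rw [← Matrix.det_transpose, Matrix.det_apply', Finset.sum_mul]
    refine Finset.sum_congr rfl fun σ _ => ?_
    simp only [hf]
    rw [det_perm_rows]
    simp only [Matrix.transpose_apply, Matrix.of_apply, Function.comp]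
    ring
  simp only [hR]
  rw [← Finset.sum_product', ← Finset.sum_image
    (g := fun p : YoungDiagram × Equiv.Perm (Fin N) => p.1.exps N ∘ p.2) (f := f)]
  -- The two index sets differ, but the summand is supported on their intersection. Both sums are
  -- therefore equal to the sum over the union.
  · have hsub : ∀ g, g ∈ Fintype.piFinset (fun i => Finset.range (l.exps N i + 1)) ∪
        Finset.image (fun p : YoungDiagram × Equiv.Perm (Fin N) => p.1.exps N ∘ p.2)
          ((YoungDiagram.finite_setOf_le l).toFinset ×ˢ Finset.univ) → f g ≠ 0 →
        g ∈ Fintype.piFinset (fun i => Finset.range (l.exps N i + 1)) ∧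
        g ∈ Finset.image (fun p : YoungDiagram × Equiv.Perm (Fin N) => p.1.exps N ∘ p.2)
          ((YoungDiagram.finite_setOf_le l).toFinset ×ˢ Finset.univ) := by
      intro g _ hg
      have hg1 : ∀ i, g i ≤ l.exps N i := by
        intro i
        by_contra! hlt
        refine hg ?_
        simp only [hf]
        rw [Finset.prod_eq_zero (Finset.mem_univ i) (hC _ _ hlt), zero_mul]
      have hg2 : Function.Injective g := by
        by_contra hinj
        refine hg ?_
        simp only [hf]
        rw [det_eq_zero_of_not_injective F hinj, mul_zero]
      refine ⟨Fintype.mem_piFinset.2 fun i => Finset.mem_range.2 (Nat.lt_succ_of_le (hg1 i)), ?_⟩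
      obtain ⟨μ, σ, hμ, rfl⟩ := YoungDiagram.exists_exps_comp_perm hg2
      refine Finset.mem_image.2 ⟨(μ, σ), Finset.mem_product.2 ⟨?_, Finset.mem_univ _⟩, rfl⟩
      rw [Set.Finite.mem_toFinset]
      exact YoungDiagram.le_of_exps_le hμ (YoungDiagram.exps_le_of_comp_perm_le
        (μ.exps_strictAnti N) (l.exps_strictAnti N) σ hg1)
    trans ∑ g ∈ Fintype.piFinset (fun i => Finset.range (l.exps N i + 1)) ∪
        Finset.image (fun p : YoungDiagram × Equiv.Perm (Fin N) => p.1.exps N ∘ p.2)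
          ((YoungDiagram.finite_setOf_le l).toFinset ×ˢ Finset.univ), f g
    · refine Finset.sum_subset Finset.subset_union_left fun g hg hg' => ?_
      by_contra h0
      exact hg' (hsub g hg h0).1
    · symm
      refine Finset.sum_subset Finset.subset_union_right fun g hg hg' => ?_
      by_contra h0
      exact hg' (hsub g hg h0).2
  · rintro ⟨μ, σ⟩ hμ ⟨ν, τ⟩ hν h
    rw [Finset.mem_coe, Finset.mem_product] at hμ hν
    obtain ⟨h1, h2⟩ := YoungDiagram.exps_comp_perm_injective (hcol μ hμ.1) (hcol ν hν.1) h
    exact Prod.ext h1 h2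


/-! ### Schur functions span the algebra of symmetric functions -/

theorem SymFun.ext_psums_X {F G : SymFun} (r : ℕ)
    (h : ∀ n, r ≤ n → MvPolynomial.aeval
      (psums (MvPolynomial.X : Fin n → MvPolynomial (Fin n) ℂ)) F =
      MvPolynomial.aeval (psums (MvPolynomial.X : Fin n → MvPolynomial (Fin n) ℂ)) G) : F = G := by
  refine SymFun.ext_psums fun n z => ?_
  set x : ℕ →₀ ℂ := finsuppOfFin z
  obtain ⟨N, hN, hr⟩ := ((eventually_psums_eq x).and (eventually_ge_atTop r)).exists
  have h1 := congrArg (MvPolynomial.aeval fun i : Fin N => x i) (h N hr)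
  have h2 : ∀ F : SymFun, MvPolynomial.aeval (fun i : Fin N => x i) (MvPolynomial.aeval
      (psums (MvPolynomial.X : Fin N → MvPolynomial (Fin N) ℂ)) F) =
      MvPolynomial.aeval (psums z) F := by
    intro F
    rw [← AlgHom.comp_apply]
    congr 1
    ext k
    rw [AlgHom.comp_apply, MvPolynomial.aeval_X, MvPolynomial.aeval_X, ← sum_finsuppOfFin, ← hN k]
    simp [psums]
  rwa [h2, h2] at h1

section SchurSpan

variable {R : Type*} [CommRing R]

/-- In the expansion over permutations, raising the exponent of row $i$ by $k$ multiplies the term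
of $\sigma$ by $x_{\sigma^{-1}(i)}^k$. The sum of these factors over $i$ is the power sum, whatever
$\sigma$ is. -/
theorem sum_det_update_pow {N : ℕ} (x : Fin N → R) (m : Fin N → ℕ) (k : ℕ) :
    ∑ i, (Matrix.of fun a j => x j ^ (Function.update m i (m i + k)) a).det =
      (∑ j, x j ^ k) * (Matrix.of fun a j => x j ^ m a).det := by
  simp only [Matrix.det_apply', Matrix.of_apply]
  rw [Finset.sum_comm, Finset.mul_sum]
  refine Finset.sum_congr rfl fun σ _ => ?_
  rw [← Finset.mul_sum, mul_left_comm]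
  congr 1
  have h : ∀ i, ∏ a, x a ^ Function.update m i (m i + k) (σ a) =
      x (σ.symm i) ^ k * ∏ a, x a ^ m (σ a) := by
    intro i
    rw [← Finset.mul_prod_erase _ _ (Finset.mem_univ (σ.symm i)),
      ← Finset.mul_prod_erase _ (fun a => x a ^ m (σ a)) (Finset.mem_univ (σ.symm i)),
      Equiv.apply_symm_apply, Function.update_self, pow_add]
    rw [Finset.prod_congr rfl (g := fun a => x a ^ m (σ a))]
    · ring
    · intro a ha
      rw [Function.update_of_ne]
      intro h
      rw [← h, Equiv.symm_apply_apply] at ha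
      simp at ha
  simp only [h]
  rw [← Finset.sum_mul, Equiv.sum_comp σ.symm fun j => x j ^ k]

variable [Algebra ℂ R]

theorem det_pow_eq {N r : ℕ} (hr : r ≤ N) (x : Fin N → R) {m : Fin r → ℕ} {M : Fin N → ℕ}
    (h1 : ∀ i : Fin N, ∀ h : (i : ℕ) < r, M i = m ⟨i, h⟩ + (N - r))
    (h2 : ∀ i : Fin N, r ≤ i → M i = N - 1 - i) :
    (Matrix.of fun i j => x j ^ M i).det =
      vdm x * (Matrix.of fun i k : Fin r => hval (psums x) ((m i : ℤ) + k + 1 - r)).det := by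
  have h0 := det_newtonPoly_eq x (fun _ => 0) M
  have h3 := det_eq_of_unitriangular (r := r)
    (A := fun i k => if h : i < r then hval (psums x) ((m ⟨i, h⟩ : ℤ) + k + 1 - r)
      else hval (psums x) ((k : ℤ) - i))
    (fun j hj k hk => by rw [dif_neg (by omega)]; exact hval_neg _ (by omega))
    (fun j hj => by rw [dif_neg (by omega), sub_self, hval_zero]) hr
  have h4 : (Matrix.of fun i j : Fin N => (newtonPoly (fun _ => (0 : R)) (M i)).eval (x j)) =
      Matrix.of fun i j => x j ^ M i := by
    ext i j
    simp [newtonPoly]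
  rw [← h4, h0]
  congr 1
  trans (Matrix.of fun i k : Fin N => if h : (i : ℕ) < r then
      hval (psums x) ((m ⟨i, h⟩ : ℤ) + k + 1 - r) else hval (psums x) ((k : ℤ) - i)).det
  · congr 1
    ext i k
    simp only [Matrix.of_apply]
    have h5 : (fun a => psums x a - ∑ s ∈ Finset.range (M i), (0 : R) ^ (a + 1)) = psums x := by
      funext a; simp
    rw [h5]
    have := i.2
    split_ifs with h
    · rw [h1 i h]; congr 1; omega
    · rw [h2 i (by omega)]; congr 1; omega
  · rw [h3]
    congr 1
    ext i k
    simp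

theorem isExpSeries_mk (P : ℕ → R) :
    IsExpSeries P (PowerSeries.mk fun k => MvPolynomial.aeval P (hsym k)) := by
  constructor
  · simp [hsym]
  · ext k
    rw [PowerSeries.coeff_derivative, PowerSeries.coeff_mk, mul_comm, aeval_hsym_succ, mul_comm,
      PowerSeries.coeff_mul, Finset.Nat.sum_antidiagonal_eq_sum_range_succ_mk]
    simp

theorem hval_add (P Q : ℕ → R) {z : ℤ} {B : ℕ} (hB : z < B) :
    hval (P + Q) z = ∑ b ∈ Finset.range B, hval Q b * hval P (z - b) := by
  by_cases hz : z < 0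
  · rw [hval_neg _ hz, Finset.sum_eq_zero]
    intro b _
    rw [hval_neg P (by omega), mul_zero]
  · obtain ⟨k, rfl⟩ : ∃ k : ℕ, z = k := ⟨z.toNat, by omega⟩
    rw [← coeff_eq_hval ((isExpSeries_mk Q).mul (isExpSeries_mk P) |> fun h => by
        rwa [add_comm] at h) k, PowerSeries.coeff_mul,
      Finset.Nat.sum_antidiagonal_eq_sum_range_succ_mk]
    rw [← Finset.sum_subset (Finset.range_mono (show k.succ ≤ B by omega))]
    · refine Finset.sum_congr rfl fun b hb => ?_
      rw [Finset.mem_range] at hb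
      rw [PowerSeries.coeff_mk, PowerSeries.coeff_mk, hval_natCast, ← hval_natCast P,
        Nat.cast_sub (by omega)]
    · intro b _ hb
      rw [Finset.mem_range] at hb
      rw [hval_neg P (by omega), mul_zero]

end SchurSpan

/-- The Jacobi–Trudi determinant with exponents `m`. -/
noncomputable def schurDet {r : ℕ} (m : Fin r → ℕ) : SymFun :=
  (Matrix.of fun i k : Fin r =>
    hval (MvPolynomial.X : ℕ → SymFun) ((m i : ℤ) + k + 1 - r)).det

/-- The Schur functions. -/
noncomputable def schurFun (μ : YoungDiagram) : SymFun := schurDet (μ.exps (μ.colLen 0))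

theorem schurDet_exps {μ : YoungDiagram} {N : ℕ} (hN : μ.colLen 0 ≤ N) :
    schurDet (μ.exps N) = schurFun μ := by
  have h : ∀ n, schurDet (μ.exps n) = (Matrix.of fun i k : Fin n =>
      hval (MvPolynomial.X : ℕ → SymFun) ((μ.rowLen i : ℤ) - i + k)).det := by
    intro n
    rw [schurDet]
    congr 1
    ext1 i k
    have := i.2
    simp only [Matrix.of_apply, YoungDiagram.exps]
    congr 1
    omega
  rw [schurFun, h, h]
  have h1 := jtDet_eq_det (μ := μ) (fun _ => (MvPolynomial.X : ℕ → SymFun)) hN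
  have h2 := jtDet_eq_det (μ := μ) (fun _ => (MvPolynomial.X : ℕ → SymFun)) le_rfl
  rw [h1, h2]

/-- The span of the Schur functions `s_μ`, `|μ| < n`. -/
noncomputable def schurSpan (n : ℕ) : Submodule ℂ SymFun :=
  Submodule.span ℂ (schurFun '' {μ | μ.card < n})

theorem schurSpan_mono {n n' : ℕ} (h : n ≤ n') : schurSpan n ≤ schurSpan n' :=
  Submodule.span_mono (Set.image_mono fun _ hμ => lt_of_lt_of_le hμ h)

/-- Straightening: sorting the exponents produces a signed Schur function, or zero if two exponents
agree. Sorting preserves their sum, which determines the size of the diagram. -/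
theorem schurDet_mem {r n : ℕ} {m : Fin r → ℕ}
    (h : ∑ i, m i < n + ∑ i : Fin r, (r - 1 - (i : ℕ))) : schurDet m ∈ schurSpan n := by
  by_cases hm : Function.Injective m
  · obtain ⟨μ, σ, hμ, rfl⟩ := YoungDiagram.exists_exps_comp_perm hm
    have h1 := det_perm_rows (fun a (k : Fin r) =>
      hval (MvPolynomial.X : ℕ → SymFun) ((a : ℤ) + k + 1 - r)) (μ.exps r) σ
    have h2 : schurDet (μ.exps r ∘ σ) = ((Equiv.Perm.sign σ : ℤ) : ℂ) • schurFun μ := by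
      rw [← schurDet_exps hμ, schurDet, h1, schurDet, Algebra.smul_def]
      simp
    rw [h2]
    refine Submodule.smul_mem _ _ (Submodule.subset_span ⟨μ, ?_, rfl⟩)
    have h3 := YoungDiagram.sum_exps hμ
    have h4 : ∑ i, (μ.exps r ∘ σ) i = ∑ i, μ.exps r i := Equiv.sum_comp σ (μ.exps r)
    change μ.card < n
    omega
  · have : schurDet m = 0 := det_eq_zero_of_not_injective (fun a (k : Fin r) =>
      hval (MvPolynomial.X : ℕ → SymFun) ((a : ℤ) + k + 1 - r)) hm
    rw [this]
    exact Submodule.zero_mem _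

/-- This is the Murnaghan–Nakayama rule before straightening. Multiplication by $p_{k+1}$ creates at
most $k+1$ new rows, so $\ell(\mu)+k+1$ rows suffice; the identity is checked on alternants in $N$
variables for every large $N$. -/
theorem X_mul_schurFun (k : ℕ) (μ : YoungDiagram) :
    MvPolynomial.X k * schurFun μ = ∑ i : Fin (μ.colLen 0 + (k + 1)),
      schurDet (Function.update (μ.exps _) i (μ.exps _ i + (k + 1))) := by
  set r := μ.colLen 0 + (k + 1) with hr
  refine SymFun.ext_psums_X r fun N hN => ?_
  set x : Fin N → MvPolynomial (Fin N) ℂ := MvPolynomial.X with hx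
  refine mul_left_cancel₀ (vdm_X_ne_zero N) ?_
  have hev : ∀ {s : ℕ} (m : Fin s → ℕ), MvPolynomial.aeval (psums x) (schurDet m) =
      (Matrix.of fun i k : Fin s => hval (psums x) ((m i : ℤ) + k + 1 - s)).det := by
    intro s m
    rw [schurDet, AlgHom.map_det]
    congr 1
    ext1 i k
    simp [hval_map]
  have h1 : vdm x * MvPolynomial.aeval (psums x) (schurFun μ) =
      (Matrix.of fun i j => x j ^ μ.exps N i).det := by
    rw [← schurDet_exps (N := N) (by omega), hev,
      det_pow_eq le_rfl x (m := μ.exps N) (by simp) (fun i h => by omega)]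
  rw [map_mul, MvPolynomial.aeval_X, mul_left_comm, ← hx, h1, psums, ← sum_det_update_pow, map_sum,
    Finset.mul_sum]
  symm
  have h2 : ∀ i : Fin r, vdm x * MvPolynomial.aeval (psums x)
      (schurDet (Function.update (μ.exps r) i (μ.exps r i + (k + 1)))) =
      (Matrix.of fun a j => x j ^ Function.update (μ.exps N) (Fin.castLE hN i)
        (μ.exps N (Fin.castLE hN i) + (k + 1)) a).det := by
    intro i
    rw [hev, ← det_pow_eq hN x]
    · intro a h
      have ha : (⟨a, h⟩ : Fin r) = i ↔ a = Fin.castLE hN i := by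
        simp [Fin.ext_iff]
      by_cases hai : a = Fin.castLE hN i
      · rw [ha.2 hai, hai, Function.update_self, Function.update_self]
        have := i.2
        simp only [YoungDiagram.exps, Fin.val_castLE]
        omega
      · rw [Function.update_of_ne hai, Function.update_of_ne fun h => hai (ha.1 h)]
        simp only [YoungDiagram.exps]
        omega
    · intro a h
      rw [Function.update_of_ne, YoungDiagram.exps, YoungDiagram.rowLen_eq_zero (by omega), zero_add]
      intro h'
      have := i.2
      rw [h'] at h
      simp at h
      omega
  rw [Finset.sum_congr rfl fun i _ => h2 i]
  -- When row $i$ lies beyond the first $r$, its raised exponent $N-1-i+(k+1)$ is already the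
  -- exponent of row $i-(k+1)$, which is empty too. Two rows coincide.
  have h3 : ∀ i : Fin N, i ∉ Set.range (Fin.castLE hN) →
      (Matrix.of fun a j => x j ^ Function.update (μ.exps N) i (μ.exps N i + (k + 1)) a).det = 0 := by
    intro i hi
    have hri : r ≤ i := by
      by_contra! h
      exact hi ⟨⟨i, h⟩, rfl⟩
    refine det_eq_zero_of_not_injective (fun m j => x j ^ m) fun hinj => ?_
    have hi2 := i.2
    have hne : (⟨i - (k + 1), by omega⟩ : Fin N) ≠ i := by
      rw [Ne, Fin.ext_iff]; simp; omega
    refine hne (hinj ?_)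
    rw [Function.update_self, Function.update_of_ne hne, YoungDiagram.exps, YoungDiagram.exps,
      YoungDiagram.rowLen_eq_zero (show μ.colLen 0 ≤ i by omega),
      YoungDiagram.rowLen_eq_zero (by simp; omega)]
    simp only
    omega
  rw [← Finset.sum_image (s := Finset.univ) (g := Fin.castLE hN) (f := fun i =>
    (Matrix.of fun a j => x j ^ Function.update (μ.exps N) i (μ.exps N i + (k + 1)) a).det)
    (Fin.castLE_injective hN).injOn]
  refine Finset.sum_subset (Finset.subset_univ _) fun i _ hi => h3 i ?_
  rintro ⟨y, hy⟩
  exact hi (Finset.mem_image.2 ⟨y, Finset.mem_univ _, hy⟩)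

/-- The span contains $1=s_\emptyset$ and is stable under multiplication by every power sum, and the
power sums generate the algebra. -/
theorem span_schurFun : Submodule.span ℂ (Set.range schurFun) = ⊤ := by
  have hle : ∀ n, schurSpan n ≤ Submodule.span ℂ (Set.range schurFun) := fun n =>
    Submodule.span_mono (Set.image_subset_range _ _)
  have hX : ∀ k, ∀ F ∈ Submodule.span ℂ (Set.range schurFun),
      MvPolynomial.X k * F ∈ Submodule.span ℂ (Set.range schurFun) := by
    intro k F hF
    induction hF using Submodule.span_induction with
    | mem F hF =>
      obtain ⟨μ, rfl⟩ := hF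
      rw [X_mul_schurFun]
      -- No size control is needed here, so the bound is taken to be one more than the sum of the
      -- exponents.
      exact Submodule.sum_mem _ fun i _ => hle _ (schurDet_mem (Nat.lt_of_lt_of_le
        (Nat.lt_succ_self _) (Nat.le_add_right _ _)))
    | zero => simp
    | add F G _ _ hF hG => rw [mul_add]; exact Submodule.add_mem _ hF hG
    | smul a F _ hF => rw [mul_smul_comm]; exact Submodule.smul_mem _ _ hF
  rw [eq_top_iff]
  rintro F -
  induction F using MvPolynomial.induction_on with
  | C a =>
    have : (MvPolynomial.C a : SymFun) = a • schurFun ⊥ := by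
      have h0 : (⊥ : YoungDiagram).colLen 0 = 0 := by
        by_contra h
        exact YoungDiagram.notMem_bot _
          (YoungDiagram.mem_iff_lt_colLen.2 (Nat.pos_of_ne_zero h))
      rw [← schurDet_exps h0.le, schurDet, Matrix.det_isEmpty, MvPolynomial.smul_eq_C_mul, mul_one]
    rw [this]
    exact Submodule.smul_mem _ _ (Submodule.subset_span ⟨⊥, rfl⟩)
  | add F G hF hG => exact Submodule.add_mem _ hF hG
  | mul_X F k hF => rw [mul_comm]; exact hX k F hF

theorem span_eq_top_of_unitriangular {Φ : YoungDiagram → SymFun}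
    (h : ∀ l, Φ l - schurFun l ∈ schurSpan l.card) : Submodule.span ℂ (Set.range Φ) = ⊤ := by
  rw [eq_top_iff, ← span_schurFun, Submodule.span_le]
  rintro _ ⟨l, rfl⟩
  induction hn : l.card using Nat.strong_induction_on generalizing l with
  | _ n ih =>
    have h1 : schurSpan l.card ≤ Submodule.span ℂ (Set.range Φ) := by
      rw [schurSpan, Submodule.span_le]
      rintro _ ⟨μ, hμ, rfl⟩
      exact ih μ.card (hn ▸ hμ) μ rfl
    have h2 := Submodule.sub_mem (Submodule.span ℂ (Set.range Φ))
      (Submodule.subset_span (Set.mem_range_self l)) (h1 (h l))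
    rwa [sub_sub_cancel] at h2

/-- Each $h_z(p-\tau)$ is $h_z(p)$ plus a combination of $h_{z-b}(p)$ with $b>0$, with coefficients
constant along a row. Expanding the rows gives $s_\mu$ once, and otherwise determinants with a
strictly smaller sum of exponents. -/
theorem jtFun_sub_schurFun_mem (μ : YoungDiagram) (τ : ℤ → ℕ → ℂ) :
    jtFun μ τ - schurFun μ ∈ schurSpan μ.card := by
  classical
  set N := μ.colLen 0 with hN
  set κ : Fin N → ℕ → ℂ := fun i b => hval (fun a => -τ ((i : ℤ) + 1 - μ.rowLen i) a) b with hκ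
  have h1 : jtFun μ τ = (Matrix.of fun i k : Fin N => ∑ m ∈ Finset.range (μ.exps N i + 1),
      (MvPolynomial.C (κ i (μ.exps N i - m)) : SymFun) *
        hval (MvPolynomial.X : ℕ → SymFun) ((m : ℤ) + k + 1 - N)).det := by
    rw [jtFun, jtDet]
    congr 1
    ext1 i k
    simp only [Matrix.of_apply]
    have hk := k.2
    have hi := i.2
    have h2 : (fun a => (MvPolynomial.X a : SymFun) -
        MvPolynomial.C (τ ((i : ℤ) + 1 - μ.rowLen i) a)) =
        (MvPolynomial.X : ℕ → SymFun) +
          fun a => algebraMap ℂ SymFun (-τ ((i : ℤ) + 1 - μ.rowLen i) a) := by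
      funext a
      simp [sub_eq_add_neg, MvPolynomial.algebraMap_eq]
    -- The bound exceeds every index $\mu_i-i+k$ of row $i$. One summation range thus serves the
    -- entire row, as the multilinear expansion requires.
    rw [h2, hval_add _ _ (B := μ.exps N i + 1) (by simp only [YoungDiagram.exps]; omega),
      ← Finset.sum_range_reflect]
    refine Finset.sum_congr rfl fun m hm => ?_
    rw [Finset.mem_range] at hm
    have h3 := hval_map (Algebra.ofId ℂ SymFun) (fun a => -τ ((i : ℤ) + 1 - μ.rowLen i) a)
      ((μ.exps N i - m : ℕ) : ℤ)
    congr 1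
    · rw [show μ.exps N i + 1 - 1 - m = μ.exps N i - m by omega]
      exact h3.symm
    · congr 1
      simp only [YoungDiagram.exps] at hm ⊢
      omega
  rw [h1, det_sum_rows]
  have hmem : μ.exps N ∈ Fintype.piFinset (fun i => Finset.range (μ.exps N i + 1)) :=
    Fintype.mem_piFinset.2 fun i => Finset.self_mem_range_succ _
  rw [← Finset.add_sum_erase _ _ hmem]
  have h4 : ∏ i, (MvPolynomial.C (κ i (μ.exps N i - μ.exps N i)) : SymFun) = 1 := by
    refine Finset.prod_eq_one fun i _ => ?_
    rw [Nat.sub_self]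
    simp [hκ, hval_zero]
  rw [h4, one_mul]
  change schurFun μ + _ - schurFun μ ∈ _
  rw [add_sub_cancel_left]
  refine Submodule.sum_mem _ fun g hg => ?_
  rw [Finset.mem_erase, Fintype.mem_piFinset] at hg
  have h5 : ∏ i, (MvPolynomial.C (κ i (μ.exps N i - g i)) : SymFun) =
      MvPolynomial.C (∏ i, κ i (μ.exps N i - g i)) := by rw [map_prod]
  rw [h5, ← MvPolynomial.smul_eq_C_mul]
  refine Submodule.smul_mem _ _ (schurDet_mem ?_)
  rw [← YoungDiagram.sum_exps le_rfl, ← hN]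
  have h6 : ∀ i, g i ≤ μ.exps N i := fun i => Nat.lt_succ_iff.1 (Finset.mem_range.1 (hg.2 i))
  refine Finset.sum_lt_sum (fun i _ => h6 i) ?_
  by_contra! h7
  exact hg.1 (funext fun i => le_antisymm (h6 i) (h7 i (Finset.mem_univ i)))


/-! ### Limits of the nodes -/

/-- The nodes `c⁻¹ q^{N-i-1} - δ c q^i`. -/
noncomputable def racahNode (q : ℝ) (c δ : ℂ) (N i : ℕ) : ℂ :=
  c⁻¹ * (q : ℂ) ^ ((N : ℤ) - i - 1) - δ * c * (q : ℂ) ^ i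

/-- The limits of the power sums of the first `N - e` nodes. -/
noncomputable def limitNodeSums (q : ℝ) (c δ : ℂ) (e : ℤ) (a : ℕ) : ℂ :=
  (c⁻¹ ^ (a + 1) * (q : ℂ) ^ (e * (a + 1)) + (-(δ * c)) ^ (a + 1)) / (1 - (q : ℂ) ^ (a + 1))

/-- All the cross terms are divisible by $xy$. The estimate serves both the nodes and the grid
points, which are sums of two quantities with a small product. -/
theorem norm_add_pow_sub_le (k : ℕ) (K : ℝ) : ∃ D : ℝ, 0 ≤ D ∧ ∀ x y : ℂ, ‖x‖ ≤ K → ‖y‖ ≤ K →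
    ‖(x + y) ^ (k + 1) - (x ^ (k + 1) + y ^ (k + 1))‖ ≤ D * ‖x * y‖ := by
  induction k with
  | zero => exact ⟨0, le_rfl, fun x y _ _ => by simp⟩
  | succ k ih =>
    obtain ⟨D, hD, h⟩ := ih
    refine ⟨2 * |K| * D + 2 * |K| ^ k, by positivity, fun x y hx hy => ?_⟩
    have hx' : ‖x‖ ≤ |K| := hx.trans (le_abs_self K)
    have hy' : ‖y‖ ≤ |K| := hy.trans (le_abs_self K)
    have h1 : (x + y) ^ (k + 1 + 1) - (x ^ (k + 1 + 1) + y ^ (k + 1 + 1)) =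
        (x + y) * ((x + y) ^ (k + 1) - (x ^ (k + 1) + y ^ (k + 1))) +
          (x * y) * (x ^ k + y ^ k) := by ring
    rw [h1]
    have h2 : ‖x + y‖ ≤ 2 * |K| := (norm_add_le _ _).trans (by linarith)
    have h3 : ‖x ^ k + y ^ k‖ ≤ 2 * |K| ^ k := by
      refine (norm_add_le _ _).trans ?_
      rw [norm_pow, norm_pow, two_mul]
      gcongr
    calc _ ≤ ‖x + y‖ * ‖(x + y) ^ (k + 1) - (x ^ (k + 1) + y ^ (k + 1))‖ +
          ‖x * y‖ * ‖x ^ k + y ^ k‖ := by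
          refine (norm_add_le _ _).trans ?_
          rw [norm_mul, norm_mul (x * y)]
      _ ≤ 2 * |K| * (D * ‖x * y‖) + ‖x * y‖ * (2 * |K| ^ k) := by
          gcongr
          exact h x y hx hy
      _ = _ := by ring

section Params

variable {q : ℝ} (hq₀ : 0 < q) (hq₁ : q < 1)

include hq₀ hq₁

theorem one_sub_pow_ne_zero (a : ℕ) : (1 - (q : ℂ) ^ (a + 1)) ≠ 0 := by
  have h : q ^ (a + 1) < 1 := pow_lt_one₀ hq₀.le hq₁ (Nat.succ_ne_zero a)
  rw [sub_ne_zero]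
  exact_mod_cast h.ne'

theorem tendsto_geom_sum (a : ℕ) : Tendsto (fun m : ℕ => ∑ j ∈ Finset.range m,
    ((q : ℂ) ^ (a + 1)) ^ j) atTop (𝓝 (1 - (q : ℂ) ^ (a + 1))⁻¹) := by
  refine (hasSum_geometric_of_norm_lt_one ?_).tendsto_sum_nat
  rw [norm_pow, Complex.norm_real, Real.norm_of_nonneg hq₀.le]
  exact pow_lt_one₀ hq₀.le hq₁ (Nat.succ_ne_zero a)

theorem tendsto_natCast_mul_pow (e : ℤ) :
    Tendsto (fun N : ℕ => (((N - e).toNat : ℕ) : ℝ) * q ^ N) atTop (𝓝 0) := by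
  have h1 : Tendsto (fun N : ℕ => (N : ℝ) * q ^ N) atTop (𝓝 0) :=
    tendsto_self_mul_const_pow_of_lt_one hq₀.le hq₁
  have h2 : Tendsto (fun N : ℕ => q ^ N) atTop (𝓝 0) :=
    tendsto_pow_atTop_nhds_zero_of_lt_one hq₀.le hq₁
  have h3 : Tendsto (fun N : ℕ => (N : ℝ) * q ^ N + |(e : ℝ)| * q ^ N) atTop (𝓝 0) := by
    simpa using h1.add (h2.const_mul |(e : ℝ)|)
  refine squeeze_zero (fun N => by positivity) (fun N => ?_) h3
  rw [← add_mul]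
  refine mul_le_mul_of_nonneg_right ?_ (by positivity)
  have : ((((N : ℤ) - e).toNat : ℕ) : ℤ) ≤ N + |e| := by
    have := neg_le_abs e
    have := abs_nonneg e
    omega
  exact_mod_cast this

/-- Each node is a sum of two geometric terms whose product has modulus of order $q^N$, so the cross
terms total $O(Nq^N)$. Among the first $N-e$ nodes the increasing part, read backwards, starts at
$c^{-1}q^e$, and the other part starts at $-\delta c$; each contributes a geometric series. -/
theorem tendsto_nodeSums (c δ : ℂ) (e : ℤ) (a : ℕ) :
    Tendsto (fun N => nodeSums (racahNode q c δ N) N e a) atTop (𝓝 (limitNodeSums q c δ e a)) := by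
  have hqne : (q : ℂ) ≠ 0 := by exact_mod_cast hq₀.ne'
  set x : ℕ → ℕ → ℂ := fun N s => c⁻¹ * (q : ℂ) ^ ((N : ℤ) - s - 1) with hx
  set y : ℕ → ℂ := fun s => -(δ * c * (q : ℂ) ^ s) with hy
  have hnorm : ∀ z : ℤ, ‖(q : ℂ) ^ z‖ = q ^ z := fun z => by
    rw [norm_zpow, Complex.norm_real, Real.norm_of_nonneg hq₀.le]
  set m : ℕ → ℕ := fun N => ((N : ℤ) - e).toNat with hm
  have hmtop : Tendsto m atTop atTop := by
    refine tendsto_atTop.2 fun b => ?_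
    filter_upwards [eventually_ge_atTop (b + e.toNat)] with N hN
    simp only [hm]
    omega
  obtain ⟨D, hD, hbound⟩ := norm_add_pow_sub_le a (‖c⁻¹‖ * q ^ e + ‖δ * c‖)
  -- the cross terms vanish in the limit
  have herr : Tendsto (fun N => ∑ s ∈ Finset.range (m N),
      ((x N s + y s) ^ (a + 1) - (x N s ^ (a + 1) + y s ^ (a + 1)))) atTop (𝓝 0) := by
    have h0 := (tendsto_natCast_mul_pow hq₀ hq₁ e).const_mul (D * (‖c⁻¹‖ * ‖δ * c‖ * q⁻¹))
    rw [mul_zero] at h0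
    refine squeeze_zero_norm (fun N => ?_) h0
    have hterm : ∀ s ∈ Finset.range (m N),
        ‖(x N s + y s) ^ (a + 1) - (x N s ^ (a + 1) + y s ^ (a + 1))‖ ≤
          D * (‖c⁻¹‖ * ‖δ * c‖ * q⁻¹) * q ^ N := by
      intro s hs
      rw [Finset.mem_range] at hs
      have hxn : ‖x N s‖ = ‖c⁻¹‖ * q ^ ((N : ℤ) - s - 1) := by rw [hx, norm_mul, hnorm]
      have hyn : ‖y s‖ = ‖δ * c‖ * q ^ s := by
        rw [hy, norm_neg, norm_mul, norm_pow, Complex.norm_real, Real.norm_of_nonneg hq₀.le]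
      have h1 : ‖x N s‖ ≤ ‖c⁻¹‖ * q ^ e + ‖δ * c‖ := by
        rw [hxn]
        have : q ^ ((N : ℤ) - s - 1) ≤ q ^ e :=
          zpow_le_zpow_right_of_le_one₀ hq₀ hq₁.le (by simp only [hm] at hs; omega)
        have := mul_le_mul_of_nonneg_left this (norm_nonneg c⁻¹)
        linarith [norm_nonneg (δ * c)]
      have h2 : ‖y s‖ ≤ ‖c⁻¹‖ * q ^ e + ‖δ * c‖ := by
        rw [hyn]
        have h3 : q ^ s ≤ 1 := pow_le_one₀ hq₀.le hq₁.le
        have h4 := mul_le_mul_of_nonneg_left h3 (norm_nonneg (δ * c))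
        have h5 : 0 ≤ ‖c⁻¹‖ * q ^ e := by positivity
        linarith
      refine (hbound _ _ h1 h2).trans (le_of_eq ?_)
      rw [norm_mul, hxn, hyn]
      have h6 : q ^ ((N : ℤ) - s - 1) * q ^ s = q⁻¹ * q ^ N := by
        rw [← zpow_natCast, ← zpow_natCast, ← zpow_neg_one, ← zpow_add₀ hq₀.ne',
          ← zpow_add₀ hq₀.ne']
        congr 1; ring
      linear_combination D * ‖c⁻¹‖ * ‖δ * c‖ * h6
    refine (norm_sum_le_of_le _ hterm).trans (le_of_eq ?_)
    rw [Finset.sum_const, Finset.card_range, nsmul_eq_mul]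
    simp only [hm]
    ring
  have hxs : Tendsto (fun N => ∑ s ∈ Finset.range (m N), x N s ^ (a + 1)) atTop
      (𝓝 (c⁻¹ ^ (a + 1) * (q : ℂ) ^ (e * (a + 1)) * (1 - (q : ℂ) ^ (a + 1))⁻¹)) := by
    refine (((tendsto_geom_sum hq₀ hq₁ a).comp hmtop).const_mul _).congr' ?_
    filter_upwards [eventually_ge_atTop e.toNat] with N hN
    rw [← Finset.sum_range_reflect, Function.comp, Finset.mul_sum]
    refine Finset.sum_congr rfl fun j hj => ?_
    rw [Finset.mem_range] at hj
    simp only [hx]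
    have h1 : ((q : ℂ) ^ (a + 1)) ^ j = (q : ℂ) ^ (j * ((a : ℤ) + 1)) := by
      rw [← pow_mul, mul_comm (a + 1)]
      norm_cast
    have h2 : ∀ z : ℤ, ((q : ℂ) ^ z) ^ (a + 1) = (q : ℂ) ^ (z * ((a : ℤ) + 1)) := fun z => by
      rw [zpow_mul]
      norm_cast
    have h3 : ((m N - 1 - j : ℕ) : ℤ) = N - e - 1 - j := by simp only [hm] at hj ⊢; omega
    rw [mul_pow, mul_assoc, h1, h2, ← zpow_add₀ hqne, h3]
    congr 2
    ring
  have hys : Tendsto (fun N => ∑ s ∈ Finset.range (m N), y s ^ (a + 1)) atTop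
      (𝓝 ((-(δ * c)) ^ (a + 1) * (1 - (q : ℂ) ^ (a + 1))⁻¹)) := by
    refine (((tendsto_geom_sum hq₀ hq₁ a).comp hmtop).const_mul _).congr fun N => ?_
    rw [Function.comp, Finset.mul_sum]
    refine Finset.sum_congr rfl fun j _ => ?_
    simp only [hy]
    rw [← neg_mul (δ * c), mul_pow, ← pow_mul, ← pow_mul, mul_comm j]
  have hfin := herr.add (hxs.add hys)
  rw [zero_add] at hfin
  have hlim : limitNodeSums q c δ e a = c⁻¹ ^ (a + 1) * (q : ℂ) ^ (e * (a + 1)) *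
      (1 - (q : ℂ) ^ (a + 1))⁻¹ + (-(δ * c)) ^ (a + 1) * (1 - (q : ℂ) ^ (a + 1))⁻¹ := by
    rw [limitNodeSums]; ring
  rw [hlim]
  refine hfin.congr fun N => ?_
  rw [← Finset.sum_add_distrib, ← Finset.sum_add_distrib, nodeSums]
  refine Finset.sum_congr rfl fun s _ => ?_
  have : racahNode q c δ N s = x N s + y s := by simp only [racahNode, hx, hy]; ring
  rw [this]
  ring

theorem interpBC_eq (s : ℂ) (μ : YoungDiagram) :
    interpBC q s μ = jtFun μ (limitNodeSums q s 1) := by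
  refine SymFun.IsLimit.lim_eq ?_
  have h := isLimit_multiSchur (tendsto_nodeSums hq₀ hq₁ s 1) μ
  have h1 : ∀ N, racahNode q s 1 N =
      fun i : ℕ => s⁻¹ * (q : ℂ) ^ ((N : ℤ) - i - 1) - s * (q : ℂ) ^ i :=
    fun N => funext fun i => by rw [racahNode, one_mul]
  simpa only [h1] using h

theorem interpA_eq (μ : YoungDiagram) : interpA q μ = jtFun μ (limitNodeSums q 1 0) := by
  refine SymFun.IsLimit.lim_eq ?_
  have h := isLimit_multiSchur (tendsto_nodeSums hq₀ hq₁ 1 0) μ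
  have h0 : ∀ N i, racahNode q 1 0 N i = (q : ℂ) ^ ((N : ℤ) - i - 1) := fun N i => by
    simp [racahNode]
  have h1 : ∀ N, racahNode q 1 0 N = fun i : ℕ => (q : ℂ) ^ ((N : ℤ) - i - 1) :=
    fun N => funext (h0 N)
  simpa only [h1] using h

end Params

/-! ### Homogeneity -/

theorem aeval_hsym_scale (t : ℂ) (P : ℕ → ℂ) (k : ℕ) :
    MvPolynomial.aeval (fun a => t ^ (a + 1) * P a) (hsym k) =
      t ^ k * MvPolynomial.aeval P (hsym k) := by
  induction k using Nat.strong_induction_on with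
  | _ k ih =>
    cases k with
    | zero => simp [hsym]
    | succ k =>
      have h : ((k : ℂ) + 1) ≠ 0 := by exact_mod_cast Nat.succ_ne_zero k
      refine mul_left_cancel₀ h ?_
      rw [mul_left_comm, aeval_hsym_succ, aeval_hsym_succ, Finset.mul_sum]
      refine Finset.sum_congr rfl fun i hi => ?_
      rw [Finset.mem_range] at hi
      rw [ih _ (by omega)]
      have : t ^ (k + 1) = t ^ (i + 1) * t ^ (k - i) := by rw [← pow_add]; congr 1; omega
      rw [this]; ring

theorem hval_scale (t : ℂ) (P : ℕ → ℂ) (z : ℤ) :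
    hval (fun a => t ^ (a + 1) * P a) z = t ^ z * hval P z := by
  by_cases hz : z < 0
  · rw [hval_neg _ hz, hval_neg _ hz, mul_zero]
  · obtain ⟨k, rfl⟩ : ∃ k : ℕ, z = k := ⟨z.toNat, by omega⟩
    rw [hval_natCast, hval_natCast, aeval_hsym_scale, zpow_natCast]

/-- By homogeneity the entry $(i,k)$ acquires $t^{\mu_i-i}\,t^k$, a row factor times a column
factor, and their total exponent is $|\mu|$. -/
theorem jtDet_scale {t : ℂ} (ht : t ≠ 0) (μ : YoungDiagram) (P : ℤ → ℕ → ℂ) :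
    jtDet μ (fun e a => t ^ (a + 1) * P e a) = t ^ μ.card * jtDet μ P := by
  have h1 : (Matrix.of fun i k : Fin (μ.colLen 0) =>
      hval (fun a => t ^ (a + 1) * P ((i : ℤ) + 1 - μ.rowLen i) a) ((μ.rowLen i : ℤ) - i + k)) =
      Matrix.of fun i k : Fin (μ.colLen 0) => t ^ ((μ.rowLen i : ℤ) - i) *
        (Matrix.of fun i k : Fin (μ.colLen 0) => t ^ (k : ℤ) *
        (Matrix.of fun i k : Fin (μ.colLen 0) =>
          hval (P ((i : ℤ) + 1 - μ.rowLen i)) ((μ.rowLen i : ℤ) - i + k)) i k) i k := by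
    ext i k
    simp only [Matrix.of_apply]
    rw [hval_scale t, zpow_add₀ ht, mul_assoc]
  rw [jtDet, h1, Matrix.det_mul_column, Matrix.det_mul_row, ← mul_assoc,
    ← Finset.prod_mul_distrib, jtDet]
  congr 1
  rw [YoungDiagram.card_eq_sum_rowLen le_rfl, Finset.sum_range, ← Finset.prod_pow_eq_pow_sum]
  refine Finset.prod_congr rfl fun i _ => ?_
  rw [← zpow_add₀ ht, sub_add_cancel, zpow_natCast]

/-! ### The symmetric functions with scaled parameters -/

/-- The entries of the determinants in the definition of the `q`-Racah functions. -/
noncomputable def racahEntry (q : ℝ) (e₁ e₂ e₃ p : ℂ) (r r' : ℤ) : ℂ :=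
  if r - r' < 0 then 0 else
    (qPoch (e₁ * (q : ℂ) ^ r') q (r - r').toNat * qPoch (e₂ * (q : ℂ) ^ r') q (r - r').toNat *
        qPoch (e₃ * (q : ℂ) ^ r') q (r - r').toNat) /
      (((q : ℂ) ^ r') ^ (r - r') * qPoch q q (r - r').toNat *
        qPoch (p * (q : ℂ) ^ (r + r' - 1)) q (r - r').toNat)

theorem racahEntry_of_lt {q : ℝ} {e₁ e₂ e₃ p : ℂ} {r r' : ℤ} (h : r < r') :
    racahEntry q e₁ e₂ e₃ p r r' = 0 := if_pos (by omega)

theorem racahEntry_self {q : ℝ} {e₁ e₂ e₃ p : ℂ} (r : ℤ) :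
    racahEntry q e₁ e₂ e₃ p r r = 1 := by
  simp [racahEntry, qPoch]

/-- The determinant of `racahEntry`. -/
noncomputable def racahDet (q : ℝ) (e₁ e₂ e₃ p : ℂ) (l m : YoungDiagram) : ℂ :=
  (Matrix.of fun j k : Fin (l.colLen 0) =>
    racahEntry q e₁ e₂ e₃ p ((l.rowLen j : ℤ) - j) ((m.rowLen k : ℤ) - k)).det

theorem racahDet_eq_det {q : ℝ} {e₁ e₂ e₃ p : ℂ} {l m : YoungDiagram} (hm : m ≤ l) {N : ℕ}
    (hN : l.colLen 0 ≤ N) :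
    (Matrix.of fun j k : Fin N =>
      racahEntry q e₁ e₂ e₃ p ((l.rowLen j : ℤ) - j) ((m.rowLen k : ℤ) - k)).det =
      racahDet q e₁ e₂ e₃ p l m :=
  det_eq_of_unitriangular
    (A := fun j k => racahEntry q e₁ e₂ e₃ p ((l.rowLen j : ℤ) - j) ((m.rowLen k : ℤ) - k))
    (fun j hj k hk => racahEntry_of_lt (by rw [YoungDiagram.rowLen_eq_zero hj]; omega))
    (fun j hj => by
      have h1 := YoungDiagram.colLen_mono hm 0
      rw [YoungDiagram.rowLen_eq_zero hj, YoungDiagram.rowLen_eq_zero (h1.trans hj),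
        racahEntry_self]) hN

theorem racahDet_self (q : ℝ) (e₁ e₂ e₃ p : ℂ) (l : YoungDiagram) :
    racahDet q e₁ e₂ e₃ p l l = 1 := by
  rw [racahDet, Matrix.det_of_isUpperTriangular, Finset.prod_eq_one]
  · intro i _
    exact racahEntry_self _
  · intro i j hij
    have h1 := l.rowLen_anti j i (le_of_lt hij)
    have h2 : (j : ℕ) < i := hij
    exact racahEntry_of_lt (by omega)

theorem continuous_qPoch (q : ℂ) (n : ℕ) : Continuous fun x => qPoch x q n := by
  unfold qPoch
  fun_prop

theorem continuous_racahDet (q : ℝ) (e₂ e₃ p : ℂ) (l m : YoungDiagram) :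
    Continuous fun e₁ => racahDet q e₁ e₂ e₃ p l m := by
  refine Continuous.matrix_det (continuous_matrix fun i j => ?_)
  simp only [Matrix.of_apply, racahEntry]
  split_ifs
  · exact continuous_const
  · refine Continuous.div_const ?_ _
    exact (((continuous_qPoch _ _).comp (by fun_prop)).mul continuous_const).mul continuous_const

/-- The coefficients of the `q`-Racah functions with parameters `a, b, c, d, δ`; the big
`q`-Jacobi case is `δ = 0`. -/
noncomputable def scaledCoef (q a b : ℝ) (c d δ : ℂ) (l m : YoungDiagram) : ℂ :=
  c ^ ((m.card : ℤ) - l.card) *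
    racahDet q (-δ * c * d) (c / a * q) (c / b * q) (q ^ 2 * (c * d / (a * b))) l m

/-- The value of a linear combination of interpolation functions at power sums `P`. -/
noncomputable def jtComb (l : YoungDiagram) (κ : YoungDiagram → ℂ) (τ : ℤ → ℕ → ℂ) (P : ℕ → ℂ) :
    ℂ :=
  ∑ m ∈ (YoungDiagram.finite_setOf_le l).toFinset, κ m * jtDet m fun e a => P a - τ e a

theorem continuous_jtComb (l : YoungDiagram) :
    Continuous fun x : (YoungDiagram → ℂ) × (ℤ → ℕ → ℂ) × (ℕ → ℂ) =>
      jtComb l x.1 x.2.1 x.2.2 := by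
  unfold jtComb
  refine continuous_finsetSum _ fun m _ => ?_
  have h1 : Continuous fun x : (YoungDiagram → ℂ) × (ℤ → ℕ → ℂ) × (ℕ → ℂ) => x.1 m :=
    (continuous_apply m).comp continuous_fst
  have h2 : Continuous fun x : (YoungDiagram → ℂ) × (ℤ → ℕ → ℂ) × (ℕ → ℂ) =>
      fun (e : ℤ) (a : ℕ) => x.2.2 a - x.2.1 e a := by
    refine continuous_pi fun e => continuous_pi fun a => Continuous.sub ?_ ?_
    · exact (continuous_apply a).comp (continuous_snd.comp continuous_snd)
    · exact (continuous_apply a).comp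
        ((continuous_apply e).comp (continuous_fst.comp continuous_snd))
  have h3 := Continuous.comp' (continuous_jtDet m) h2
  exact h1.mul h3

/-- The `q`-Racah symmetric functions with scaled parameters. -/
noncomputable def scaledFun (q a b : ℝ) (c d δ : ℂ) (l : YoungDiagram) : SymFun :=
  ∑ m ∈ (YoungDiagram.finite_setOf_le l).toFinset,
    scaledCoef q a b c d δ l m • jtFun m (limitNodeSums q c δ)

theorem aeval_scaledFun (q a b : ℝ) (c d δ : ℂ) (l : YoungDiagram) (P : ℕ → ℂ) :
    MvPolynomial.aeval P (scaledFun q a b c d δ l) =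
      jtComb l (scaledCoef q a b c d δ l) (limitNodeSums q c δ) P := by
  simp only [scaledFun, jtComb, map_sum, map_smul, aeval_jtFun, smul_eq_mul]

theorem span_scaledFun (q a b : ℝ) (c d δ : ℂ) :
    Submodule.span ℂ (Set.range (scaledFun q a b c d δ)) = ⊤ := by
  classical
  refine span_eq_top_of_unitriangular fun l => ?_
  have hl : l ∈ (YoungDiagram.finite_setOf_le l).toFinset := by simp
  rw [scaledFun, ← Finset.add_sum_erase _ _ hl]
  have h1 : scaledCoef q a b c d δ l l = 1 := by simp [scaledCoef, racahDet_self]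
  rw [h1, one_smul, add_sub_right_comm]
  refine Submodule.add_mem _ (jtFun_sub_schurFun_mem _ _) (Submodule.sum_mem _ fun m hm => ?_)
  rw [Finset.mem_erase, Set.Finite.mem_toFinset] at hm
  have hcard : m.card < l.card :=
    Finset.card_lt_card (YoungDiagram.cells_ssubset_iff.2 (lt_of_le_of_ne hm.2 hm.1))
  refine Submodule.smul_mem _ _ ?_
  rw [← sub_add_cancel (jtFun m (limitNodeSums q c δ)) (schurFun m)]
  exact Submodule.add_mem _ (schurSpan_mono hcard.le (jtFun_sub_schurFun_mem _ _))
    (Submodule.subset_span ⟨m, hcard, rfl⟩)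

theorem scaledFun_bot (q a b : ℝ) (c d δ : ℂ) : scaledFun q a b c d δ ⊥ = 1 := by
  have h0 : (⊥ : YoungDiagram).colLen 0 = 0 := by
    by_contra h
    exact YoungDiagram.notMem_bot _ (YoungDiagram.mem_iff_lt_colLen.2 (Nat.pos_of_ne_zero h))
  have h1 : (YoungDiagram.finite_setOf_le ⊥).toFinset = {⊥} := by
    ext m; simp
  rw [scaledFun, h1, Finset.sum_singleton, scaledCoef, racahDet_self, sub_self, zpow_zero, one_mul,
    one_smul, jtFun, jtDet]
  have : IsEmpty (Fin ((⊥ : YoungDiagram).colLen 0)) := by rw [h0]; infer_instance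
  exact Matrix.det_isEmpty


/-! ### The `q`-Racah polynomials -/

/-- The correction factors of the `N`-variate expansion. -/
noncomputable def racahCorrection (q : ℝ) (N : ℕ) (l m : YoungDiagram) : ℂ :=
  ∏ i : Fin N, qPoch q q (l.exps N i) / qPoch q q (m.exps N i)

/-- The coefficients of the monic `q`-Racah polynomials in the Newton basis. -/
noncomputable def racahPolyCoef (q a b : ℝ) (c d δ : ℂ) (N l m : ℕ) : ℂ :=
  qPoch q q l / qPoch q q m * c ^ ((m : ℤ) - l) *
    racahEntry q (-δ * c * d) (c / a * q) (c / b * q) (q ^ 2 * (c * d / (a * b)))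
      ((l : ℤ) + 1 - N) ((m : ℤ) + 1 - N)

/-- The monic `q`-Racah polynomials. -/
noncomputable def racahPoly (q a b : ℝ) (c d δ : ℂ) (N l : ℕ) (x : ℂ) : ℂ :=
  ∑ m ∈ Finset.range (l + 1),
    racahPolyCoef q a b c d δ N l m * (newtonPoly (racahNode q c δ N) m).eval x

theorem racahPolyCoef_of_lt {q a b : ℝ} {c d δ : ℂ} {N l m : ℕ} (h : l < m) :
    racahPolyCoef q a b c d δ N l m = 0 := by
  rw [racahPolyCoef, racahEntry_of_lt (by omega), mul_zero]

section Params

variable {q : ℝ} (hq₀ : 0 < q) (hq₁ : q < 1)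

include hq₀ hq₁

theorem qPoch_self_ne_zero (n : ℕ) : qPoch q q n ≠ 0 := by
  refine Finset.prod_ne_zero_iff.2 fun k _ => ?_
  rw [← pow_succ']
  exact one_sub_pow_ne_zero hq₀ hq₁ k

theorem racahPolyCoef_self (a b : ℝ) (c d δ : ℂ) (N l : ℕ) :
    racahPolyCoef q a b c d δ N l l = 1 := by
  rw [racahPolyCoef, racahEntry_self, sub_self, zpow_zero,
    div_self (qPoch_self_ne_zero hq₀ hq₁ l), mul_one, mul_one]

/-- The ratio in row $i$ is a product of $\lambda_i-\mu_i$ factors $1-q^{n}$ with $n\to\infty$. Rows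
beyond those of $\lambda$ contribute exactly $1$, so the number of nontrivial factors is bounded. -/
theorem tendsto_racahCorrection {l m : YoungDiagram} (h : m ≤ l) :
    Tendsto (fun N => racahCorrection q N l m) atTop (𝓝 1) := by
  have hle := YoungDiagram.le_iff_rowLen.1 h
  have hratio : ∀ N i : ℕ, qPoch q q (l.rowLen i + (N - 1 - i)) /
      qPoch q q (m.rowLen i + (N - 1 - i)) = ∏ k ∈ Finset.range (l.rowLen i - m.rowLen i),
        (1 - (q : ℂ) * (q : ℂ) ^ (m.rowLen i + (N - 1 - i) + k)) := by
    intro N i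
    have h1 : l.rowLen i + (N - 1 - i) =
        (m.rowLen i + (N - 1 - i)) + (l.rowLen i - m.rowLen i) := by
      have := hle i
      omega
    rw [div_eq_iff (qPoch_self_ne_zero hq₀ hq₁ _), mul_comm, h1, qPoch, Finset.prod_range_add,
      qPoch]
  have hlim : Tendsto (fun N : ℕ => ∏ i ∈ Finset.range (l.colLen 0),
      ∏ k ∈ Finset.range (l.rowLen i - m.rowLen i),
        (1 - (q : ℂ) * (q : ℂ) ^ (m.rowLen i + (N - 1 - i) + k))) atTop (𝓝 1) := by
    have h1 : ∏ i ∈ Finset.range (l.colLen 0),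
        ∏ k ∈ Finset.range (l.rowLen i - m.rowLen i), (1 - (q : ℂ) * 0) = 1 := by simp
    refine (congrArg (fun z => Tendsto _ atTop (𝓝 z)) h1).mp ?_
    refine tendsto_finsetProd _ fun i _ => tendsto_finsetProd _ fun k _ =>
      (Tendsto.const_mul _ ?_).const_sub _
    have hq : ‖(q : ℂ)‖ < 1 := by rwa [Complex.norm_real, Real.norm_of_nonneg hq₀.le]
    have h2 : Tendsto (fun N : ℕ => m.rowLen i + (N - 1 - i) + k) atTop atTop := by
      refine tendsto_atTop.2 fun B => ?_
      filter_upwards [eventually_ge_atTop (B + 1 + i)] with N hN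
      omega
    exact Tendsto.comp (g := fun n : ℕ => (q : ℂ) ^ n)
      (tendsto_pow_atTop_nhds_zero_of_norm_lt_one hq) h2
  refine hlim.congr' ?_
  filter_upwards [eventually_ge_atTop (l.colLen 0)] with N hN
  rw [racahCorrection]
  simp only [YoungDiagram.exps]
  rw [← Finset.prod_range fun i => qPoch q q (l.rowLen i + (N - 1 - i)) /
      qPoch q q (m.rowLen i + (N - 1 - i))]
  rw [← Finset.prod_subset (Finset.range_mono hN)]
  · exact Finset.prod_congr rfl fun i _ => (hratio N i).symm
  · intro i _ hi
    rw [hratio, YoungDiagram.rowLen_eq_zero (i := i) (by simpa using hi)]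
    simp

end Params

/-- Cauchy–Binet for the expansion in Newton polynomials. The $q$-factorials and powers of $c$ split
into row and column factors, and the shift $\lambda_i+(N-1-i)+1-N=\lambda_i-i$ turns the remaining
entries into those of `racahDet`, in which $N$ no longer occurs. -/
theorem det_racahPoly {q : ℝ} (a b : ℝ) {c : ℂ} (hc : c ≠ 0) (d δ : ℂ) {N : ℕ} {l : YoungDiagram}
    (hl : l.colLen 0 ≤ N) (x : Fin N → ℂ) :
    (Matrix.of fun i j => racahPoly q a b c d δ N (l.exps N i) (x j)).det =
      vdm x * jtComb l (fun m => racahCorrection q N l m * scaledCoef q a b c d δ l m)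
        (fun e k => nodeSums (racahNode q c δ N) N e k) (psums x) := by
  simp only [racahPoly]
  rw [det_cauchyBinet hl (C := racahPolyCoef q a b c d δ N)
    (fun _ _ h => racahPolyCoef_of_lt h)
    fun m j => (newtonPoly (racahNode q c δ N) m).eval (x j), jtComb, Finset.mul_sum]
  refine Finset.sum_congr rfl fun m hm => ?_
  rw [Set.Finite.mem_toFinset] at hm
  have hmN : m.colLen 0 ≤ N := (YoungDiagram.colLen_mono hm 0).trans hl
  have h1 := det_newtonPoly_rowLen x (racahNode q c δ N) hmN
  have h2 : (Matrix.of fun k j => (newtonPoly (racahNode q c δ N) (m.exps N k)).eval (x j)).det =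
      vdm x * jtDet m fun e k => psums x k - nodeSums (racahNode q c δ N) N e k := h1
  rw [h2, mul_left_comm]
  congr 2
  have h3 : (Matrix.of fun i k : Fin N =>
      racahPolyCoef q a b c d δ N (l.exps N i) (m.exps N k)) =
      Matrix.of fun i k : Fin N => (qPoch q q (l.exps N i) * c ^ (-(l.exps N i : ℤ))) *
        (Matrix.of fun i k : Fin N => ((qPoch q q (m.exps N k))⁻¹ * c ^ (m.exps N k : ℤ)) *
        (Matrix.of fun i k : Fin N => racahEntry q (-δ * c * d) (c / a * q) (c / b * q)
          (q ^ 2 * (c * d / (a * b))) ((l.rowLen i : ℤ) - i) ((m.rowLen k : ℤ) - k)) i k) i k := by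
    ext i k
    simp only [Matrix.of_apply]
    have hi : ((l.exps N i : ℤ) + 1 - N) = (l.rowLen i : ℤ) - i := by
      have := i.2
      simp only [YoungDiagram.exps]; omega
    have hk : ((m.exps N k : ℤ) + 1 - N) = (m.rowLen k : ℤ) - k := by
      have := k.2
      simp only [YoungDiagram.exps]; omega
    rw [racahPolyCoef, hi, hk, sub_eq_add_neg (m.exps N k : ℤ), zpow_add₀ hc]
    ring
  rw [h3, Matrix.det_mul_column, Matrix.det_mul_row, racahDet_eq_det hm hl, racahCorrection,
    scaledCoef, Finset.prod_mul_distrib, Finset.prod_mul_distrib, Finset.prod_div_distrib,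
    Finset.prod_inv_distrib]
  have h4 : (∏ i, c ^ (-(l.exps N i : ℤ))) * ∏ i, c ^ (m.exps N i : ℤ) =
      c ^ ((m.card : ℤ) - l.card) := by
    have h5 : ∀ s : Finset (Fin N), ∀ f : Fin N → ℤ, ∏ i ∈ s, c ^ f i = c ^ ∑ i ∈ s, f i := by
      intro s f
      induction s using Finset.induction_on with
      | empty => simp
      | insert i s hi ih => rw [Finset.prod_insert hi, Finset.sum_insert hi, ih, zpow_add₀ hc]
    rw [h5, h5, ← zpow_add₀ hc, Finset.sum_neg_distrib, ← Nat.cast_sum, ← Nat.cast_sum,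
      YoungDiagram.sum_exps hl, YoungDiagram.sum_exps hmN]
    congr 1
    push_cast
    ring
  rw [← h4]
  ring


/-! ### The difference equation of the `q`-Racah polynomials -/

/-- The action of the operator on the Newton polynomial of degree $m+1$, after the common factors of
degree $m$ are divided out. Here $y=q^{m+1}$ and $w=\delta Q$; the shifted products have been
replaced by their telescoped forms. -/
theorem racah_operator_identity {q y v Q c d A B w : ℂ} (hq : q ≠ 0) (hy : y ≠ 0) (hv : v ≠ 0)
    (hQ : Q ≠ 0) (hc : c ≠ 0) (h1 : w + v ^ 2 ≠ 0) (h2 : w + q * v ^ 2 ≠ 0)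
    (h3 : v ^ 2 + q * w ≠ 0) :
    (1 - d * v / Q) * (w + A * v) * (w + B * v) / ((w + v ^ 2) * (w + q * v ^ 2)) *
      (-(c / Q) * (y * ((v - Q / (c * (y / q))) * (v - Q / (c * y))) *
        (1 + w / Q * c / (q * v))) -
        (1 - c * v / Q) * ((v - Q / (c * (y / q))) * (1 + w / Q * c * (y / q) / v))) +
    (v + w / Q * d) * (v - A) * (v - B) / ((w + v ^ 2) * (v ^ 2 + q * w)) *
      (v * (y⁻¹ * (v - Q * q / c) *
        ((1 + w / Q * c * (y / q) / v) * (1 + w / Q * c * y / v))) -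
        (v + w / Q * c) * ((v - Q / (c * (y / q))) * (1 + w / Q * c * (y / q) / v))) =
    (y⁻¹ - 1) * (1 - c * d * A * B / (q * Q ^ 2) * y) *
      ((v - Q / (c * (y / q))) * (1 + w / Q * c * (y / q) / v)) +
    (1 - y) * (c⁻¹ * y⁻¹ * (1 + w / Q * c * d * (y / (q * Q))) * (1 - c * A * (y / (q * Q))) *
      (1 - c * B * (y / (q * Q))) / (y / (q * Q))) := by
  have h2' : q * v ^ 2 + w ≠ 0 := by rwa [add_comm]
  have h3' : q * w + v ^ 2 ≠ 0 := by rwa [add_comm]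
  have h1' : v ^ 2 + w ≠ 0 := by rwa [add_comm]
  have h4' : w + v ^ 2 * q ≠ 0 := by rwa [mul_comm (v ^ 2)]
  have h5' : v ^ 2 + w * q ≠ 0 := by rwa [mul_comm w]
  have h6' : v ^ 2 * q + w ≠ 0 := by rwa [add_comm]
  have h7' : w * q + v ^ 2 ≠ 0 := by rwa [add_comm]
  field_simp
  ring

/-- The factor `∏_{k<m} (v - Q / (c q^k))`. -/
noncomputable def upFactor (q c Q : ℂ) (m : ℕ) (v : ℂ) : ℂ :=
  ∏ k ∈ Finset.range m, (v - Q / (c * q ^ k))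

/-- The factor `∏_{k<m} (1 + δ c q^k / v)`. -/
noncomputable def downFactor (q c δ : ℂ) (m : ℕ) (v : ℂ) : ℂ :=
  ∏ k ∈ Finset.range m, (1 + δ * c * q ^ k / v)

/-- The substitution $v\mapsto qv$ shifts the index of each factor by one. The initial factor
$v-Q/c$ that gets lost is restored by $1-cv/Q$ in `racahUp`. -/
theorem upFactor_mul {q : ℂ} (hq : q ≠ 0) (c Q : ℂ) (m : ℕ) (v : ℂ) :
    upFactor q c Q (m + 1) (q * v) * (v - Q / c) =
      q ^ (m + 1) * (upFactor q c Q m v * (v - Q / (c * q ^ m)) * (v - Q / (c * q ^ (m + 1)))) := by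
  have h1 : upFactor q c Q (m + 1) (q * v) =
      q ^ (m + 1) * ∏ k ∈ Finset.range (m + 1), (v - Q / (c * q ^ (k + 1))) := by
    have h : ∀ k, q * v - Q / (c * q ^ k) = q * (v - Q / (c * q ^ (k + 1))) := fun k => by
      rw [mul_sub, pow_succ]
      congr 1
      field_simp
    simp only [upFactor, h]
    rw [Finset.prod_mul_distrib, Finset.prod_const, Finset.card_range]
  have h2 : (∏ k ∈ Finset.range (m + 1), (v - Q / (c * q ^ (k + 1)))) * (v - Q / c) =
      ∏ k ∈ Finset.range (m + 2), (v - Q / (c * q ^ k)) := by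
    rw [Finset.prod_range_succ' _ (m + 1)]
    simp
  rw [h1, mul_assoc, h2, Finset.prod_range_succ, Finset.prod_range_succ, upFactor]

theorem upFactor_div {q : ℂ} (hq : q ≠ 0) (c Q : ℂ) (m : ℕ) (v : ℂ) :
    upFactor q c Q (m + 1) (v / q) = (q ^ (m + 1))⁻¹ * (v - Q * q / c) * upFactor q c Q m v := by
  have h : ∀ k, v / q - Q / (c * q ^ (k + 1)) = q⁻¹ * (v - Q / (c * q ^ k)) := fun k => by
    rw [mul_sub, pow_succ]
    congr 1
    · rw [div_eq_inv_mul]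
    · field_simp
  rw [upFactor, Finset.prod_range_succ']
  simp only [h]
  rw [Finset.prod_mul_distrib, Finset.prod_const, Finset.card_range, upFactor]
  have h0 : v / q - Q / (c * q ^ 0) = q⁻¹ * (v - Q * q / c) := by
    rw [pow_zero, mul_one, mul_sub]
    congr 1
    · rw [div_eq_inv_mul]
    · field_simp
  rw [h0, ← inv_pow, pow_succ]
  ring

theorem downFactor_mul {q : ℂ} (hq : q ≠ 0) (c δ : ℂ) (m : ℕ) (v : ℂ) :
    downFactor q c δ (m + 1) (q * v) = (1 + δ * c / (q * v)) * downFactor q c δ m v := by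
  have h : ∀ k, 1 + δ * c * q ^ (k + 1) / (q * v) = 1 + δ * c * q ^ k / v := fun k => by
    rw [pow_succ, ← mul_assoc, mul_comm _ q, mul_div_mul_left _ _ hq]
  rw [downFactor, Finset.prod_range_succ']
  simp only [h]
  rw [downFactor, pow_zero, mul_one, mul_comm]

/-- Here $v\mapsto v/q$ shifts the index up, and the lost factor $1+\delta c/v$ is restored by
$v+\delta c$ in `racahDown`. -/
theorem downFactor_div {q : ℂ} (hq : q ≠ 0) (c δ : ℂ) (m : ℕ) (v : ℂ) :
    downFactor q c δ (m + 1) (v / q) * (1 + δ * c / v) =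
      downFactor q c δ m v * ((1 + δ * c * q ^ m / v) * (1 + δ * c * q ^ (m + 1) / v)) := by
  have h : ∀ k, 1 + δ * c * q ^ k / (v / q) = 1 + δ * c * q ^ (k + 1) / v := fun k => by
    rw [pow_succ]
    congr 1
    field_simp
  simp only [downFactor, h]
  have h2 : (∏ k ∈ Finset.range (m + 1), (1 + δ * c * q ^ (k + 1) / v)) * (1 + δ * c / v) =
      ∏ k ∈ Finset.range (m + 2), (1 + δ * c * q ^ k / v) := by
    rw [Finset.prod_range_succ' _ (m + 1)]
    simp
  rw [h2, Finset.prod_range_succ, Finset.prod_range_succ, mul_assoc]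

/-- The coefficient of the upward shift. -/
noncomputable def racahUp (q Q c d A B δ v : ℂ) : ℂ :=
  (1 - c * v / Q) * ((1 - d * v / Q) * (δ * Q + A * v) * (δ * Q + B * v) /
    ((δ * Q + v ^ 2) * (δ * Q + q * v ^ 2)))

/-- The coefficient of the downward shift. -/
noncomputable def racahDown (q Q c d A B δ v : ℂ) : ℂ :=
  (v + δ * c) * ((v + δ * d) * (v - A) * (v - B) /
    ((δ * Q + v ^ 2) * (v ^ 2 + q * (δ * Q))))

/-- The eigenvalues of the difference operator. -/
noncomputable def racahEig (q p : ℂ) (m : ℕ) : ℂ := ((q ^ m)⁻¹ - 1) * (1 - p * q ^ m)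

/-- The lowering coefficient of the difference operator in the Newton basis. -/
noncomputable def racahLower (q Q c d A B δ : ℂ) (m : ℕ) : ℂ :=
  (1 - q ^ m) * (c⁻¹ * (q ^ m)⁻¹ * (1 + δ * c * d * (q ^ m / (q * Q))) *
    (1 - c * A * (q ^ m / (q * Q))) * (1 - c * B * (q ^ m / (q * Q))) / (q ^ m / (q * Q)))

/-- In the Newton basis the difference operator is bidiagonal, sending degree $m$ to degrees $m$ and
$m-1$. For $m=0$ the lowering coefficient vanishes, so the truncated index $m-1$ is harmless. -/
theorem racah_operator_factor {q v Q c d A B δ : ℂ} (hq : q ≠ 0) (hv : v ≠ 0)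
    (hQ : Q ≠ 0) (hc : c ≠ 0) (h1 : δ * Q + v ^ 2 ≠ 0) (h2 : δ * Q + q * v ^ 2 ≠ 0)
    (h3 : v ^ 2 + q * (δ * Q) ≠ 0) (m : ℕ) :
    racahUp q Q c d A B δ v *
        (upFactor q c Q m (q * v) * downFactor q c δ m (q * v) -
          upFactor q c Q m v * downFactor q c δ m v) +
      racahDown q Q c d A B δ v *
        (upFactor q c Q m (v / q) * downFactor q c δ m (v / q) -
          upFactor q c Q m v * downFactor q c δ m v) =
      racahEig q (c * d * A * B / (q * Q ^ 2)) m * (upFactor q c Q m v * downFactor q c δ m v) +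
        racahLower q Q c d A B δ m *
          (upFactor q c Q (m - 1) v * downFactor q c δ (m - 1) v) := by
  cases m with
  | zero => simp [upFactor, downFactor, racahEig, racahLower]
  | succ m =>
    have hy : q ^ (m + 1) ≠ 0 := pow_ne_zero _ hq
    have key := racah_operator_identity (d := d) (A := A) (B := B) hq hy hv hQ hc h1 h2 h3
    have hym : q ^ (m + 1) / q = q ^ m := by rw [pow_succ, mul_div_cancel_right₀ _ hq]
    rw [mul_div_cancel_right₀ _ hQ, hym] at key
    have e1 := upFactor_mul hq c Q m v
    have e2 := upFactor_div hq c Q m v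
    have e3 := downFactor_mul hq c δ m v
    have e4 := downFactor_div hq c δ m v
    have e5 : upFactor q c Q (m + 1) v = upFactor q c Q m v * (v - Q / (c * q ^ m)) := by
      rw [upFactor, Finset.prod_range_succ, upFactor]
    have e6 : downFactor q c δ (m + 1) v = downFactor q c δ m v * (1 + δ * c * q ^ m / v) := by
      rw [downFactor, Finset.prod_range_succ, downFactor]
    rw [Nat.add_sub_cancel, racahUp, racahDown, racahEig, racahLower]
    set U := upFactor q c Q m v
    set W := downFactor q c δ m v
    set X := (1 - d * v / Q) * (δ * Q + A * v) * (δ * Q + B * v) /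
      ((δ * Q + v ^ 2) * (δ * Q + q * v ^ 2))
    set Y := (v + δ * d) * (v - A) * (v - B) / ((δ * Q + v ^ 2) * (v ^ 2 + q * (δ * Q)))
    have e7 : (1 - c * v / Q) = -(c / Q) * (v - Q / c) := by field_simp; ring
    have e8 : v + δ * c = v * (1 + δ * c / v) := by field_simp
    have t1 : (1 - c * v / Q) * (upFactor q c Q (m + 1) (q * v) * downFactor q c δ (m + 1) (q * v)) =
        U * W * (-(c / Q) * (q ^ (m + 1) * ((v - Q / (c * q ^ m)) *
          (v - Q / (c * q ^ (m + 1)))) * (1 + δ * c / (q * v)))) := by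
      rw [e7, e3]
      linear_combination (-(c / Q) * (1 + δ * c / (q * v)) * W) * e1
    have t2 : (v + δ * c) * (upFactor q c Q (m + 1) (v / q) * downFactor q c δ (m + 1) (v / q)) =
        U * W * (v * ((q ^ (m + 1))⁻¹ * (v - Q * q / c) *
          ((1 + δ * c * q ^ m / v) * (1 + δ * c * q ^ (m + 1) / v)))) := by
      rw [e8, e2]
      linear_combination (v * (q ^ (m + 1))⁻¹ * (v - Q * q / c) * U) * e4
    rw [e5, e6]
    linear_combination X * t1 + Y * t2 + U * W * key

section Params

variable {q : ℝ} (hq₀ : 0 < q) (hq₁ : q < 1)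

include hq₀

/-- In the coordinate $x=v-\delta Q/v$ with $Q=q^{N-1}$, the difference of $x$ and the $k$-th node
factors as $(v-Q/(cq^k))(1+\delta cq^k/v)$. -/
theorem newtonPoly_racahNode_eval {c : ℂ} (hc : c ≠ 0) (δ : ℂ) (N m : ℕ) {v : ℂ} (hv : v ≠ 0) :
    (newtonPoly (racahNode q c δ N) m).eval (v - δ * (q : ℂ) ^ ((N : ℤ) - 1) / v) =
      upFactor q c ((q : ℂ) ^ ((N : ℤ) - 1)) m v * downFactor q c δ m v := by
  have hq : (q : ℂ) ≠ 0 := by exact_mod_cast hq₀.ne'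
  rw [newtonPoly, Polynomial.eval_prod, upFactor, downFactor, ← Finset.prod_mul_distrib]
  refine Finset.prod_congr rfl fun k _ => ?_
  rw [Polynomial.eval_sub, Polynomial.eval_X, Polynomial.eval_C, racahNode,
    show (N : ℤ) - k - 1 = ((N : ℤ) - 1) - k by ring, zpow_sub₀ hq _ (k : ℤ), zpow_natCast]
  have := pow_ne_zero k hq
  field_simp
  ring

include hq₁

/-- A two-term recurrence in the column index, obtained by removing the first factor of the
parameter-dependent Pochhammer symbols and the last factor of $(q;q)$. -/
theorem racahEntry_step {e₁ e₂ e₃ p : ℂ} (hp : ∀ z : ℤ, 1 - p * (q : ℂ) ^ z ≠ 0) (r : ℤ) (k : ℕ) :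
    racahEntry q e₁ e₂ e₃ p (r + (k + 1)) r * ((q : ℂ) ^ r * (1 - (q : ℂ) ^ (k + 1)) *
      (1 - p * (q : ℂ) ^ (2 * r + k))) =
    racahEntry q e₁ e₂ e₃ p (r + (k + 1)) (r + 1) * ((1 - e₁ * (q : ℂ) ^ r) *
      (1 - e₂ * (q : ℂ) ^ r) * (1 - e₃ * (q : ℂ) ^ r) * (q : ℂ) ^ k) := by
  have hq : (q : ℂ) ≠ 0 := by exact_mod_cast hq₀.ne'
  have hs : ∀ x : ℂ, qPoch x q (k + 1) = (1 - x) * qPoch (x * q) q k := by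
    intro x
    rw [qPoch, Finset.prod_range_succ', pow_zero, mul_one, mul_comm, qPoch]
    congr 1
    refine Finset.prod_congr rfl fun i _ => ?_
    rw [pow_succ']; ring
  have hs' : qPoch q q (k + 1) = qPoch q q k * (1 - (q : ℂ) ^ (k + 1)) := by
    rw [qPoch, Finset.prod_range_succ, qPoch, ← pow_succ']
  have h1 : (q : ℂ) ^ (r + 1) = (q : ℂ) ^ r * q := zpow_add_one₀ hq r
  have h2 : ∀ x : ℂ, x * (q : ℂ) ^ (r + 1) = x * (q : ℂ) ^ r * q := fun x => by rw [h1]; ring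
  rw [racahEntry, racahEntry, if_neg (by omega), if_neg (by omega)]
  have h3 : (r + ((k : ℤ) + 1) - r).toNat = k + 1 := by omega
  have h4 : (r + ((k : ℤ) + 1) - (r + 1)).toNat = k := by omega
  rw [h3, h4, hs, hs, hs, hs', hs, h2, h2, h2]
  have h5 : r + ((k : ℤ) + 1) + r - 1 = 2 * r + k := by ring
  have h6 : p * (q : ℂ) ^ (r + ((k : ℤ) + 1) + (r + 1) - 1) = p * (q : ℂ) ^ (2 * r + (k : ℤ)) * q := by
    rw [mul_assoc, ← zpow_add_one₀ hq]
    congr 2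
    ring
  rw [h5, h6]
  have h7 : ((q : ℂ) ^ r) ^ (r + ((k : ℤ) + 1) - r) = ((q : ℂ) ^ r) ^ k * (q : ℂ) ^ r := by
    rw [show r + ((k : ℤ) + 1) - r = (k : ℤ) + 1 by ring, zpow_add_one₀ (zpow_ne_zero _ hq),
      zpow_natCast]
  have h8 : ((q : ℂ) ^ (r + 1)) ^ (r + ((k : ℤ) + 1) - (r + 1)) =
      ((q : ℂ) ^ r) ^ k * (q : ℂ) ^ k := by
    rw [show r + ((k : ℤ) + 1) - (r + 1) = (k : ℤ) by ring, zpow_natCast, h1, mul_pow]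
  rw [h7, h8]
  have n1 : (q : ℂ) ^ r ≠ 0 := zpow_ne_zero _ hq
  have n2 := hp (2 * r + k)
  have n3 := qPoch_self_ne_zero hq₀ hq₁ k
  have n4 : qPoch (p * (q : ℂ) ^ (2 * r + (k : ℤ)) * q) q k ≠ 0 := by
    refine Finset.prod_ne_zero_iff.2 fun i _ => ?_
    have := hp (2 * r + k + 1 + i)
    rw [zpow_add₀ hq, zpow_add_one₀ hq, zpow_natCast] at this
    convert this using 2
    ring
  have n5 := one_sub_pow_ne_zero hq₀ hq₁ k
  have n6 : (q : ℂ) ^ k ≠ 0 := pow_ne_zero _ hq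
  have n7 : ((q : ℂ) ^ r) ^ k ≠ 0 := pow_ne_zero _ n1
  generalize (q : ℂ) ^ r = u at *
  generalize qPoch (p * (q : ℂ) ^ (2 * r + (k : ℤ)) * q) q k = X1 at *
  generalize (q : ℂ) ^ (2 * r + (k : ℤ)) = X2 at *
  generalize qPoch (q : ℂ) q k = X3 at *
  generalize (1 - (q : ℂ) ^ (k + 1)) = X4 at *
  generalize (q : ℂ) ^ k = X5 at *
  generalize u ^ k = X6 at *
  field_simp

end Params


/-! ### Sign conditions supplied by admissibility -/

/-- The consequences of admissibility used below. -/
structure RacahPositive (q a b : ℝ) (c d : ℂ) : Prop where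
  ha : 0 < a
  hb : b < 0
  hc : c ≠ 0
  hd : d ≠ 0
  hp : ∃ p : ℝ, p < 0 ∧ (p : ℂ) = q ^ 2 * (c * d / (a * b))
  ha' : ∀ k : ℤ, ∃ r : ℝ, 0 < r ∧ (r : ℂ) = (1 - c / a * (q : ℂ) ^ k) * (1 - d / a * (q : ℂ) ^ k)
  hb' : ∀ k : ℤ, ∃ r : ℝ, 0 < r ∧ (r : ℂ) = (1 - c / b * (q : ℂ) ^ k) * (1 - d / b * (q : ℂ) ^ k)

/-- Since $x/a$ and $y/a$ lie in the same gap between consecutive powers of $q$, the two factors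
have the same sign for every $k$. -/
theorem pos_of_mem_Ioo {q a x y : ℝ} (hq₀ : 0 < q) (hq₁ : q < 1) (ha : 0 < a) {m : ℤ}
    (hx : x ∈ Set.Ioo (a * q ^ m) (a * q ^ (m - 1)))
    (hy : y ∈ Set.Ioo (a * q ^ m) (a * q ^ (m - 1))) (k : ℤ) :
    0 < (1 - x / a * q ^ k) * (1 - y / a * q ^ k) := by
  have key : ∀ z ∈ Set.Ioo (a * q ^ m) (a * q ^ (m - 1)),
      (1 - m ≤ k → 0 < 1 - z / a * q ^ k) ∧ (k ≤ -m → 1 - z / a * q ^ k < 0) := by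
    intro z hz
    have h1 : q ^ m < z / a := by rw [lt_div_iff₀ ha, mul_comm]; exact hz.1
    have h2 : z / a < q ^ (m - 1) := by rw [div_lt_iff₀ ha, mul_comm]; exact hz.2
    have hk := zpow_pos hq₀ k
    constructor
    · intro h
      have h3 : z / a * q ^ k < q ^ (m - 1) * q ^ k := mul_lt_mul_of_pos_right h2 hk
      rw [← zpow_add₀ hq₀.ne'] at h3
      have h4 : q ^ (m - 1 + k) ≤ q ^ (0 : ℤ) :=
        zpow_le_zpow_right_of_le_one₀ hq₀ hq₁.le (by omega)
      rw [zpow_zero] at h4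
      linarith
    · intro h
      have h3 : q ^ m * q ^ k < z / a * q ^ k := mul_lt_mul_of_pos_right h1 hk
      rw [← zpow_add₀ hq₀.ne'] at h3
      have h4 : q ^ (0 : ℤ) ≤ q ^ (m + k) :=
        zpow_le_zpow_right_of_le_one₀ hq₀ hq₁.le (by omega)
      rw [zpow_zero] at h4
      linarith
  rcases le_or_gt (1 - m) k with h | h
  · exact mul_pos ((key x hx).1 h) ((key y hy).1 h)
  · exact mul_pos_of_neg_of_neg ((key x hx).2 (by omega)) ((key y hy).2 (by omega))

/-- For conjugate parameters the products are squared moduli. For real ones, the endpoint of the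
same sign is handled by the gap condition, and for the endpoint of opposite sign both factors exceed
$1$. -/
theorem BigQJacobiAdmissible.racahPositive {q a b : ℝ} {c d : ℂ} (hq₀ : 0 < q) (hq₁ : q < 1)
    (h : BigQJacobiAdmissible q a b c d) : RacahPositive q a b c d := by
  obtain ⟨hb, ha, h⟩ := h
  have hab : a * b < 0 := mul_neg_of_pos_of_neg ha hb
  rcases h with ⟨rfl, hc⟩ | ⟨x, y, rfl, rfl, m, hx, hy⟩ | ⟨x, y, rfl, rfl, m, hx, hy⟩
  · have hc0 : c ≠ 0 := by rintro rfl; simp at hc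
    have hconj : ∀ s : ℝ, s ≠ 0 → ∀ k : ℤ, ∃ r : ℝ, 0 < r ∧ (r : ℂ) =
        (1 - c / s * (q : ℂ) ^ k) * (1 - (starRingEnd ℂ) c / s * (q : ℂ) ^ k) := by
      intro s hs k
      refine ⟨Complex.normSq (1 - c / s * (q : ℂ) ^ k), Complex.normSq_pos.2 fun h => ?_, ?_⟩
      · have h1 := congrArg Complex.im h
        have h2 : c / s * (q : ℂ) ^ k = ((q ^ k / s : ℝ) : ℂ) * c := by push_cast; ring
        rw [h2, Complex.sub_im, Complex.im_ofReal_mul, Complex.one_im, Complex.zero_im, zero_sub,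
          neg_eq_zero] at h1
        exact mul_ne_zero (div_ne_zero (zpow_ne_zero _ hq₀.ne') hs) hc h1
      · rw [← Complex.mul_conj]
        simp
    refine ⟨ha, hb, hc0, by simpa using hc0, ⟨q ^ 2 * (Complex.normSq c / (a * b)), ?_, ?_⟩,
      hconj a ha.ne', hconj b hb.ne⟩
    · exact mul_neg_of_pos_of_neg (by positivity)
        (div_neg_of_pos_of_neg (Complex.normSq_pos.2 hc0) hab)
    · push_cast
      rw [← Complex.mul_conj]
  · have hz : ∀ z ∈ Set.Ioo (a * q ^ m) (a * q ^ (m - 1)), 0 < z := fun z hz =>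
      (mul_pos ha (zpow_pos hq₀ m)).trans hz.1
    have hx0 := hz x hx
    have hy0 := hz y hy
    refine ⟨ha, hb, by exact_mod_cast hx0.ne', by exact_mod_cast hy0.ne',
      ⟨q ^ 2 * (x * y / (a * b)), ?_, by push_cast; ring⟩, fun k => ?_, fun k => ?_⟩
    · exact mul_neg_of_pos_of_neg (by positivity) (div_neg_of_pos_of_neg (by positivity) hab)
    · exact ⟨_, pos_of_mem_Ioo hq₀ hq₁ ha hx hy k, by push_cast; ring⟩
    · refine ⟨(1 - x / b * q ^ k) * (1 - y / b * q ^ k), ?_, by push_cast; ring⟩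
      have hk := zpow_pos hq₀ k
      have h1 := mul_neg_of_neg_of_pos (div_neg_of_pos_of_neg hx0 hb) hk
      have h2 := mul_neg_of_neg_of_pos (div_neg_of_pos_of_neg hy0 hb) hk
      exact mul_pos (by linarith) (by linarith)
  · have hz : ∀ z ∈ Set.Ioo (b * q ^ (m - 1)) (b * q ^ m), z < 0 := fun z hz =>
      hz.2.trans (mul_neg_of_neg_of_pos hb (zpow_pos hq₀ m))
    have hx0 := hz x hx
    have hy0 := hz y hy
    have hflip : ∀ z ∈ Set.Ioo (b * q ^ (m - 1)) (b * q ^ m),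
        -z ∈ Set.Ioo (-b * q ^ m) (-b * q ^ (m - 1)) := fun z hz =>
      ⟨by linarith [hz.2], by linarith [hz.1]⟩
    refine ⟨ha, hb, by exact_mod_cast hx0.ne, by exact_mod_cast hy0.ne,
      ⟨q ^ 2 * (x * y / (a * b)), ?_, by push_cast; ring⟩, fun k => ?_, fun k => ?_⟩
    · exact mul_neg_of_pos_of_neg (by positivity)
        (div_neg_of_pos_of_neg (mul_pos_of_neg_of_neg hx0 hy0) hab)
    · refine ⟨(1 - x / a * q ^ k) * (1 - y / a * q ^ k), ?_, by push_cast; ring⟩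
      have hk := zpow_pos hq₀ k
      have h1 := mul_neg_of_neg_of_pos (div_neg_of_neg_of_pos hx0 ha) hk
      have h2 := mul_neg_of_neg_of_pos (div_neg_of_neg_of_pos hy0 ha) hk
      exact mul_pos (by linarith) (by linarith)
    · refine ⟨_, pos_of_mem_Ioo hq₀ hq₁ (neg_pos.2 hb) (hflip x hx) (hflip y hy) k, ?_⟩
      push_cast
      rw [neg_div_neg_eq, neg_div_neg_eq]

/-! ### The polynomials as eigenfunctions -/

section Eigen

variable {q a b : ℝ} {c d : ℂ} (hq₀ : 0 < q) (hq₁ : q < 1) (H : RacahPositive q a b c d)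

include hq₀ H

theorem RacahPositive.one_sub_ne_zero (z : ℤ) :
    1 - (q : ℂ) ^ 2 * (c * d / (a * b)) * (q : ℂ) ^ z ≠ 0 := by
  obtain ⟨p, hp, h⟩ := H.hp
  rw [← h]
  have h1 : (0 : ℝ) < 1 - p * q ^ z := by
    have := mul_neg_of_neg_of_pos hp (zpow_pos hq₀ z)
    linarith
  exact_mod_cast h1.ne'

include hq₁

/-- For a bidiagonal operator, being an eigenvector means exactly such a relation between
neighbouring coefficients. It is `racahEntry_step` at $r=m+1-N$, multiplied by the normalizing
factors. -/
theorem racahPolyCoef_step (δ : ℂ) (N : ℕ) {l m : ℕ} (hm : m < l) :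
    (racahEig q (c * d * (q / a) * (q / b) / (q * ((q : ℂ) ^ ((N : ℤ) - 1)) ^ 2)) l -
      racahEig q (c * d * (q / a) * (q / b) / (q * ((q : ℂ) ^ ((N : ℤ) - 1)) ^ 2)) m) *
      racahPolyCoef q a b c d δ N l m =
    racahLower q ((q : ℂ) ^ ((N : ℤ) - 1)) c d (q / a) (q / b) δ (m + 1) *
      racahPolyCoef q a b c d δ N l (m + 1) := by
  obtain ⟨k, rfl⟩ : ∃ k, l = m + (k + 1) := ⟨l - m - 1, by omega⟩
  have hq : (q : ℂ) ≠ 0 := by exact_mod_cast hq₀.ne'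
  have hc := H.hc
  have ha : (a : ℂ) ≠ 0 := by exact_mod_cast H.ha.ne'
  have hb : (b : ℂ) ≠ 0 := by exact_mod_cast H.hb.ne
  set r : ℤ := (m : ℤ) + 1 - N with hr
  have hstep := racahEntry_step hq₀ hq₁ (e₁ := -δ * c * d) (e₂ := c / a * q) (e₃ := c / b * q)
    (H.one_sub_ne_zero hq₀) r k
  have hP := qPoch_self_ne_zero hq₀ hq₁ m
  have hs' : qPoch q q (m + 1) = qPoch q q m * (1 - (q : ℂ) ^ (m + 1)) := by
    rw [qPoch, Finset.prod_range_succ, qPoch, ← pow_succ']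
  have hn := one_sub_pow_ne_zero hq₀ hq₁ m
  set Q : ℂ := (q : ℂ) ^ ((N : ℤ) - 1) with hQ
  have hQ0 : Q ≠ 0 := zpow_ne_zero _ hq
  set u : ℂ := (q : ℂ) ^ r with hu
  have hu0 : u ≠ 0 := zpow_ne_zero _ hq
  have hy : (q : ℂ) ^ (m + 1) / (q * Q) = u := by
    rw [hQ, hu, hr, ← zpow_natCast, ← zpow_one_add₀ hq, ← zpow_sub₀ hq]
    congr 1
    push_cast
    ring
  have hym : (q : ℂ) ^ m = u * Q := by
    rw [← hy, pow_succ]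
    field_simp
  have e1 : (((m + (k + 1) : ℕ) : ℤ) + 1 - N) = r + (k + 1) := by rw [hr]; push_cast; ring
  have e2 : (((m + 1 : ℕ) : ℤ) + 1 - N) = r + 1 := by rw [hr]; push_cast; ring
  have e3 : (q : ℂ) ^ 2 * (c * d / (a * b)) * (q : ℂ) ^ (2 * r + k) =
      c * d * (q / a) * (q / b) / (q * Q ^ 2) * ((q : ℂ) ^ (m + (k + 1)) * (q : ℂ) ^ m) := by
    have : (q : ℂ) ^ (2 * r + k) = u ^ 2 * (q : ℂ) ^ k := by
      rw [zpow_add₀ hq, zpow_natCast, two_mul, zpow_add₀ hq, ← sq]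
    rw [this, pow_add, pow_succ, hym]
    field_simp
    ring
  have e4 : c ^ (((m + 1 : ℕ) : ℤ) - ((m + (k + 1) : ℕ) : ℤ)) =
      c ^ ((m : ℤ) - ((m + (k + 1) : ℕ) : ℤ)) * c := by
    rw [← zpow_add_one₀ hc]
    congr 1
    push_cast
    ring
  rw [racahPolyCoef, racahPolyCoef, e1, e2, e4, hs', racahLower, hy, racahEig, racahEig]
  rw [e3] at hstep
  set E0 := racahEntry q (-δ * c * d) (c / a * q) (c / b * q) (q ^ 2 * (c * d / (a * b)))
    (r + (k + 1)) r
  set E1 := racahEntry q (-δ * c * d) (c / a * q) (c / b * q) (q ^ 2 * (c * d / (a * b)))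
    (r + (k + 1)) (r + 1)
  set p' := c * d * (q / a) * (q / b) / (q * Q ^ 2)
  have hym0 : (q : ℂ) ^ m ≠ 0 := pow_ne_zero _ hq
  have hyk0 : (q : ℂ) ^ k ≠ 0 := pow_ne_zero _ hq
  have hE0 : E0 * ((1 - (q : ℂ) ^ (k + 1)) * (1 - p' * ((q : ℂ) ^ (m + (k + 1)) * (q : ℂ) ^ m))) =
      E1 * ((1 - -δ * c * d * u) * (1 - c / a * q * u) * (1 - c / b * q * u) * (q : ℂ) ^ k) / u := by
    rw [eq_div_iff hu0, ← hstep]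
    ring
  -- The difference of two eigenvalues factors, which supplies the factors $1-q^{l-m}$ and
  -- $1-p'q^{l+m}$ on the left of the entry recurrence.
  have hL : (((q : ℂ) ^ (m + (k + 1)))⁻¹ - 1) * (1 - p' * (q : ℂ) ^ (m + (k + 1))) -
      (((q : ℂ) ^ m)⁻¹ - 1) * (1 - p' * (q : ℂ) ^ m) = ((q : ℂ) ^ (m + (k + 1)))⁻¹ *
      ((1 - (q : ℂ) ^ (k + 1)) * (1 - p' * ((q : ℂ) ^ (m + (k + 1)) * (q : ℂ) ^ m))) := by
    rw [pow_add _ m]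
    have : (q : ℂ) ^ (k + 1) ≠ 0 := pow_ne_zero _ hq
    field_simp
    ring
  rw [hL]
  generalize qPoch (q : ℂ) (q : ℂ) (m + (k + 1)) = G
  generalize c ^ ((m : ℤ) - ((m + (k + 1) : ℕ) : ℤ)) = G2
  calc _ = ((q : ℂ) ^ (m + (k + 1)))⁻¹ * (G / qPoch q q m * G2) *
        (E0 * ((1 - (q : ℂ) ^ (k + 1)) *
          (1 - p' * ((q : ℂ) ^ (m + (k + 1)) * (q : ℂ) ^ m)))) := by ring
    _ = _ := by
      rw [hE0]
      have e5 : (q : ℂ) ^ (m + (k + 1)) = (q : ℂ) ^ (m + 1) * (q : ℂ) ^ k := by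
        rw [← pow_add]; congr 1; ring
      have hm10 : (q : ℂ) ^ (m + 1) ≠ 0 := pow_ne_zero _ hq
      rw [e5]
      generalize (q : ℂ) ^ (m + 1) = Y at *
      generalize (q : ℂ) ^ k = K at *
      generalize qPoch (q : ℂ) (q : ℂ) m = G3 at *
      field_simp
      ring

theorem racahPoly_operator (δ : ℂ) (N l : ℕ) {v : ℂ} (hv : v ≠ 0)
    (h1 : δ * (q : ℂ) ^ ((N : ℤ) - 1) + v ^ 2 ≠ 0)
    (h2 : δ * (q : ℂ) ^ ((N : ℤ) - 1) + q * v ^ 2 ≠ 0)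
    (h3 : v ^ 2 + q * (δ * (q : ℂ) ^ ((N : ℤ) - 1)) ≠ 0) :
    racahUp q ((q : ℂ) ^ ((N : ℤ) - 1)) c d (q / a) (q / b) δ v *
        (racahPoly q a b c d δ N l (q * v - δ * (q : ℂ) ^ ((N : ℤ) - 1) / (q * v)) -
          racahPoly q a b c d δ N l (v - δ * (q : ℂ) ^ ((N : ℤ) - 1) / v)) +
      racahDown q ((q : ℂ) ^ ((N : ℤ) - 1)) c d (q / a) (q / b) δ v *
        (racahPoly q a b c d δ N l (v / q - δ * (q : ℂ) ^ ((N : ℤ) - 1) / (v / q)) -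
          racahPoly q a b c d δ N l (v - δ * (q : ℂ) ^ ((N : ℤ) - 1) / v)) =
      racahEig q (c * d * (q / a) * (q / b) / (q * ((q : ℂ) ^ ((N : ℤ) - 1)) ^ 2)) l *
        racahPoly q a b c d δ N l (v - δ * (q : ℂ) ^ ((N : ℤ) - 1) / v) := by
  have hq : (q : ℂ) ≠ 0 := by exact_mod_cast hq₀.ne'
  have hQ0 : (q : ℂ) ^ ((N : ℤ) - 1) ≠ 0 := zpow_ne_zero _ hq
  simp only [racahPoly, newtonPoly_racahNode_eval hq₀ H.hc δ N _ hv,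
    newtonPoly_racahNode_eval hq₀ H.hc δ N _ (mul_ne_zero hq hv),
    newtonPoly_racahNode_eval hq₀ H.hc δ N _ (div_ne_zero hv hq)]
  have hstep := fun m => racahPolyCoef_step hq₀ hq₁ H δ N (l := l) (m := m)
  set Q : ℂ := (q : ℂ) ^ ((N : ℤ) - 1)
  have hop := racah_operator_factor (d := d) (A := q / a) (B := q / b) hq hv hQ0 H.hc h1 h2 h3
  set C := racahPolyCoef q a b c d δ N l
  set F : ℕ → ℂ → ℂ := fun m v => upFactor q c Q m v * downFactor q c δ m v with hF
  set E := racahEig (q : ℂ) (c * d * (q / a) * (q / b) / (q * Q ^ 2))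
  set L := racahLower (q : ℂ) Q c d (q / a) (q / b) δ
  have hL0 : L 0 = 0 := by simp [L, racahLower]
  have h4 : ∀ m, C m * (E m * F m v + L m * F (m - 1) v) =
      racahUp q Q c d (q / a) (q / b) δ v * (C m * F m (q * v) - C m * F m v) +
      racahDown q Q c d (q / a) (q / b) δ v * (C m * F m (v / q) - C m * F m v) := by
    intro m
    rw [← hop m]
    simp only [hF]
    ring
  calc _ = ∑ m ∈ Finset.range (l + 1), C m * (E m * F m v + L m * F (m - 1) v) := by
        simp only [h4]
        rw [Finset.sum_add_distrib, ← Finset.mul_sum, ← Finset.mul_sum, Finset.sum_sub_distrib,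
          Finset.sum_sub_distrib]
    _ = ∑ m ∈ Finset.range (l + 1), C m * E m * F m v +
        ∑ m ∈ Finset.range (l + 1), C m * L m * F (m - 1) v := by
        rw [← Finset.sum_add_distrib]
        exact Finset.sum_congr rfl fun m _ => by ring
    _ = ∑ m ∈ Finset.range (l + 1), C m * E m * F m v +
        ∑ m ∈ Finset.range l, (E l - E m) * C m * F m v := by
        congr 1
        -- The lowering terms are reindexed by $m\mapsto m+1$, after which the coefficient relation
        -- turns them into multiples of degree $m$ terms.
        rw [Finset.sum_range_succ', hL0, mul_zero, zero_mul, add_zero]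
        refine Finset.sum_congr rfl fun m hm => ?_
        rw [hstep m (Finset.mem_range.1 hm), Nat.add_sub_cancel]
        ring
    _ = ∑ m ∈ Finset.range (l + 1), C m * E m * F m v +
        ∑ m ∈ Finset.range (l + 1), (E l - E m) * C m * F m v := by
        rw [Finset.sum_range_succ (fun m => (E l - E m) * C m * F m v), sub_self, zero_mul,
          zero_mul, add_zero]
    _ = _ := by
        rw [← Finset.sum_add_distrib, Finset.mul_sum]
        exact Finset.sum_congr rfl fun m _ => by simp only [hF]; ring

end Eigen


/-! ### Orthogonality of the `q`-Racah polynomials on the grid -/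

/-- Discrete Green's formula. Detailed balance makes the partial sums of $(E-F)w f g$ telescope to
the boundary term $w_k\,\mathrm{up}_k\,(f_{k+1}g_k-f_kg_{k+1})$, which is zero at the last point. At
$t=0$ the truncated index $t-1$ is multiplied by `down 0 = 0`. -/
theorem sturm_liouville_orthogonal {n : ℕ} {w up down : ℕ → ℝ} (h0 : down 0 = 0)
    (hn : ∀ t, t + 1 = n → up t = 0)
    (hw : ∀ t, t + 1 < n → w t * up t = w (t + 1) * down (t + 1)) {f g : ℕ → ℂ} {E F : ℝ}
    (hEF : E ≠ F)
    (hf : ∀ t < n, up t * (f (t + 1) - f t) + down t * (f (t - 1) - f t) = E * f t)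
    (hg : ∀ t < n, up t * (g (t + 1) - g t) + down t * (g (t - 1) - g t) = F * g t) :
    ∑ t ∈ Finset.range n, (w t : ℂ) * (f t * g t) = 0 := by
  have key : ∀ k, k + 1 ≤ n → ∑ t ∈ Finset.range (k + 1), (w t : ℂ) * ((E - F) * (f t * g t)) =
      w k * up k * (f (k + 1) * g k - f k * g (k + 1)) := by
    intro k hk
    induction k with
    | zero =>
      have e1 := hf 0 (by omega)
      have e2 := hg 0 (by omega)
      rw [h0, Complex.ofReal_zero, zero_mul, add_zero, zero_add] at e1 e2
      rw [zero_add, Finset.sum_range_one]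
      linear_combination (-(w 0 : ℂ) * g 0) * e1 + (w 0 : ℂ) * f 0 * e2
    | succ k ih =>
      rw [Finset.sum_range_succ, ih (by omega)]
      have e1 := hf (k + 1) (by omega)
      have e2 := hg (k + 1) (by omega)
      have e3 : (w k : ℂ) * up k = w (k + 1) * down (k + 1) := by exact_mod_cast hw k (by omega)
      rw [Nat.add_sub_cancel] at e1 e2
      rw [e3]
      linear_combination (-(w (k + 1) : ℂ) * g (k + 1)) * e1 + (w (k + 1) : ℂ) * f (k + 1) * e2
  cases n with
  | zero => simp
  | succ n =>
    have h := key n le_rfl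
    rw [hn n rfl, Complex.ofReal_zero, mul_zero, zero_mul] at h
    have h1 : ((E : ℂ) - F) * ∑ t ∈ Finset.range (n + 1), (w t : ℂ) * (f t * g t) = 0 := by
      rw [← h, Finset.mul_sum]
      exact Finset.sum_congr rfl fun t _ => by ring
    refine (mul_eq_zero.1 h1).resolve_left ?_
    exact sub_ne_zero.2 (by exact_mod_cast hEF)

/-- The points of the grid on which the `q`-Racah polynomials are orthogonal. -/
noncomputable def racahPoint (q a b : ℝ) (n t : ℕ) : ℝ :=
  q ^ (t + 1) / a + q ^ ((n : ℤ) - t) / b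

/-- The parameter `ε²`. -/
noncomputable def deltaPar (q a b : ℝ) (M : ℕ) : ℝ := q ^ (2 * M + 2) / -(a * b)

/-- The expression equals $q^{-m}+pq^m-1-p$, and both varying terms increase with $m$ because $p<0$.
-/
theorem racahEig_strictMono {q p : ℝ} (hq₀ : 0 < q) (hq₁ : q < 1) (hp : p < 0) :
    StrictMono fun m : ℕ => ((q ^ m)⁻¹ - 1) * (1 - p * q ^ m) := by
  refine strictMono_nat_of_lt_succ fun m => ?_
  have h : 0 < q ^ m := pow_pos hq₀ m
  have h1 : ((q ^ m)⁻¹ - 1) * (1 - p * q ^ m) = (q ^ m)⁻¹ + p * q ^ m - 1 - p := by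
    field_simp; ring
  have h2 : ((q ^ (m + 1))⁻¹ - 1) * (1 - p * q ^ (m + 1)) =
      (q ^ (m + 1))⁻¹ + p * q ^ (m + 1) - 1 - p := by
    have : 0 < q ^ (m + 1) := pow_pos hq₀ _
    field_simp; ring
  have h3 : (q ^ m)⁻¹ < (q ^ (m + 1))⁻¹ :=
    inv_strictAnti₀ (pow_pos hq₀ _) (pow_lt_pow_right_of_lt_one₀ hq₀ hq₁ (Nat.lt_succ_self m))
  have h4 : q ^ (m + 1) < q ^ m := pow_lt_pow_right_of_lt_one₀ hq₀ hq₁ (Nat.lt_succ_self m)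
  simp only [h1, h2]
  nlinarith

/-- With $v_t=q^{t+1}/a$, $n=N+2M$ and $D=\delta q^{N-1}=-q^{n+1}/(ab)$, the grid points are
$v_t-D/v_t$. The downward coefficient vanishes at $v_0=q/a$ and the upward one at $t=n-1$, where
$D+(q/b)v_t=0$. In between both are negative by the sign conditions, so ratios of them define a
positive weight. -/
theorem exists_racah_weight {q a b : ℝ} {c d : ℂ} (hq₀ : 0 < q) (hq₁ : q < 1)
    (H : RacahPositive q a b c d) (M N : ℕ) :
    ∃ w : ℕ → ℝ, (∀ t < N + 2 * M, 0 < w t) ∧ ∀ l m : ℕ, l ≠ m →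
      ∑ t ∈ Finset.range (N + 2 * M), (w t : ℂ) *
        (racahPoly q a b c d (deltaPar q a b M) N l (racahPoint q a b (N + 2 * M) t) *
          (starRingEnd ℂ) (racahPoly q a b c d (deltaPar q a b M) N m
            (racahPoint q a b (N + 2 * M) t))) = 0 := by
  obtain ⟨p, hp, hpc⟩ := H.hp
  choose pa hpa hpa' using H.ha'
  choose pb hpb hpb' using H.hb'
  have ha := H.ha
  have hb := H.hb
  have hab : 0 < -(a * b) := by have := mul_neg_of_pos_of_neg ha hb; linarith
  have hq : (q : ℂ) ≠ 0 := by exact_mod_cast hq₀.ne'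
  set n := N + 2 * M with hnd
  set δ := deltaPar q a b M with hδ
  have hδ0 : 0 < δ := div_pos (pow_pos hq₀ _) hab
  set Q : ℝ := q ^ ((N : ℤ) - 1) with hQd
  have hQ : 0 < Q := zpow_pos hq₀ _
  set D : ℝ := δ * Q with hD
  have hD0 : 0 < D := mul_pos hδ0 hQ
  set v : ℕ → ℝ := fun t => q ^ (t + 1) / a with hv
  have hv0 : ∀ t, 0 < v t := fun t => div_pos (pow_pos hq₀ _) ha
  have hDn : D = q ^ (n + 1) / -(a * b) := by
    have : q ^ (n + 1) = q ^ (2 * M + 2) * Q := by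
      rw [hQd, ← zpow_natCast, ← zpow_natCast, ← zpow_add₀ hq₀.ne']
      congr 1
      rw [hnd]; push_cast; ring
    rw [hD, hδ, deltaPar, this]; ring
  set up : ℕ → ℝ := fun t => pa ((t : ℤ) + 2 - N) * ((D + q / a * v t) * (D + q / b * v t) /
    ((D + v t ^ 2) * (D + q * v t ^ 2))) with hup
  set down : ℕ → ℝ := fun t => v t ^ 2 * pb (2 * M + 1 - t) * ((v t - q / a) * (v t - q / b) /
    ((D + v t ^ 2) * (v t ^ 2 + q * D))) with hdown
  have hden : ∀ t, 0 < (D + v t ^ 2) * (D + q * v t ^ 2) := fun t => by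
    have := hv0 t
    positivity
  have hden' : ∀ t, 0 < (D + v t ^ 2) * (v t ^ 2 + q * D) := fun t => by
    have := hv0 t
    positivity
  have hB : ∀ t, D + q / b * v t = (q ^ (n + 1) - q ^ (t + 2)) / -(a * b) := by
    intro t
    rw [hDn, hv]
    field_simp
    ring
  have hA : ∀ t, v t - q / a = -(q * (1 - q ^ t) / a) := by
    intro t
    rw [hv]
    field_simp
    ring
  have hup_neg : ∀ t, t + 1 < n → up t < 0 := by
    intro t ht
    refine mul_neg_of_pos_of_neg (hpa _) (div_neg_of_neg_of_pos ?_ (hden t))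
    refine mul_neg_of_pos_of_neg ?_ ?_
    · have := hv0 t
      positivity
    · rw [hB]
      refine div_neg_of_neg_of_pos ?_ hab
      rw [sub_neg]
      exact pow_lt_pow_right_of_lt_one₀ hq₀ hq₁ (by omega)
  have hup_zero : ∀ t, t + 1 = n → up t = 0 := by
    intro t ht
    simp only [hup]
    rw [hB, ← ht, sub_self]
    simp
  have hvB : ∀ t, 0 < v t - q / b := fun t => by
    have := div_neg_of_pos_of_neg hq₀ hb
    linarith [hv0 t]
  have hdown_zero : down 0 = 0 := by
    simp only [hdown]
    rw [hA, pow_zero]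
    simp
  have hdown_neg : ∀ t, down (t + 1) < 0 := by
    intro t
    refine mul_neg_of_pos_of_neg (mul_pos (pow_pos (hv0 _) 2) (hpb _))
      (div_neg_of_neg_of_pos (mul_neg_of_neg_of_pos ?_ (hvB _)) (hden' _))
    rw [hA, neg_lt_zero]
    refine div_pos (mul_pos hq₀ ?_) ha
    rw [sub_pos]
    exact pow_lt_one₀ hq₀.le hq₁ (Nat.succ_ne_zero t)
  -- The unique solution of detailed balance normalized by $w_0=1$.
  set w : ℕ → ℝ := fun t => ∏ s ∈ Finset.range t, up s / down (s + 1) with hw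
  have hw0 : ∀ t < n, 0 < w t := fun t ht => Finset.prod_pos fun s hs =>
    div_pos_of_neg_of_neg (hup_neg s (by have := Finset.mem_range.1 hs; omega)) (hdown_neg s)
  have hwstep : ∀ t, w t * up t = w (t + 1) * down (t + 1) := by
    intro t
    simp only [hw]
    rw [Finset.prod_range_succ, mul_assoc, div_mul_cancel₀ _ (hdown_neg t).ne]
  set eig : ℕ → ℝ := fun m => ((q ^ m)⁻¹ - 1) * (1 - p / (q * Q ^ 2) * q ^ m) with heig
  have hxv : ∀ t ≤ n, ((v t : ℂ) - (δ : ℂ) * (q : ℂ) ^ ((N : ℤ) - 1) / v t) =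
      (racahPoint q a b n t : ℂ) := by
    intro t ht
    have h1 : q ^ (n + 1) = q ^ ((n : ℤ) - t) * q ^ (t + 1) := by
      rw [← zpow_natCast, ← zpow_natCast, ← zpow_add₀ hq₀.ne']
      congr 1
      push_cast; ring
    have h2 : v t - D / v t = racahPoint q a b n t := by
      rw [hDn, racahPoint, h1, hv]
      have := pow_pos hq₀ (t + 1)
      field_simp
      ring
    rw [← h2, hD, hQd]
    push_cast
    ring
  have hvm : ∀ t, (v (t + 1) : ℂ) = q * v t := by
    intro t
    simp only [hv]
    push_cast
    ring
  have hQc : (Q : ℂ) = (q : ℂ) ^ ((N : ℤ) - 1) := by rw [hQd]; push_cast; rfl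
  have hac : (a : ℂ) ≠ 0 := by exact_mod_cast ha.ne'
  have hbc : (b : ℂ) ≠ 0 := by exact_mod_cast hb.ne
  have hQc0 : (Q : ℂ) ≠ 0 := by exact_mod_cast hQ.ne'
  have hDc : (D : ℂ) = (δ : ℂ) * Q := by rw [hD]; push_cast; rfl
  have hupc : ∀ t, (up t : ℂ) =
      racahUp q (q ^ ((N : ℤ) - 1)) c d (q / a) (q / b) δ (v t) := by
    intro t
    have h1 : (v t : ℂ) / Q = (q : ℂ) ^ ((t : ℤ) + 2 - N) / a := by
      have h2 : (q : ℂ) ^ ((t : ℤ) + 2 - N) * Q = (q : ℂ) ^ (t + 1) := by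
        rw [hQc, ← zpow_add₀ hq, ← zpow_natCast]
        congr 1
        push_cast; ring
      simp only [hv]
      push_cast
      rw [← h2]
      field_simp
    rw [racahUp, ← hQc, mul_div_assoc c, mul_div_assoc d, h1, ← hDc]
    simp only [hup]
    push_cast
    rw [hpa']
    ring
  have hdownc : ∀ t, (down t : ℂ) =
      racahDown q (q ^ ((N : ℤ) - 1)) c d (q / a) (q / b) δ (v t) := by
    intro t
    have hvc : (v t : ℂ) ≠ 0 := by exact_mod_cast (hv0 t).ne'
    -- This form of $\delta$ gives $v_t+\delta c=v_t(1-\tfrac cb q^{2M+1-t})$, and the same with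
    -- $d$, so the second sign condition applies.
    have h1 : (δ : ℂ) = -((v t : ℂ) * ((q : ℂ) ^ (2 * (M : ℤ) + 1 - t) / b)) := by
      have h2 : (q : ℂ) ^ (t + 1) * (q : ℂ) ^ (2 * (M : ℤ) + 1 - t) = (q : ℂ) ^ (2 * M + 2) := by
        rw [← zpow_natCast, ← zpow_natCast, ← zpow_add₀ hq]
        congr 1
        push_cast; ring
      simp only [hv, hδ, deltaPar]
      push_cast
      rw [← h2]
      field_simp
    rw [racahDown, ← hQc, ← hDc]
    simp only [hdown]
    push_cast
    rw [hpb', h1]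
    ring
  have heigc : ∀ m, (eig m : ℂ) =
      racahEig q (c * d * (q / a) * (q / b) / (q * ((q : ℂ) ^ ((N : ℤ) - 1)) ^ 2)) m := by
    intro m
    rw [racahEig, ← hQc]
    simp only [heig]
    push_cast
    rw [hpc]
    congr 3
    field_simp
  have hinj : Function.Injective eig :=
    (racahEig_strictMono hq₀ hq₁ (div_neg_of_neg_of_pos hp (by positivity))).injective
  set F : ℕ → ℕ → ℂ := fun l t => racahPoly q a b c d δ N l (racahPoint q a b n t) with hF
  have hop : ∀ l, ∀ t < n,
      up t * (F l (t + 1) - F l t) + down t * (F l (t - 1) - F l t) = eig l * F l t := by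
    intro l t ht
    have hDp : (0 : ℝ) < D := hD0
    have n1 : (δ : ℂ) * (q : ℂ) ^ ((N : ℤ) - 1) + (v t : ℂ) ^ 2 ≠ 0 := by
      rw [← hQc, ← hDc]
      exact_mod_cast (by positivity : 0 < D + v t ^ 2).ne'
    have n2 : (δ : ℂ) * (q : ℂ) ^ ((N : ℤ) - 1) + q * (v t : ℂ) ^ 2 ≠ 0 := by
      rw [← hQc, ← hDc]
      exact_mod_cast (by have := hv0 t; positivity : 0 < D + q * v t ^ 2).ne'
    have n3 : (v t : ℂ) ^ 2 + q * ((δ : ℂ) * (q : ℂ) ^ ((N : ℤ) - 1)) ≠ 0 := by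
      rw [← hQc, ← hDc]
      exact_mod_cast (by positivity : 0 < v t ^ 2 + q * D).ne'
    have hvc : (v t : ℂ) ≠ 0 := by exact_mod_cast (hv0 t).ne'
    have h := racahPoly_operator hq₀ hq₁ H δ N l hvc n1 n2 n3
    rw [← hupc, ← hdownc, ← heigc, ← hvm, hxv t ht.le, hxv (t + 1) ht] at h
    rw [← h]
    congr 1
    cases t with
    | zero => rw [hdown_zero, Complex.ofReal_zero, zero_mul, zero_mul]
    | succ t =>
      have h2 : (v (t + 1) : ℂ) / q = v t := by rw [hvm]; field_simp
      rw [h2, hxv t (by omega)]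
      rfl
  refine ⟨w, hw0, fun l m hlm => sturm_liouville_orthogonal hdown_zero hup_zero
    (fun t _ => hwstep t) (hinj.ne hlm) (hop l) fun t ht => ?_⟩
  -- The parameters $c,d$ may be nonreal, and so may the values of the polynomials. The operator and
  -- its eigenvalues are real, so conjugate values satisfy the same equation.
  have h := congrArg (starRingEnd ℂ) (hop m t ht)
  simpa using h


/-! ### Norms of monic orthogonal polynomials on a finite grid -/

theorem newtonPoly_monic (node : ℕ → ℂ) (m : ℕ) : (newtonPoly node m).Monic :=
  Polynomial.monic_prod_of_monic _ _ fun _ _ => Polynomial.monic_X_sub_C _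

theorem degree_newtonPoly (node : ℕ → ℂ) (m : ℕ) : (newtonPoly node m).degree = m := by
  rw [newtonPoly, Polynomial.degree_prod]
  simp

theorem X_mul_newtonPoly (node : ℕ → ℂ) (m : ℕ) : Polynomial.X * newtonPoly node m =
    newtonPoly node (m + 1) + Polynomial.C (node m) * newtonPoly node m := by
  rw [newtonPoly, newtonPoly, Finset.prod_range_succ]
  ring

/-- The polynomial with coefficients `κ l` in the Newton basis. -/
noncomputable def newtonComb (node : ℕ → ℂ) (κ : ℕ → ℕ → ℂ) (l : ℕ) : Polynomial ℂ :=
  ∑ m ∈ Finset.range (l + 1), Polynomial.C (κ l m) * newtonPoly node m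

theorem sum_newtonPoly_mem_degreeLT (node κ : ℕ → ℂ) (l : ℕ) :
    ∑ m ∈ Finset.range l, Polynomial.C (κ m) * newtonPoly node m ∈ Polynomial.degreeLT ℂ l := by
  refine Submodule.sum_mem _ fun m hm => ?_
  rw [Polynomial.C_mul']
  refine Submodule.smul_mem _ _ (Polynomial.mem_degreeLT.2 ?_)
  rw [degree_newtonPoly]
  exact_mod_cast Finset.mem_range.1 hm

theorem newtonComb_eq (node : ℕ → ℂ) {κ : ℕ → ℕ → ℂ} {l : ℕ} (h : κ l l = 1) :
    newtonComb node κ l =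
      ∑ m ∈ Finset.range l, Polynomial.C (κ l m) * newtonPoly node m + newtonPoly node l := by
  rw [newtonComb, Finset.sum_range_succ, h, Polynomial.C_1, one_mul]

theorem degree_sum_newtonPoly_lt (node κ : ℕ → ℂ) (l : ℕ) :
    (∑ m ∈ Finset.range l, Polynomial.C (κ m) * newtonPoly node m).degree <
      (newtonPoly node l).degree := by
  rw [degree_newtonPoly]
  exact Polynomial.mem_degreeLT.1 (sum_newtonPoly_mem_degreeLT node κ l)

theorem newtonComb_monic (node : ℕ → ℂ) {κ : ℕ → ℕ → ℂ} {l : ℕ} (h : κ l l = 1) :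
    (newtonComb node κ l).Monic := by
  rw [newtonComb_eq node h]
  exact (newtonPoly_monic node l).add_of_right (degree_sum_newtonPoly_lt node _ l)

theorem degree_newtonComb (node : ℕ → ℂ) {κ : ℕ → ℕ → ℂ} {l : ℕ} (h : κ l l = 1) :
    (newtonComb node κ l).degree = l := by
  rw [newtonComb_eq node h, Polynomial.degree_add_eq_right_of_degree_lt
    (degree_sum_newtonPoly_lt node _ l), degree_newtonPoly]

/-- The inner product of polynomials on a weighted grid. -/
noncomputable def gridInner (w x : ℕ → ℝ) (n : ℕ) (f g : Polynomial ℂ) : ℂ :=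
  ∑ t ∈ Finset.range n, (w t : ℂ) * (f.eval (x t : ℂ) * (starRingEnd ℂ) (g.eval (x t : ℂ)))

/-- The squared norm of a polynomial on a weighted grid. -/
noncomputable def gridNorm (w x : ℕ → ℝ) (n : ℕ) (f : Polynomial ℂ) : ℝ :=
  ∑ t ∈ Finset.range n, w t * Complex.normSq (f.eval (x t : ℂ))

section Grid

variable (w x : ℕ → ℝ) (n : ℕ)

theorem gridInner_self (f : Polynomial ℂ) : gridInner w x n f f = gridNorm w x n f := by
  rw [gridInner, gridNorm, Complex.ofReal_sum]
  exact Finset.sum_congr rfl fun t _ => by rw [Complex.mul_conj, Complex.ofReal_mul]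

theorem gridInner_conj (f g : Polynomial ℂ) :
    (starRingEnd ℂ) (gridInner w x n f g) = gridInner w x n g f := by
  rw [gridInner, map_sum, gridInner]
  refine Finset.sum_congr rfl fun t _ => ?_
  simp only [map_mul, Complex.conj_ofReal, Complex.conj_conj]
  ring

theorem gridInner_add_left (f f' g : Polynomial ℂ) :
    gridInner w x n (f + f') g = gridInner w x n f g + gridInner w x n f' g := by
  simp only [gridInner, Polynomial.eval_add, ← Finset.sum_add_distrib]
  exact Finset.sum_congr rfl fun t _ => by ring

theorem gridInner_C_mul_left (k : ℂ) (f g : Polynomial ℂ) :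
    gridInner w x n (Polynomial.C k * f) g = k * gridInner w x n f g := by
  simp only [gridInner, Polynomial.eval_mul, Polynomial.eval_C, Finset.mul_sum]
  exact Finset.sum_congr rfl fun t _ => by ring

theorem gridInner_X_mul (f g : Polynomial ℂ) :
    gridInner w x n (Polynomial.X * f) g = gridInner w x n f (Polynomial.X * g) := by
  simp only [gridInner, Polynomial.eval_mul, Polynomial.eval_X, map_mul, Complex.conj_ofReal]
  exact Finset.sum_congr rfl fun t _ => by ring

variable {w x n}

/-- A nonzero polynomial of degree below $n$ cannot vanish at $n$ distinct points. -/
theorem gridNorm_pos (hw : ∀ t < n, 0 < w t) (hx : Set.InjOn x (Set.Iio n)) {f : Polynomial ℂ}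
    (hf : f ≠ 0) (hdeg : f.natDegree < n) : 0 < gridNorm w x n f := by
  have h0 : ∀ t ∈ Finset.range n, 0 ≤ w t * Complex.normSq (f.eval (x t : ℂ)) := fun t ht =>
    mul_nonneg (hw t (Finset.mem_range.1 ht)).le (Complex.normSq_nonneg _)
  refine lt_of_le_of_ne (Finset.sum_nonneg h0) fun h => hf ?_
  have h1 := (Finset.sum_eq_zero_iff_of_nonneg h0).1 h.symm
  have hinj : Set.InjOn (fun t : ℕ => (x t : ℂ)) (Finset.range n : Set ℕ) := by
    intro s hs t ht hst
    exact hx (by simpa using hs) (by simpa using ht) (Complex.ofReal_injective hst)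
  refine Polynomial.eq_zero_of_natDegree_lt_card_of_eval_eq_zero' f
    ((Finset.range n).image fun t : ℕ => (x t : ℂ)) ?_ ?_
  · intro z hz
    obtain ⟨t, ht, rfl⟩ := Finset.mem_image.1 hz
    have := (mul_eq_zero.1 (h1 t ht)).resolve_left (hw t (Finset.mem_range.1 ht)).ne'
    exact Complex.normSq_eq_zero.1 this
  · rwa [Finset.card_image_of_injOn hinj, Finset.card_range]

variable {P : ℕ → Polynomial ℂ} (hmon : ∀ l, (P l).Monic) (hdeg : ∀ l, (P l).degree = l)
  (horth : ∀ l m, l ≠ m → gridInner w x n (P l) (P m) = 0)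

include hmon hdeg horth

theorem gridInner_eq_zero_of_mem_degreeLT {k l : ℕ} (hkl : k ≤ l) {f : Polynomial ℂ}
    (hf : f ∈ Polynomial.degreeLT ℂ k) : gridInner w x n f (P l) = 0 := by
  induction k generalizing f with
  | zero =>
    have h0 : f = 0 := by
      have := Polynomial.mem_degreeLT.1 hf
      rw [Nat.cast_zero] at this
      by_contra h
      exact absurd (Polynomial.zero_le_degree_iff.2 h) (not_le.2 this)
    simp [h0, gridInner]
  | succ k ih =>
    have h1 : f - Polynomial.C (f.coeff k) * P k ∈ Polynomial.degreeLT ℂ k := by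
      rw [Polynomial.mem_degreeLT, Polynomial.degree_lt_iff_coeff_zero]
      intro m hm
      have hPc : (P k).coeff k = 1 := by
        have h2 := (hmon k).coeff_natDegree
        rwa [Polynomial.natDegree_eq_of_degree_eq_some (hdeg k)] at h2
      rw [Polynomial.coeff_sub, Polynomial.coeff_C_mul]
      rcases hm.eq_or_lt with rfl | h
      · rw [hPc, mul_one, sub_self]
      · rw [Polynomial.coeff_eq_zero_of_degree_lt, Polynomial.coeff_eq_zero_of_degree_lt (p := P k)]
        · simp
        · rw [hdeg]; exact_mod_cast h
        · refine (Polynomial.mem_degreeLT.1 hf).trans_le ?_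
          exact_mod_cast h
    have h2 := ih (by omega) h1
    have h3 : f = (f - Polynomial.C (f.coeff k) * P k) + Polynomial.C (f.coeff k) * P k := by ring
    rw [h3, gridInner_add_left, h2, gridInner_C_mul_left, horth k l (by omega), mul_zero, add_zero]

/-- The inner product $\langle XP_{l+1},P_l\rangle$ is computed in two ways: the recurrence gives
$a\|P_l\|^2$, while moving the real variable $X$ to the other side gives $\langle
P_{l+1},XP_l\rangle=\|P_{l+1}\|^2$. -/
theorem gridNorm_recursion {l : ℕ} {b a : ℂ}
    (h : Polynomial.X * P (l + 1) - P (l + 2) - Polynomial.C b * P (l + 1) -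
      Polynomial.C a * P l ∈ Polynomial.degreeLT ℂ l) :
    (gridNorm w x n (P (l + 1)) : ℂ) = a * gridNorm w x n (P l) := by
  set r := Polynomial.X * P (l + 1) - P (l + 2) - Polynomial.C b * P (l + 1) -
      Polynomial.C a * P l with hr
  have h1 : Polynomial.X * P (l + 1) = P (l + 2) + Polynomial.C b * P (l + 1) +
      Polynomial.C a * P l + r := by rw [hr]; ring
  have h2 : gridInner w x n (Polynomial.X * P (l + 1)) (P l) = a * gridNorm w x n (P l) := by
    rw [h1, gridInner_add_left, gridInner_add_left, gridInner_add_left, gridInner_C_mul_left,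
      gridInner_C_mul_left, horth _ _ (by omega), horth _ _ (by omega), gridInner_self,
      gridInner_eq_zero_of_mem_degreeLT hmon hdeg horth le_rfl h]
    ring
  have h3 : Polynomial.X * P l - P (l + 1) ∈ Polynomial.degreeLT ℂ (l + 1) := by
    rw [Polynomial.mem_degreeLT]
    have h4 : (Polynomial.X * P l).degree = ((l + 1 : ℕ) : WithBot ℕ) := by
      rw [Polynomial.degree_mul, hdeg, Polynomial.degree_X]
      norm_cast
      omega
    have h6 : (Polynomial.X * P l).Monic := Polynomial.monic_X.mul (hmon l)
    rw [← h4]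
    exact Polynomial.degree_sub_lt_left (by rw [h4, hdeg]) h6.ne_zero
      (by rw [h6.leadingCoeff, (hmon _).leadingCoeff])
  have h4 : Polynomial.X * P l = P (l + 1) + (Polynomial.X * P l - P (l + 1)) := by ring
  have h5 := gridInner_eq_zero_of_mem_degreeLT hmon hdeg horth le_rfl h3
  rw [← h2, ← gridInner_self, ← gridInner_conj w x n (P (l + 1)),
    gridInner_X_mul, ← gridInner_conj w x n (Polynomial.X * P l)]
  congr 1
  rw [h4, gridInner_add_left, h5, add_zero]

end Grid

/-- The two constants are those that cancel the components of degrees $l+2$ and $l+1$ in the Newton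
basis. They use only the node values and the coefficients next to the leading one, so the norm
ratios are explicit without computing any weighted sum. -/
theorem newtonComb_recursion_mem (node : ℕ → ℂ) {κ : ℕ → ℕ → ℂ} (hκ : ∀ l, κ l l = 1) (l : ℕ) :
    Polynomial.X * newtonComb node κ (l + 2) - newtonComb node κ (l + 3) -
      Polynomial.C (node (l + 2) + κ (l + 2) (l + 1) - κ (l + 3) (l + 2)) *
        newtonComb node κ (l + 2) -
      Polynomial.C (κ (l + 2) l - κ (l + 3) (l + 1) + κ (l + 2) (l + 1) *
        (node (l + 1) - (node (l + 2) + κ (l + 2) (l + 1) - κ (l + 3) (l + 2)))) *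
          newtonComb node κ (l + 1) ∈ Polynomial.degreeLT ℂ (l + 1) := by
  have hX : Polynomial.X * ∑ m ∈ Finset.range l, Polynomial.C (κ (l + 2) m) * newtonPoly node m ∈
      Polynomial.degreeLT ℂ (l + 1) := by
    rw [Finset.mul_sum]
    refine Submodule.sum_mem _ fun m hm => ?_
    rw [mul_left_comm, Polynomial.C_mul']
    refine Submodule.smul_mem _ _ (Polynomial.mem_degreeLT.2 ?_)
    rw [Polynomial.degree_mul, degree_newtonPoly, Polynomial.degree_X]
    have := Finset.mem_range.1 hm
    norm_cast
    omega
  have h1 := sum_newtonPoly_mem_degreeLT node (κ (l + 1)) (l + 1)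
  have h2 := sum_newtonPoly_mem_degreeLT node (κ (l + 2)) (l + 1)
  have h3 := sum_newtonPoly_mem_degreeLT node (κ (l + 3)) (l + 1)
  have h4 : newtonPoly node l ∈ Polynomial.degreeLT ℂ (l + 1) := by
    rw [Polynomial.mem_degreeLT, degree_newtonPoly]
    exact_mod_cast Nat.lt_succ_self l
  have e1 : newtonComb node κ (l + 1) = ∑ m ∈ Finset.range (l + 1),
      Polynomial.C (κ (l + 1) m) * newtonPoly node m + newtonPoly node (l + 1) :=
    newtonComb_eq node (hκ _)
  have e2 : newtonComb node κ (l + 2) = ∑ m ∈ Finset.range (l + 1),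
      Polynomial.C (κ (l + 2) m) * newtonPoly node m +
      Polynomial.C (κ (l + 2) (l + 1)) * newtonPoly node (l + 1) + newtonPoly node (l + 2) := by
    rw [newtonComb_eq node (hκ _), Finset.sum_range_succ]
  have e3 : newtonComb node κ (l + 3) = ∑ m ∈ Finset.range (l + 1),
      Polynomial.C (κ (l + 3) m) * newtonPoly node m +
      Polynomial.C (κ (l + 3) (l + 1)) * newtonPoly node (l + 1) +
      Polynomial.C (κ (l + 3) (l + 2)) * newtonPoly node (l + 2) + newtonPoly node (l + 3) := by
    rw [newtonComb_eq node (hκ _), Finset.sum_range_succ, Finset.sum_range_succ]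
  have e4 : Polynomial.X * newtonComb node κ (l + 2) =
      Polynomial.X * ∑ m ∈ Finset.range l, Polynomial.C (κ (l + 2) m) * newtonPoly node m +
      Polynomial.C (κ (l + 2) l) * (newtonPoly node (l + 1) + Polynomial.C (node l) *
        newtonPoly node l) + Polynomial.C (κ (l + 2) (l + 1)) * (newtonPoly node (l + 2) +
        Polynomial.C (node (l + 1)) * newtonPoly node (l + 1)) +
      (newtonPoly node (l + 3) + Polynomial.C (node (l + 2)) * newtonPoly node (l + 2)) := by
    rw [e2, Finset.sum_range_succ, ← X_mul_newtonPoly, ← X_mul_newtonPoly, ← X_mul_newtonPoly]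
    ring
  set b := node (l + 2) + κ (l + 2) (l + 1) - κ (l + 3) (l + 2) with hb
  set a := κ (l + 2) l - κ (l + 3) (l + 1) + κ (l + 2) (l + 1) * (node (l + 1) - b) with ha
  have hkey : Polynomial.X * newtonComb node κ (l + 2) - newtonComb node κ (l + 3) -
      Polynomial.C b * newtonComb node κ (l + 2) - Polynomial.C a * newtonComb node κ (l + 1) =
      Polynomial.X * ∑ m ∈ Finset.range l, Polynomial.C (κ (l + 2) m) * newtonPoly node m +
      (κ (l + 2) l * node l) • newtonPoly node l - ∑ m ∈ Finset.range (l + 1),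
      Polynomial.C (κ (l + 3) m) * newtonPoly node m - b • (∑ m ∈ Finset.range (l + 1),
      Polynomial.C (κ (l + 2) m) * newtonPoly node m) - a • ∑ m ∈ Finset.range (l + 1),
      Polynomial.C (κ (l + 1) m) * newtonPoly node m := by
    rw [e4, e3, e2, e1, ha, hb]
    simp only [← Polynomial.C_mul', map_sub, map_add, map_mul]
    ring
  rw [hkey]
  exact sub_mem (sub_mem (sub_mem (add_mem hX (Submodule.smul_mem _ _ h4)) h3)
    (Submodule.smul_mem _ _ h2)) (Submodule.smul_mem _ _ h1)


/-! ### Norms of the `q`-Racah polynomials -/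

/-- The monic `q`-Racah polynomials as elements of `ℂ[x]`. -/
noncomputable def racahMonic (q a b : ℝ) (c d δ : ℂ) (N l : ℕ) : Polynomial ℂ :=
  newtonComb (racahNode q c δ N) (racahPolyCoef q a b c d δ N) l

theorem eval_racahMonic (q a b : ℝ) (c d δ : ℂ) (N l : ℕ) (x : ℂ) :
    (racahMonic q a b c d δ N l).eval x = racahPoly q a b c d δ N l x := by
  simp [racahMonic, newtonComb, racahPoly, Polynomial.eval_finsetSum]

/-- The ratio of the squared norms of degrees `l + 2` and `l + 1`. -/
noncomputable def racahRatio (q a b : ℝ) (c d δ : ℂ) (N l : ℕ) : ℂ :=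
  racahPolyCoef q a b c d δ N (l + 2) l - racahPolyCoef q a b c d δ N (l + 3) (l + 1) +
    racahPolyCoef q a b c d δ N (l + 2) (l + 1) * (racahNode q c δ N (l + 1) -
      (racahNode q c δ N (l + 2) + racahPolyCoef q a b c d δ N (l + 2) (l + 1) -
        racahPolyCoef q a b c d δ N (l + 3) (l + 2)))

/-- The limit of `racahPolyCoef q a b c d δ N (N + r) (N + r')`. -/
noncomputable def limitCoef (q a b : ℝ) (c d δ : ℂ) (r r' : ℤ) : ℂ :=
  c ^ (r' - r) * racahEntry q (-δ * c * d) (c / a * q) (c / b * q) (q ^ 2 * (c * d / (a * b)))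
    (r + 1) (r' + 1)

/-- The limit of the ratios of the squared norms of degrees `N + r` and `N + r - 1`. -/
noncomputable def limitRatio (q a b : ℝ) (c d δ : ℂ) (r : ℤ) : ℂ :=
  limitCoef q a b c d δ r (r - 2) - limitCoef q a b c d δ (r + 1) (r - 1) +
    limitCoef q a b c d δ r (r - 1) * (c⁻¹ * (q : ℂ) ^ (-r) -
      (c⁻¹ * (q : ℂ) ^ (-r - 1) + limitCoef q a b c d δ r (r - 1) - limitCoef q a b c d δ (r + 1) r))

theorem continuous_racahEntry (q : ℝ) (e₂ e₃ p : ℂ) (r r' : ℤ) :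
    Continuous fun e₁ => racahEntry q e₁ e₂ e₃ p r r' := by
  simp only [racahEntry]
  split_ifs
  · exact continuous_const
  · refine Continuous.div_const ?_ _
    have := (continuous_qPoch q (r - r').toNat).comp
      (continuous_id.mul (continuous_const (y := (q : ℂ) ^ r')))
    exact (this.mul continuous_const).mul continuous_const

theorem continuous_limitRatio (q a b : ℝ) (c d : ℂ) (r : ℤ) :
    Continuous fun δ => limitRatio q a b c d δ r := by
  have h : ∀ r r', Continuous fun δ => limitCoef q a b c d δ r r' := fun r r' =>
    continuous_const.mul ((continuous_racahEntry q (c / a * q) (c / b * q)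
      (q ^ 2 * (c * d / (a * b))) (r + 1) (r' + 1)).comp
      ((continuous_neg.mul continuous_const).mul continuous_const))
  unfold limitRatio
  exact ((h _ _).sub (h _ _)).add ((h _ _).mul
    (continuous_const.sub ((continuous_const.add (h _ _)).sub (h _ _))))

section Params

variable {q : ℝ} (hq₀ : 0 < q) (hq₁ : q < 1)

include hq₀ hq₁

/-- When both degrees are $N$ plus constants, $N$ remains only in the ratio of $q$-factorials, which
has a fixed number of factors, each tending to $1$. -/
theorem tendsto_racahPolyCoef (a b : ℝ) (c d δ : ℂ) {f g : ℕ → ℕ} {r r' : ℤ} (hr : r' ≤ r)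
    (hf : ∀ᶠ N : ℕ in atTop, (f N : ℤ) = N + r) (hg : ∀ᶠ N : ℕ in atTop, (g N : ℤ) = N + r') :
    Tendsto (fun N => racahPolyCoef q a b c d δ N (f N) (g N)) atTop
      (𝓝 (limitCoef q a b c d δ r r')) := by
  have hgt : Tendsto g atTop atTop := by
    refine tendsto_atTop.2 fun B => ?_
    filter_upwards [hg, eventually_ge_atTop ((B - r').toNat)] with N h1 h2
    omega
  have hq : ‖(q : ℂ)‖ < 1 := by rwa [Complex.norm_real, Real.norm_of_nonneg hq₀.le]
  have h1 : Tendsto (fun N => ∏ k ∈ Finset.range (r - r').toNat,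
      (1 - (q : ℂ) * (q : ℂ) ^ (g N + k))) atTop (𝓝 1) := by
    have h1 : ∏ k ∈ Finset.range (r - r').toNat, (1 - (q : ℂ) * 0) = 1 := by simp
    refine (congrArg (fun z => Tendsto _ atTop (𝓝 z)) h1).mp ?_
    refine tendsto_finsetProd _ fun k _ => (Tendsto.const_mul _ ?_).const_sub _
    exact Tendsto.comp (g := fun n : ℕ => (q : ℂ) ^ n)
      (tendsto_pow_atTop_nhds_zero_of_norm_lt_one hq) (tendsto_atTop_mono (fun N => Nat.le_add_right (g N) k) hgt)
  have h2 := h1.mul_const (limitCoef q a b c d δ r r')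
  rw [one_mul] at h2
  refine h2.congr' ?_
  filter_upwards [hf, hg] with N hfN hgN
  have h3 : f N = g N + (r - r').toNat := by omega
  have h4 : qPoch q q (f N) = qPoch q q (g N) * ∏ k ∈ Finset.range (r - r').toNat,
      (1 - (q : ℂ) * (q : ℂ) ^ (g N + k)) := by
    rw [h3, qPoch, Finset.prod_range_add, qPoch]
  rw [racahPolyCoef, limitCoef, h4, mul_div_cancel_left₀ _ (qPoch_self_ne_zero hq₀ hq₁ _),
    show (g N : ℤ) - f N = r' - r by omega, show (f N : ℤ) + 1 - N = r + 1 by omega,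
    show (g N : ℤ) + 1 - N = r' + 1 by omega]
  ring

theorem tendsto_racahNode (c δ : ℂ) {f : ℕ → ℕ} {r : ℤ}
    (hf : ∀ᶠ N : ℕ in atTop, (f N : ℤ) = N + r) :
    Tendsto (fun N => racahNode q c δ N (f N)) atTop (𝓝 (c⁻¹ * (q : ℂ) ^ (-r - 1))) := by
  have hft : Tendsto f atTop atTop := by
    refine tendsto_atTop.2 fun B => ?_
    filter_upwards [hf, eventually_ge_atTop ((B - r).toNat)] with N h1 h2
    omega
  have hq : ‖(q : ℂ)‖ < 1 := by rwa [Complex.norm_real, Real.norm_of_nonneg hq₀.le]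
  have h1 := ((tendsto_pow_atTop_nhds_zero_of_norm_lt_one hq).comp hft).const_mul (δ * c)
  have h2 := h1.const_sub (c⁻¹ * (q : ℂ) ^ (-r - 1))
  rw [mul_zero, sub_zero] at h2
  refine h2.congr' ?_
  filter_upwards [hf] with N hN
  rw [racahNode, show (N : ℤ) - f N - 1 = -r - 1 by omega]
  rfl

theorem tendsto_racahRatio (a b : ℝ) (c d δ : ℂ) {f : ℕ → ℕ} {r : ℤ}
    (hf : ∀ᶠ N : ℕ in atTop, (f N : ℤ) + 2 = N + r) :
    Tendsto (fun N => racahRatio q a b c d δ N (f N)) atTop (𝓝 (limitRatio q a b c d δ r)) := by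
  have h0 : ∀ᶠ N : ℕ in atTop, (f N : ℤ) = N + (r - 2) := hf.mono fun N h => by omega
  have h1 : ∀ᶠ N : ℕ in atTop, ((f N + 1 : ℕ) : ℤ) = N + (r - 1) := hf.mono fun N h => by omega
  have h2 : ∀ᶠ N : ℕ in atTop, ((f N + 2 : ℕ) : ℤ) = N + r := hf.mono fun N h => by omega
  have h3 : ∀ᶠ N : ℕ in atTop, ((f N + 3 : ℕ) : ℤ) = N + (r + 1) := hf.mono fun N h => by omega
  have n1 := tendsto_racahNode hq₀ hq₁ c δ h1
  have n2 := tendsto_racahNode hq₀ hq₁ c δ h2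
  rw [show -(r - 1) - 1 = -r by ring] at n1
  exact ((tendsto_racahPolyCoef hq₀ hq₁ a b c d δ (by omega) h2 h0).sub
    (tendsto_racahPolyCoef hq₀ hq₁ a b c d δ (by omega) h3 h1)).add
    ((tendsto_racahPolyCoef hq₀ hq₁ a b c d δ (by omega) h2 h1).mul
    (n1.sub ((n2.add (tendsto_racahPolyCoef hq₀ hq₁ a b c d δ (by omega) h2 h1)).sub
    (tendsto_racahPolyCoef hq₀ hq₁ a b c d δ (by omega) h3 h2))))

theorem gridNorm_racahMonic (a b : ℝ) (c d δ : ℂ) (N n : ℕ) {w x : ℕ → ℝ}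
    (horth : ∀ l m, l ≠ m → gridInner w x n (racahMonic q a b c d δ N l)
      (racahMonic q a b c d δ N m) = 0) (l : ℕ) :
    (gridNorm w x n (racahMonic q a b c d δ N (l + 2)) : ℂ) =
      racahRatio q a b c d δ N l * gridNorm w x n (racahMonic q a b c d δ N (l + 1)) :=
  gridNorm_recursion (P := racahMonic q a b c d δ N)
    (fun _ => newtonComb_monic _ (racahPolyCoef_self hq₀ hq₁ a b c d δ N _))
    (fun _ => degree_newtonComb _ (racahPolyCoef_self hq₀ hq₁ a b c d δ N _)) horth
    (newtonComb_recursion_mem _ (fun _ => racahPolyCoef_self hq₀ hq₁ a b c d δ N _) l)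

end Params

/-- At $\delta=0$ the recurrence coefficient, a combination of several fractions, collapses to a
single product, with $u=q^r$. Only in this form is its nonvanishing visible. -/
theorem limitRatio_identity {q s t p u : ℂ} (hq : q ≠ 0) (hu : u ≠ 0) (h1 : 1 - q ≠ 0)
    (h2 : 1 + q ≠ 0) (p0 : 1 - p * u ^ 2 / q ≠ 0) (p1 : 1 - p * u ^ 2 ≠ 0)
    (p2 : 1 - p * u ^ 2 * q ≠ 0) (p3 : 1 - p * u ^ 2 * q ^ 2 ≠ 0) :
    (1 - s * u / q) * (1 - s * u) * ((1 - t * u / q) * (1 - t * u)) /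
        ((u / q) ^ 2 * ((1 - q) * (1 - q ^ 2)) * ((1 - p * u ^ 2 / q) * (1 - p * u ^ 2))) -
      (1 - s * u) * (1 - s * u * q) * ((1 - t * u) * (1 - t * u * q)) /
        (u ^ 2 * ((1 - q) * (1 - q ^ 2)) * ((1 - p * u ^ 2 * q) * (1 - p * u ^ 2 * q ^ 2))) +
      (1 - s * u) * (1 - t * u) / (u * (1 - q) * (1 - p * u ^ 2)) *
        (u⁻¹ - (u⁻¹ * q⁻¹ + (1 - s * u) * (1 - t * u) / (u * (1 - q) * (1 - p * u ^ 2)) -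
          (1 - s * u * q) * (1 - t * u * q) / (u * q * (1 - q) * (1 - p * u ^ 2 * q ^ 2)))) =
      p * u ^ 2 / q * ((1 - s * u) * (1 - t * u) * (s - p * u) * (t - p * u)) /
        ((1 - p * u ^ 2 / q) * (1 - p * u ^ 2) ^ 2 * (1 - p * u ^ 2 * q)) := by
  have e0 : 1 - p * u ^ 2 / q = (q - p * u ^ 2) / q := by field_simp
  rw [e0] at p0 ⊢
  have p0' : q - p * u ^ 2 ≠ 0 := fun h => p0 (by rw [h, zero_div])
  have e1 : 1 - q ^ 2 = (1 - q) * (1 + q) := by ring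
  rw [e1]
  obtain ⟨D0, hD0⟩ : ∃ D, D = q - p * u ^ 2 := ⟨_, rfl⟩
  obtain ⟨D1, hD1⟩ : ∃ D, D = 1 - p * u ^ 2 := ⟨_, rfl⟩
  obtain ⟨D2, hD2⟩ : ∃ D, D = 1 - p * u ^ 2 * q := ⟨_, rfl⟩
  obtain ⟨D3, hD3⟩ : ∃ D, D = 1 - p * u ^ 2 * q ^ 2 := ⟨_, rfl⟩
  obtain ⟨E1, hE1⟩ : ∃ D, D = 1 - q := ⟨_, rfl⟩
  obtain ⟨E2, hE2⟩ : ∃ D, D = 1 + q := ⟨_, rfl⟩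
  rw [← hD0] at p0' ⊢
  rw [← hD1] at p1 ⊢
  rw [← hD2] at p2 ⊢
  rw [← hD3] at p3 ⊢
  rw [← hE1] at h1 ⊢
  rw [← hE2] at h2 ⊢
  field_simp
  rw [hD0, hD1, hD2, hD3, hE1, hE2]
  ring


section Params

variable {q : ℝ} (hq₀ : 0 < q)

include hq₀

theorem racahEntry_zero_one (s t p : ℂ) (r : ℤ) :
    racahEntry q 0 s t p (r + 1) r = (1 - s * (q : ℂ) ^ r) * (1 - t * (q : ℂ) ^ r) /
      ((q : ℂ) ^ r * (1 - q) * (1 - p * ((q : ℂ) ^ r) ^ 2)) := by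
  have hq : (q : ℂ) ≠ 0 := by exact_mod_cast hq₀.ne'
  have h1 : (q : ℂ) ^ (r + 1 + r - 1) = ((q : ℂ) ^ r) ^ 2 := by
    rw [sq, ← zpow_add₀ hq]
    congr 1
    ring
  rw [racahEntry, if_neg (by omega), show (r + 1 - r).toNat = 1 by omega, h1,
    show r + 1 - r = 1 by ring, zpow_one]
  simp [qPoch]

theorem racahEntry_zero_two (s t p : ℂ) (r : ℤ) :
    racahEntry q 0 s t p (r + 2) r = (1 - s * (q : ℂ) ^ r) * (1 - s * (q : ℂ) ^ r * q) *
      ((1 - t * (q : ℂ) ^ r) * (1 - t * (q : ℂ) ^ r * q)) /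
      (((q : ℂ) ^ r) ^ 2 * ((1 - q) * (1 - (q : ℂ) ^ 2)) *
        ((1 - p * ((q : ℂ) ^ r) ^ 2 * q) * (1 - p * ((q : ℂ) ^ r) ^ 2 * (q : ℂ) ^ 2))) := by
  have hq : (q : ℂ) ≠ 0 := by exact_mod_cast hq₀.ne'
  have h1 : (q : ℂ) ^ (r + 2 + r - 1) = ((q : ℂ) ^ r) ^ 2 * q := by
    rw [sq, ← zpow_add₀ hq, ← zpow_add_one₀ hq]
    congr 1
    ring
  rw [racahEntry, if_neg (by omega), show (r + 2 - r).toNat = 2 by omega, h1,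
    show r + 2 - r = ((2 : ℕ) : ℤ) by norm_num, zpow_natCast]
  simp only [qPoch, Finset.prod_range_succ, Finset.prod_range_zero, pow_zero, pow_one, mul_one,
    one_mul, zero_mul, sub_zero]
  congr 2
  · ring
  · ring

end Params

/-- The factors $1-su$ and $1-tu$ are nonzero by the sign conditions, and so are $s-pu=s(1-\tfrac db
q^{r+1})$ and $t-pu=t(1-\tfrac da q^{r+1})$. The denominators are nonzero since $p<0$. -/
theorem limitRatio_zero_ne_zero {q a b : ℝ} {c d : ℂ} (hq₀ : 0 < q) (hq₁ : q < 1)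
    (H : RacahPositive q a b c d) (r : ℤ) : limitRatio q a b c d 0 r ≠ 0 := by
  have hq : (q : ℂ) ≠ 0 := by exact_mod_cast hq₀.ne'
  have ha : (a : ℂ) ≠ 0 := by exact_mod_cast H.ha.ne'
  have hb : (b : ℂ) ≠ 0 := by exact_mod_cast H.hb.ne
  have hc := H.hc
  have hd := H.hd
  set u : ℂ := (q : ℂ) ^ r with hu
  have hu0 : u ≠ 0 := zpow_ne_zero _ hq
  have hum : (q : ℂ) ^ (r - 1) = u / q := by rw [zpow_sub_one₀ hq, div_eq_mul_inv]
  have hup : (q : ℂ) ^ (r + 1) = u * q := zpow_add_one₀ hq r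
  set s : ℂ := c / a * q with hs
  set t : ℂ := c / b * q with ht
  set p : ℂ := (q : ℂ) ^ 2 * (c * d / (a * b)) with hp
  have h1 : (1 : ℂ) - q ≠ 0 := by exact_mod_cast (sub_pos.2 hq₁).ne'
  have h2 : (1 : ℂ) + q ≠ 0 := by exact_mod_cast (by positivity : 0 < 1 + q).ne'
  have hpz := H.one_sub_ne_zero hq₀
  have hz : ∀ k : ℤ, (q : ℂ) ^ (2 * r + k) = u ^ 2 * (q : ℂ) ^ k := fun k => by
    rw [zpow_add₀ hq, two_mul, zpow_add₀ hq, sq]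
  have p0 : 1 - p * u ^ 2 / q ≠ 0 := by
    have := hpz (2 * r + (-1))
    rw [hz, zpow_neg_one] at this
    convert this using 2
    ring
  have p1 : 1 - p * u ^ 2 ≠ 0 := by
    have := hpz (2 * r + 0)
    rwa [hz, zpow_zero, mul_one] at this
  have p2 : 1 - p * u ^ 2 * q ≠ 0 := by
    have := hpz (2 * r + 1)
    rwa [hz, zpow_one, ← mul_assoc] at this
  have p3 : 1 - p * u ^ 2 * (q : ℂ) ^ 2 ≠ 0 := by
    have := hpz (2 * r + (2 : ℕ))
    rwa [hz, zpow_natCast, ← mul_assoc] at this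
  have key := limitRatio_identity (s := s) (t := t) hq hu0 h1 h2 p0 p1 p2 p3
  have hE : ∀ r r', limitCoef q a b c d 0 r r' =
      c ^ (r' - r) * racahEntry q 0 s t p (r + 1) (r' + 1) := fun r r' => by
    rw [limitCoef, neg_zero, zero_mul, zero_mul]
  have c1 : limitCoef q a b c d 0 r (r - 1) =
      c⁻¹ * ((1 - s * u) * (1 - t * u) / (u * (1 - q) * (1 - p * u ^ 2))) := by
    rw [hE, show r - 1 - r = (-1 : ℤ) by ring, zpow_neg_one, sub_add_cancel, racahEntry_zero_one hq₀]
  have c2 : limitCoef q a b c d 0 (r + 1) r =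
      c⁻¹ * ((1 - s * u * q) * (1 - t * u * q) / (u * q * (1 - q) * (1 - p * u ^ 2 * q ^ 2))) := by
    rw [hE, show r - (r + 1) = (-1 : ℤ) by ring, zpow_neg_one, racahEntry_zero_one hq₀, hup,
      mul_pow]
    simp only [mul_assoc]
  have c3 : limitCoef q a b c d 0 r (r - 2) =
      c⁻¹ ^ 2 * ((1 - s * u / q) * (1 - s * u) * ((1 - t * u / q) * (1 - t * u)) /
        ((u / q) ^ 2 * ((1 - q) * (1 - (q : ℂ) ^ 2)) *
          ((1 - p * u ^ 2 / q) * (1 - p * u ^ 2)))) := by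
    have f1 : ∀ z : ℂ, z * (u / q) = z * u / q := fun z => by ring
    have f2 : ∀ z : ℂ, z * u / q * q = z * u := fun z => by field_simp
    have f3 : p * (u / q) ^ 2 * q = p * u ^ 2 / q := by field_simp
    have f4 : p * (u / q) ^ 2 * (q : ℂ) ^ 2 = p * u ^ 2 := by field_simp
    rw [hE, show r - 2 - r = -((2 : ℕ) : ℤ) by norm_num, zpow_neg, zpow_natCast, show r - 2 + 1 = r - 1 by ring, show r + 1 = r - 1 + 2 by ring,
      racahEntry_zero_two hq₀, hum, inv_pow, f1, f1, f2, f2, f3, f4]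
  have c4 : limitCoef q a b c d 0 (r + 1) (r - 1) =
      c⁻¹ ^ 2 * ((1 - s * u) * (1 - s * u * q) * ((1 - t * u) * (1 - t * u * q)) /
        (u ^ 2 * ((1 - q) * (1 - (q : ℂ) ^ 2)) *
          ((1 - p * u ^ 2 * q) * (1 - p * u ^ 2 * (q : ℂ) ^ 2)))) := by
    rw [hE, show r - 1 - (r + 1) = -((2 : ℕ) : ℤ) by norm_num; ring, zpow_neg, zpow_natCast,
      sub_add_cancel, show r + 1 + 1 = r + 2 by ring,
      racahEntry_zero_two hq₀, inv_pow]
  have e1 : (q : ℂ) ^ (-r) = u⁻¹ := zpow_neg _ _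
  have e2 : (q : ℂ) ^ (-r - 1) = u⁻¹ * (q : ℂ)⁻¹ := by rw [zpow_sub_one₀ hq, e1]
  have hfin : limitRatio q a b c d 0 r = c⁻¹ ^ 2 * (p * u ^ 2 / q *
      ((1 - s * u) * (1 - t * u) * (s - p * u) * (t - p * u)) /
        ((1 - p * u ^ 2 / q) * (1 - p * u ^ 2) ^ 2 * (1 - p * u ^ 2 * q))) := by
    rw [← key, limitRatio, c1, c2, c3, c4, e1, e2]
    ring
  have hA : ∀ k : ℤ, (1 - c / a * (q : ℂ) ^ k) * (1 - d / a * (q : ℂ) ^ k) ≠ 0 := fun k => by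
    obtain ⟨x, hx, h⟩ := H.ha' k
    rw [← h]
    exact_mod_cast hx.ne'
  have hB : ∀ k : ℤ, (1 - c / b * (q : ℂ) ^ k) * (1 - d / b * (q : ℂ) ^ k) ≠ 0 := fun k => by
    obtain ⟨x, hx, h⟩ := H.hb' k
    rw [← h]
    exact_mod_cast hx.ne'
  have n1 : 1 - s * u ≠ 0 := by
    have := left_ne_zero_of_mul (hA (r + 1))
    rw [hup] at this
    convert this using 2
    rw [hs]; ring
  have n2 : 1 - t * u ≠ 0 := by
    have := left_ne_zero_of_mul (hB (r + 1))
    rw [hup] at this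
    convert this using 2
    rw [ht]; ring
  have n3 : s - p * u ≠ 0 := by
    have h3 : s - p * u = s * (1 - d / b * (q : ℂ) ^ (r + 1)) := by
      rw [hup, hs, hp]; field_simp
    rw [h3]
    exact mul_ne_zero (mul_ne_zero (div_ne_zero hc ha) hq) (right_ne_zero_of_mul (hB (r + 1)))
  have n4 : t - p * u ≠ 0 := by
    have h3 : t - p * u = t * (1 - d / a * (q : ℂ) ^ (r + 1)) := by
      rw [hup, ht, hp]; field_simp
    rw [h3]
    exact mul_ne_zero (mul_ne_zero (div_ne_zero hc hb) hq) (right_ne_zero_of_mul (hA (r + 1)))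
  have n5 : p ≠ 0 := mul_ne_zero (pow_ne_zero _ hq)
    (div_ne_zero (mul_ne_zero hc hd) (mul_ne_zero ha hb))
  rw [hfin]
  refine mul_ne_zero (pow_ne_zero _ (inv_ne_zero hc)) (div_ne_zero (mul_ne_zero (div_ne_zero
    (mul_ne_zero n5 (pow_ne_zero _ hu0)) hq) (mul_ne_zero (mul_ne_zero (mul_ne_zero n1 n2) n3) n4))
    (mul_ne_zero (mul_ne_zero p0 (pow_ne_zero _ p1)) p2))


/-! ### The `q`-Racah ensembles -/

/-- Andréief's identity for a sum over a finite set. -/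
theorem sum_det_mul_det {R : Type*} [CommRing R] {N : ℕ} (s : Finset ℕ) (w : ℕ → R)
    (u v : Fin N → ℕ → R) :
    ∑ f ∈ Fintype.piFinset (fun _ : Fin N => s), (∏ j, w (f j)) *
      ((Matrix.of fun i j => u i (f j)).det * (Matrix.of fun i j => v i (f j)).det) =
      N.factorial * (Matrix.of fun i j => ∑ t ∈ s, (w t * v i t) * u j t).det := by
  have hperm : ∀ (σ : Equiv.Perm (Fin N)) (F : (Fin N → ℕ) → R),
      ∑ f ∈ Fintype.piFinset (fun _ : Fin N => s), F f =
        ∑ f ∈ Fintype.piFinset (fun _ : Fin N => s), F (f ∘ σ) := by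
    intro σ F
    refine (Finset.sum_bij' (fun f _ => f ∘ σ) (fun f _ => f ∘ σ.symm) ?_ ?_ ?_ ?_ ?_).symm
    · intro f hf
      rw [Fintype.mem_piFinset] at hf ⊢
      exact fun i => hf _
    · intro f hf
      rw [Fintype.mem_piFinset] at hf ⊢
      exact fun i => hf _
    · intro f _
      funext i
      simp
    · intro f _
      funext i
      simp
    · intro f _
      rfl
  have hdet : ∀ (σ : Equiv.Perm (Fin N)) (f : Fin N → ℕ),
      (Matrix.of fun i j => u i ((f ∘ σ) j)).det =
        ((Equiv.Perm.sign σ : ℤ) : R) * (Matrix.of fun i j => u i (f j)).det := by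
    intro σ f
    rw [← Matrix.det_transpose, ← Matrix.det_transpose (Matrix.of fun i j => u i (f j))]
    exact det_perm_rows (fun t j => u j t) f σ
  have hdet' : (Matrix.of fun i j => ∑ t ∈ s, (w t * v i t) * u j t).det =
      ∑ f ∈ Fintype.piFinset (fun _ : Fin N => s), (∏ i, w (f i) * v i (f i)) *
        (Matrix.of fun i j => u i (f j)).det := by
    rw [det_sum_rows (fun i t => w t * v i t) (fun t j => u j t) fun _ => s]
    refine Finset.sum_congr rfl fun f _ => ?_
    rw [← Matrix.det_transpose]
    rfl
  -- Relabelling $f$ by $\sigma$ produces a sign from the first determinant that cancels the sign of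
  -- $\sigma$. Each of the $N!$ permutations therefore contributes the same amount.
  have hterm : ∀ σ : Equiv.Perm (Fin N),
      ∑ f ∈ Fintype.piFinset (fun _ : Fin N => s), (∏ j, w (f j)) *
        ((Matrix.of fun i j => u i (f j)).det * (((Equiv.Perm.sign σ : ℤ) : R) *
          ∏ i, v (σ i) (f i))) =
      (Matrix.of fun i j => ∑ t ∈ s, (w t * v i t) * u j t).det := by
    intro σ
    rw [hperm σ, hdet']
    refine Finset.sum_congr rfl fun f _ => ?_
    have h1 : ∏ j, w ((f ∘ σ) j) = ∏ j, w (f j) := Equiv.prod_comp σ fun j => w (f j)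
    have h2 : ∏ i, v (σ i) ((f ∘ σ) i) = ∏ i, v i (f i) :=
      Equiv.prod_comp σ fun i => v i (f i)
    have h3 : ((Equiv.Perm.sign σ : ℤ) : R) * ((Equiv.Perm.sign σ : ℤ) : R) = 1 := by
      rw [← Int.cast_mul, ← Units.val_mul, Int.units_mul_self]
      simp
    rw [h1, h2, hdet, Finset.prod_mul_distrib]
    linear_combination (∏ j, w (f j)) * (∏ i, v i (f i)) *
      (Matrix.of fun i j => u i (f j)).det * h3
  calc _ = ∑ f ∈ Fintype.piFinset (fun _ : Fin N => s), ∑ σ : Equiv.Perm (Fin N),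
        (∏ j, w (f j)) * ((Matrix.of fun i j => u i (f j)).det *
          (((Equiv.Perm.sign σ : ℤ) : R) * ∏ i, v (σ i) (f i))) := by
        refine Finset.sum_congr rfl fun f _ => ?_
        rw [Matrix.det_apply' (Matrix.of fun i j => v i (f j)), Finset.mul_sum, Finset.mul_sum]
        rfl
    _ = _ := by
        rw [Finset.sum_comm, Finset.sum_congr rfl fun σ _ => hterm σ, Finset.sum_const,
          Finset.card_univ, Fintype.card_perm, Fintype.card_fin, nsmul_eq_mul]

/-- The Gram determinant of two families of orthogonal functions. -/
theorem det_gram_exps {N : ℕ} {l m : YoungDiagram} (hl : l.colLen 0 ≤ N) (hm : m.colLen 0 ≤ N)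
    {G : ℕ → ℕ → ℂ} (hG : ∀ i j, i ≠ j → G i j = 0) [Decidable (l = m)] :
    (Matrix.of fun i j => G (l.exps N j) (m.exps N i)).det =
      if l = m then ∏ i, G (l.exps N i) (l.exps N i) else 0 := by
  split_ifs with h
  · subst h
    rw [show (Matrix.of fun i j => G (l.exps N j) (l.exps N i)) =
      Matrix.diagonal fun i => G (l.exps N i) (l.exps N i) from ?_, Matrix.det_diagonal]
    ext i j
    rw [Matrix.of_apply, Matrix.diagonal_apply]
    split_ifs with hij
    · rw [hij]
    · exact hG _ _ fun h => hij (l.exps_injective N h).symm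
  · rw [Matrix.det_apply]
    refine Finset.sum_eq_zero fun σ _ => ?_
    have h1 : ∃ i, l.exps N i ≠ m.exps N (σ i) := by
      by_contra! h1
      refine h (YoungDiagram.exps_comp_perm_injective (σ := 1) (τ := σ) hl hm ?_).1
      funext i
      exact h1 i
    obtain ⟨i, hi⟩ := h1
    rw [Finset.prod_eq_zero (Finset.mem_univ i), smul_zero]
    exact hG _ _ hi

theorem jtComb_bot (κ : YoungDiagram → ℂ) (τ : ℤ → ℕ → ℂ) (P : ℕ → ℂ) :
    jtComb ⊥ κ τ P = κ ⊥ := by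
  have h0 : (⊥ : YoungDiagram).colLen 0 = 0 := by
    by_contra h
    exact YoungDiagram.notMem_bot _ (YoungDiagram.mem_iff_lt_colLen.2 (Nat.pos_of_ne_zero h))
  have h1 : (YoungDiagram.finite_setOf_le ⊥).toFinset = {⊥} := by
    ext m; simp
  have h2 : ∀ n : ℕ, n = 0 → ∀ A : Matrix (Fin n) (Fin n) ℂ, A.det = 1 := by
    rintro n rfl A
    exact Matrix.det_fin_zero
  rw [jtComb, h1, Finset.sum_singleton, jtDet, h2 _ h0, mul_one]

/-- The normalized `N`-variate `q`-Racah polynomials, as functions of the power sums. -/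
noncomputable def racahMulti (q a b : ℝ) (c d δ : ℂ) (N : ℕ) (l : YoungDiagram) (P : ℕ → ℂ) : ℂ :=
  jtComb l (fun m => racahCorrection q N l m * scaledCoef q a b c d δ l m)
    (fun e k => nodeSums (racahNode q c δ N) N e k) P

/-- The squared norms of the `N`-variate `q`-Racah polynomials. -/
noncomputable def racahMultiNorm (q a b : ℝ) (c d δ : ℂ) (N : ℕ) (l : YoungDiagram) : ℂ :=
  ∏ i ∈ Finset.range (l.colLen 0), ∏ s ∈ Finset.range (l.rowLen i),
    racahRatio q a b c d δ N (N - 2 - i + s)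

/-- The squared norms of the limit functions. -/
noncomputable def limitNorm (q a b : ℝ) (c d δ : ℂ) (l : YoungDiagram) : ℂ :=
  ∏ i ∈ Finset.range (l.colLen 0), ∏ s ∈ Finset.range (l.rowLen i),
    limitRatio q a b c d δ ((s : ℤ) - i)

theorem continuous_limitNorm (q a b : ℝ) (c d : ℂ) (l : YoungDiagram) :
    Continuous fun δ => limitNorm q a b c d δ l :=
  continuous_finsetProd _ fun _ _ => continuous_finsetProd _ fun _ _ =>
    continuous_limitRatio _ _ _ _ _ _

theorem limitNorm_zero_ne_zero {q a b : ℝ} {c d : ℂ} (hq₀ : 0 < q) (hq₁ : q < 1)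
    (H : RacahPositive q a b c d) (l : YoungDiagram) : limitNorm q a b c d 0 l ≠ 0 :=
  Finset.prod_ne_zero_iff.2 fun _ _ => Finset.prod_ne_zero_iff.2 fun _ _ =>
    limitRatio_zero_ne_zero hq₀ hq₁ H _

theorem tendsto_racahMultiNorm {q : ℝ} (hq₀ : 0 < q) (hq₁ : q < 1) (a b : ℝ) (c d δ : ℂ)
    (l : YoungDiagram) : Tendsto (fun N => racahMultiNorm q a b c d δ N l) atTop
      (𝓝 (limitNorm q a b c d δ l)) := by
  refine tendsto_finsetProd _ fun i _ => tendsto_finsetProd _ fun s _ =>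
    tendsto_racahRatio hq₀ hq₁ a b c d δ ?_
  filter_upwards [eventually_ge_atTop (2 + i)] with N hN
  omega

theorem racahPoint_strictAnti {q a b : ℝ} (hq₀ : 0 < q) (hq₁ : q < 1) (ha : 0 < a) (hb : b < 0)
    (n : ℕ) : StrictAnti (racahPoint q a b n) := by
  intro s t hst
  have h1 : q ^ (t + 1) / a < q ^ (s + 1) / a :=
    div_lt_div_of_pos_right (pow_lt_pow_right_of_lt_one₀ hq₀ hq₁ (by omega)) ha
  have h2 : q ^ ((n : ℤ) - s) < q ^ ((n : ℤ) - t) :=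
    zpow_lt_zpow_right_of_lt_one₀ hq₀ hq₁ (by omega)
  have h3 := div_lt_div_of_neg_of_lt hb h2
  simp only [racahPoint]
  linarith

-- The weight is $\prod_jw(f_j)$ times the squared Vandermonde product, normalized. The Vandermonde
-- factors convert the $N$-variate polynomials into determinants, and Andréief's identity makes
-- their inner products Gram determinants, diagonal for an orthogonal family.
open Classical in
theorem exists_racah_ensemble {q a b : ℝ} {c d : ℂ} (hq₀ : 0 < q) (hq₁ : q < 1)
    (H : RacahPositive q a b c d) (M N : ℕ) :
    ∃ W : (Fin N → ℕ) → ℝ, (∀ f ∈ Fintype.piFinset fun _ => Finset.range (N + 2 * M), 0 ≤ W f) ∧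
      (∑ f ∈ Fintype.piFinset fun _ => Finset.range (N + 2 * M), W f = 1) ∧
      (∀ f, ¬ Function.Injective f → W f = 0) ∧
      ∀ l m : YoungDiagram, l.colLen 0 + 1 ≤ N → m.colLen 0 + 1 ≤ N →
        ∑ f ∈ Fintype.piFinset fun _ => Finset.range (N + 2 * M), (W f : ℂ) *
          (racahMulti q a b c d (deltaPar q a b M) N l
              (psums fun j => (racahPoint q a b (N + 2 * M) (f j) : ℂ)) *
            (starRingEnd ℂ) (racahMulti q a b c d (deltaPar q a b M) N m
              (psums fun j => (racahPoint q a b (N + 2 * M) (f j) : ℂ)))) =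
          if l = m then racahMultiNorm q a b c d (deltaPar q a b M) N l else 0 := by
  obtain ⟨w, hw, horth⟩ := exists_racah_weight hq₀ hq₁ H M N
  set n := N + 2 * M
  set δ : ℂ := (deltaPar q a b M : ℂ)
  set x := racahPoint q a b n
  set G := Fintype.piFinset fun _ : Fin N => Finset.range n
  set p := racahMonic q a b c d δ N
  have hP : ∀ l m, l ≠ m → gridInner w x n (p l) (p m) = 0 := by
    intro l m hlm
    simp only [gridInner, p, eval_racahMonic]
    exact horth l m hlm
  set h : ℕ → ℝ := fun l => gridNorm w x n (p l) with hh
  have hpos : ∀ l < n, 0 < h l := by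
    intro l hl
    have h1 : (p l).Monic := newtonComb_monic _ (racahPolyCoef_self hq₀ hq₁ a b c d δ N _)
    refine gridNorm_pos hw (racahPoint_strictAnti hq₀ hq₁ H.ha H.hb n).injective.injOn h1.ne_zero ?_
    have h2 : (p l).degree = l := degree_newtonComb _ (racahPolyCoef_self hq₀ hq₁ a b c d δ N _)
    rwa [Polynomial.natDegree_eq_of_degree_eq_some h2]
  have hrec : ∀ l, (h (l + 2) : ℂ) = racahRatio q a b c d δ N l * h (l + 1) :=
    gridNorm_racahMonic hq₀ hq₁ a b c d δ N n hP
  set V : (Fin N → ℕ) → ℝ := fun f => vdm fun j => x (f j)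
  have hV : ∀ f, (V f : ℂ) = vdm fun j => (x (f j) : ℂ) := by
    intro f
    simp only [V, vdm]
    push_cast
    rfl
  set φ : YoungDiagram → (Fin N → ℕ) → ℂ := fun l f =>
    racahMulti q a b c d δ N l (psums fun j => (x (f j) : ℂ))
  set W₀ : (Fin N → ℕ) → ℝ := fun f => (∏ j, w (f j)) * V f ^ 2
  have hmain : ∀ l m : YoungDiagram, l.colLen 0 ≤ N → m.colLen 0 ≤ N →
      ∑ f ∈ G, (W₀ f : ℂ) * (φ l f * (starRingEnd ℂ) (φ m f)) =
        if l = m then (N.factorial : ℂ) * ∏ i, (h (l.exps N i) : ℂ) else 0 := by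
    intro l m hl hm
    have e1 := fun f : Fin N → ℕ => det_racahPoly (q := q) a b H.hc d δ hl fun j => (x (f j) : ℂ)
    have e2 := fun f : Fin N → ℕ => det_racahPoly (q := q) a b H.hc d δ hm fun j => (x (f j) : ℂ)
    have e3 := sum_det_mul_det (Finset.range n) (fun t => (w t : ℂ))
      (fun i t => racahPoly q a b c d δ N (l.exps N i) (x t))
      (fun i t => (starRingEnd ℂ) (racahPoly q a b c d δ N (m.exps N i) (x t)))
    have e4 : (Matrix.of fun i j => ∑ t ∈ Finset.range n, ((w t : ℂ) * (starRingEnd ℂ)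
        (racahPoly q a b c d δ N (m.exps N i) (x t))) *
          racahPoly q a b c d δ N (l.exps N j) (x t)) =
        Matrix.of fun i j => gridInner w x n (p (l.exps N j)) (p (m.exps N i)) := by
      ext i j
      simp only [Matrix.of_apply, gridInner, p, eval_racahMonic]
      exact Finset.sum_congr rfl fun t _ => by ring
    rw [e4, det_gram_exps hl hm (G := fun i j => gridInner w x n (p i) (p j)) hP] at e3
    simp only [gridInner_self] at e3
    rw [mul_ite, mul_zero] at e3
    rw [← e3]
    refine Finset.sum_congr rfl fun f _ => ?_
    have e5 : (Matrix.of fun i j => (starRingEnd ℂ)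
        (racahPoly q a b c d δ N (m.exps N i) (x (f j)))).det = V f * (starRingEnd ℂ) (φ m f) := by
      have := congrArg (starRingEnd ℂ) (e2 f)
      rw [← hV, map_mul, Complex.conj_ofReal, RingHom.map_det] at this
      exact this
    rw [e5, e1 f, ← hV]
    simp only [W₀, φ, racahMulti]
    push_cast
    ring
  have hbot0 : (⊥ : YoungDiagram).colLen 0 = 0 := by
    by_contra h
    exact YoungDiagram.notMem_bot _ (YoungDiagram.mem_iff_lt_colLen.2 (Nat.pos_of_ne_zero h))
  have hφbot : ∀ f, φ ⊥ f = 1 := by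
    intro f
    simp only [φ, racahMulti]
    rw [jtComb_bot, scaledCoef, racahDet_self, sub_self, zpow_zero, one_mul, mul_one,
      racahCorrection, Finset.prod_congr rfl fun i _ => div_self (qPoch_self_ne_zero hq₀ hq₁ _),
      Finset.prod_const_one]
  set Z : ℝ := N.factorial * ∏ i : Fin N, h ((⊥ : YoungDiagram).exps N i) with hZ
  have hZpos : 0 < Z := by
    refine mul_pos (by exact_mod_cast N.factorial_pos) (Finset.prod_pos fun i _ => hpos _ ?_)
    rw [YoungDiagram.exps, YoungDiagram.rowLen_eq_zero (by rw [hbot0]; omega)]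
    have := i.2
    omega
  have hsum : ∑ f ∈ G, W₀ f = Z := by
    have h1 := hmain ⊥ ⊥ (by omega) (by omega)
    simp only [hφbot, map_one, mul_one, if_true] at h1
    have h2 : ((∑ f ∈ G, W₀ f : ℝ) : ℂ) = (Z : ℂ) := by
      rw [hZ]
      push_cast
      exact h1
    exact_mod_cast h2
  have hstep : ∀ l : YoungDiagram, l.colLen 0 + 1 ≤ N → ∏ i : Fin N, (h (l.exps N i) : ℂ) =
      racahMultiNorm q a b c d δ N l * ∏ i : Fin N, (h ((⊥ : YoungDiagram).exps N i) : ℂ) := by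
    intro l hl
    -- Row $i$ raises the degree from $N-1-i$ to $N-1-i+\lambda_i$, and `racahRatio` at index $l$ is
    -- the passage from degree $l+1$ to $l+2$. The passage from degree $0$ is not covered, so the
    -- last row must be empty; hence the condition that $\lambda$ has at most $N-1$ rows.
    have h1 : ∀ i : ℕ, i + 2 ≤ N → ∀ k : ℕ, (h (k + (N - 1 - i)) : ℂ) =
        (∏ s ∈ Finset.range k, racahRatio q a b c d δ N (N - 2 - i + s)) * h (N - 1 - i) := by
      intro i hi k
      induction k with
      | zero => simp
      | succ k ih =>
        have h2 := hrec (N - 2 - i + k)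
        rw [show N - 2 - i + k + 2 = k + 1 + (N - 1 - i) by omega,
          show N - 2 - i + k + 1 = k + (N - 1 - i) by omega, ih] at h2
        rw [h2, Finset.prod_range_succ]
        ring
    have h3 : ∀ i : Fin N, (h (l.exps N i) : ℂ) =
        (∏ s ∈ Finset.range (l.rowLen i), racahRatio q a b c d δ N (N - 2 - i + s)) *
          h ((⊥ : YoungDiagram).exps N i) := by
      intro i
      have h4 : (⊥ : YoungDiagram).exps N i = N - 1 - i := by
        rw [YoungDiagram.exps, YoungDiagram.rowLen_eq_zero (by rw [hbot0]; omega), zero_add]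
      rw [h4]
      by_cases hi : (i : ℕ) + 2 ≤ N
      · exact h1 i hi _
      · rw [YoungDiagram.exps, YoungDiagram.rowLen_eq_zero (μ := l) (i := i) (by omega)]
        simp
    rw [Finset.prod_congr rfl fun i _ => h3 i, Finset.prod_mul_distrib]
    congr 1
    rw [← Finset.prod_range fun i => ∏ s ∈ Finset.range (l.rowLen i),
      racahRatio q a b c d δ N (N - 2 - i + s), racahMultiNorm]
    symm
    refine Finset.prod_subset (Finset.range_mono (by omega)) fun i _ hi => ?_
    rw [YoungDiagram.rowLen_eq_zero (by simpa using hi)]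
    simp
  refine ⟨fun f => W₀ f / Z, fun f hf => ?_, ?_, fun f hf => ?_, fun l m hl hm => ?_⟩
  · refine div_nonneg (mul_nonneg (Finset.prod_nonneg fun j _ => (hw _ ?_).le) (sq_nonneg _))
      hZpos.le
    exact Finset.mem_range.1 (Fintype.mem_piFinset.1 hf j)
  · rw [← Finset.sum_div, hsum, div_self hZpos.ne']
  · have h1 : V f = 0 := by
      simp only [Function.Injective, not_forall] at hf
      obtain ⟨i, j, hij, hne⟩ := hf
      rcases lt_or_gt_of_ne hne with h2 | h2
      · exact Finset.prod_eq_zero (Finset.mem_univ i)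
          (Finset.prod_eq_zero (Finset.mem_Ioi.2 h2) (sub_eq_zero.2 (congrArg x hij)))
      · exact Finset.prod_eq_zero (Finset.mem_univ j)
          (Finset.prod_eq_zero (Finset.mem_Ioi.2 h2) (sub_eq_zero.2 (congrArg x hij.symm)))
    simp only [W₀, h1]
    simp
  · have h1 := hmain l m (by omega) (by omega)
    have hZc : (Z : ℂ) ≠ 0 := by exact_mod_cast hZpos.ne'
    have h2 : ∑ f ∈ G, ((W₀ f / Z : ℝ) : ℂ) * (φ l f * (starRingEnd ℂ) (φ m f)) =
        (∑ f ∈ G, (W₀ f : ℂ) * (φ l f * (starRingEnd ℂ) (φ m f))) / Z := by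
      rw [Finset.sum_div]
      refine Finset.sum_congr rfl fun f _ => ?_
      push_cast
      ring
    refine h2.trans ?_
    rw [h1]
    split_ifs with hlm
    · rw [hstep l hl, div_eq_iff hZc, hZ]
      push_cast
      ring
    · rw [zero_div]


/-! ### Power sums of configurations -/

/-- The power sums of a configuration. -/
noncomputable def configSums {Δ : Set ℝ} (X : Config Δ) (k : ℕ) : ℂ :=
  ∑' x : Δ, if X x = true then ((x : ℝ) : ℂ) ^ (k + 1) else 0

theorem evalConfig_eq {Δ : Set ℝ} (X : Config Δ) (F : SymFun) :
    F.evalConfig X = MvPolynomial.aeval (configSums X) F := rfl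

theorem summable_doubleGrid {q : ℝ} (hq₀ : 0 < q) (hq₁ : q < 1) {l r : ℝ} (hl : l ≠ 0)
    (hr : r ≠ 0) : Summable fun x : doubleGrid q l r => |(x : ℝ)| := by
  have h1 : ∀ c : ℝ, c ≠ 0 →
      Summable ((Set.range fun n : ℕ => c * q ^ n).indicator fun x : ℝ => |x|) := by
    intro c hc
    have hinj : Function.Injective fun n : ℕ => c * q ^ n := fun m n h =>
      pow_right_injective₀ hq₀ hq₁.ne (mul_left_cancel₀ hc h)
    rw [← hinj.summable_iff]
    · refine ((summable_geometric_of_lt_one hq₀.le hq₁).mul_left |c|).congr fun n => ?_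
      rw [Function.comp_apply, Set.indicator_of_mem (Set.mem_range_self n), abs_mul,
        abs_of_pos (pow_pos hq₀ n)]
    · intro x hx
      exact Set.indicator_of_notMem hx _
  have h2 : Summable ((doubleGrid q l r).indicator fun x : ℝ => |x|) := by
    refine Summable.of_nonneg_of_le (fun x => Set.indicator_nonneg (fun _ _ => abs_nonneg _) x)
      (fun x => ?_) ((h1 l hl).add (h1 r hr))
    have h3 : ∀ s : Set ℝ, 0 ≤ s.indicator (fun x : ℝ => |x|) x := fun s =>
      Set.indicator_nonneg (fun _ _ => abs_nonneg _) x
    by_cases hx : x ∈ doubleGrid q l r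
    · rw [Set.indicator_of_mem hx]
      obtain ⟨n, hn | hn⟩ := hx
      · rw [Set.indicator_of_mem (s := Set.range fun n : ℕ => l * q ^ n) ⟨n, hn.symm⟩]
        exact le_add_of_nonneg_right (h3 _)
      · rw [Set.indicator_of_mem (s := Set.range fun n : ℕ => r * q ^ n) ⟨n, hn.symm⟩]
        exact le_add_of_nonneg_left (h3 _)
    · rw [Set.indicator_of_notMem hx]
      exact add_nonneg (h3 _) (h3 _)
  exact summable_subtype_iff_indicator.2 h2

section Grid

variable {Δ : Set ℝ} (hΔ : Summable fun x : Δ => |(x : ℝ)|)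

include hΔ

theorem abs_le_tsum_abs (x : Δ) : |(x : ℝ)| ≤ ∑' y : Δ, |(y : ℝ)| :=
  hΔ.le_tsum x fun _ _ => abs_nonneg _

theorem summable_abs_pow (k : ℕ) : Summable fun x : Δ => |(x : ℝ)| ^ (k + 1) := by
  refine Summable.of_nonneg_of_le (fun x => by positivity) (fun x => ?_)
    (hΔ.mul_left ((∑' y : Δ, |(y : ℝ)|) ^ k))
  rw [pow_succ]
  exact mul_le_mul_of_nonneg_right
    (pow_le_pow_left₀ (abs_nonneg _) (abs_le_tsum_abs hΔ x) k) (abs_nonneg _)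

omit hΔ in
theorem norm_configSums_term_le (k : ℕ) (X : Config Δ) (x : Δ) :
    ‖if X x = true then ((x : ℝ) : ℂ) ^ (k + 1) else 0‖ ≤ |(x : ℝ)| ^ (k + 1) := by
  split_ifs
  · rw [norm_pow, Complex.norm_real, Real.norm_eq_abs]
  · rw [norm_zero]; positivity

theorem continuous_configSums : Continuous fun X : Config Δ => configSums X := by
  refine continuous_pi fun k => continuous_tsum (fun x => ?_) (summable_abs_pow hΔ k)
    fun x X => norm_configSums_term_le k X x
  exact (continuous_of_discreteTopology (f := fun β : Bool =>
    if β = true then ((x : ℝ) : ℂ) ^ (k + 1) else 0)).comp (continuous_apply x)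

omit hΔ in
theorem conj_configSums (X : Config Δ) (k : ℕ) :
    (starRingEnd ℂ) (configSums X k) = configSums X k := by
  rw [configSums, Complex.conj_tsum]
  refine tsum_congr fun x => ?_
  split_ifs
  · rw [map_pow, Complex.conj_ofReal]
  · simp

/-- The power sums separate configurations. -/
theorem configSums_injective (h0 : (0 : ℝ) ∉ Δ) :
    Function.Injective fun X : Config Δ => configSums X := by
  intro X Y hXY
  set ε : Δ → ℝ := fun x => (if X x = true then 1 else 0) - (if Y x = true then 1 else 0) with hε
  have hε1 : ∀ x, |ε x| ≤ 1 := by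
    intro x
    simp only [hε]
    split_ifs <;> simp
  have hsum : ∀ k : ℕ, Summable fun x : Δ => ε x * (x : ℝ) ^ (k + 1) := fun k => by
    refine Summable.of_norm_bounded (summable_abs_pow hΔ k) fun x => ?_
    rw [norm_mul, norm_pow, Real.norm_eq_abs, Real.norm_eq_abs]
    exact mul_le_of_le_one_left (by positivity) (hε1 x)
  have hmom : ∀ k : ℕ, ∑' x : Δ, ε x * (x : ℝ) ^ (k + 1) = 0 := by
    intro k
    have h1 : ∀ Z : Config Δ, Summable fun x : Δ =>
        if Z x = true then ((x : ℝ) : ℂ) ^ (k + 1) else 0 := fun Z =>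
      Summable.of_norm_bounded (summable_abs_pow hΔ k) (norm_configSums_term_le k Z)
    have h2 : configSums X k - configSums Y k = 0 := sub_eq_zero.2 (congrFun hXY k)
    rw [configSums, configSums, ← (h1 X).tsum_sub (h1 Y)] at h2
    have h3 : ((∑' x : Δ, ε x * (x : ℝ) ^ (k + 1) : ℝ) : ℂ) = 0 := by
      rw [Complex.ofReal_tsum, ← h2]
      refine tsum_congr fun x => ?_
      simp only [hε]
      split_ifs <;> simp
    exact_mod_cast h3
  have hpoly : ∀ f : Polynomial ℝ, ∑' x : Δ, ε x * (x : ℝ) * f.eval (x : ℝ) = 0 := by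
    intro f
    have h1 : ∀ x : Δ, ε x * (x : ℝ) * f.eval (x : ℝ) =
        ∑ k ∈ Finset.range (f.natDegree + 1), f.coeff k * (ε x * (x : ℝ) ^ (k + 1)) := by
      intro x
      rw [Polynomial.eval_eq_sum_range, Finset.mul_sum]
      exact Finset.sum_congr rfl fun k _ => by ring
    simp only [h1]
    rw [Summable.tsum_finsetSum fun k _ => (hsum k).mul_left _]
    refine Finset.sum_eq_zero fun k _ => ?_
    rw [tsum_mul_left, hmom, mul_zero]
  set T : ℝ := ∑' y : Δ, |(y : ℝ)| with hT
  have hT0 : 0 ≤ T := tsum_nonneg fun _ => abs_nonneg _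
  funext x₀
  -- The polynomials $(1-((x-x_0)/(2T+1))^2)^j$ equal $1$ at $x_0$ and tend to $0$ at every other
  -- grid point, since $|x-x_0|\le2T$. They isolate the difference of the two configurations at
  -- $x_0$.
  have hlim : Tendsto (fun j : ℕ => ∑' x : Δ, ε x * (x : ℝ) *
      (1 - (((x : ℝ) - x₀) / (2 * T + 1)) ^ 2) ^ j) atTop
      (𝓝 (∑' x : Δ, if x = x₀ then ε x₀ * (x₀ : ℝ) else 0)) := by
    have hr : ∀ x : Δ, (((x : ℝ) - x₀) / (2 * T + 1)) ^ 2 ≤ 1 := by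
      intro x
      rw [sq_le_one_iff_abs_le_one, abs_div, abs_of_pos (by positivity : 0 < 2 * T + 1),
        div_le_one (by positivity)]
      have h1 := abs_le_tsum_abs hΔ x
      have h2 := abs_le_tsum_abs hΔ x₀
      have h3 := abs_sub (x : ℝ) x₀
      linarith
    refine tendsto_tsum_of_dominated_convergence (bound := fun x : Δ => |(x : ℝ)|) hΔ
      (fun x => ?_) (Eventually.of_forall fun j x => ?_)
    · split_ifs with h
      · subst h
        simp
      · have h1 : 0 < (((x : ℝ) - x₀) / (2 * T + 1)) ^ 2 := by
          have : (x : ℝ) - x₀ ≠ 0 := sub_ne_zero.2 fun h' => h (Subtype.ext h')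
          positivity
        have h2 := (tendsto_pow_atTop_nhds_zero_of_lt_one (sub_nonneg.2 (hr x))
          (by linarith)).const_mul (ε x * (x : ℝ))
        rwa [mul_zero] at h2
    · rw [norm_mul, norm_mul, norm_pow, Real.norm_eq_abs, Real.norm_eq_abs, Real.norm_eq_abs,
        abs_of_nonneg (sub_nonneg.2 (hr x))]
      have h1 : (1 - (((x : ℝ) - x₀) / (2 * T + 1)) ^ 2) ^ j ≤ 1 :=
        pow_le_one₀ (sub_nonneg.2 (hr x)) (sub_le_self _ (sq_nonneg _))
      have h2 : 0 ≤ (1 - (((x : ℝ) - x₀) / (2 * T + 1)) ^ 2) ^ j :=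
        pow_nonneg (sub_nonneg.2 (hr x)) j
      calc |ε x| * |(x : ℝ)| * _ ≤ 1 * |(x : ℝ)| * 1 := by
            have := hε1 x
            gcongr
        _ = |(x : ℝ)| := by ring
  have hzero : ∀ j : ℕ, ∑' x : Δ, ε x * (x : ℝ) *
      (1 - (((x : ℝ) - x₀) / (2 * T + 1)) ^ 2) ^ j = 0 := by
    intro j
    have h1 := hpoly ((1 - (Polynomial.C (2 * T + 1)⁻¹ *
      (Polynomial.X - Polynomial.C (x₀ : ℝ))) ^ 2) ^ j)
    rw [← h1]
    refine tsum_congr fun x => ?_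
    simp only [Polynomial.eval_pow, Polynomial.eval_sub, Polynomial.eval_mul, Polynomial.eval_C,
      Polynomial.eval_X, Polynomial.eval_one]
    rw [div_eq_inv_mul]
  simp only [hzero] at hlim
  have h1 := tendsto_nhds_unique hlim tendsto_const_nhds
  rw [tsum_ite_eq] at h1
  have h2 : (x₀ : ℝ) ≠ 0 := fun h => h0 (h ▸ x₀.2)
  have h3 := (mul_eq_zero.1 h1).resolve_right h2
  simp only [hε] at h3
  cases hX : X x₀ <;> cases hY : Y x₀ <;> simp [hX, hY] at h3 <;> rfl

/-- Evaluation of symmetric functions at configurations. -/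
noncomputable def evalHom : SymFun →ₐ[ℂ] C(Config Δ, ℂ) :=
  MvPolynomial.aeval fun k => ⟨fun X => configSums X k,
    (continuous_apply k).comp (continuous_configSums hΔ)⟩

theorem evalHom_apply (F : SymFun) (X : Config Δ) : evalHom hΔ F X = F.evalConfig X := by
  have h : ((ContinuousMap.evalAlgHom ℂ ℂ X).comp (evalHom hΔ)) =
      MvPolynomial.aeval (configSums X) := by
    ext k
    simp [evalHom]
  exact DFunLike.congr_fun h F

/-- Stone–Weierstrass. The image is closed under conjugation because power sums of configurations
are real, so conjugating the coefficients conjugates the function. -/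
theorem topologicalClosure_range_evalHom (h0 : (0 : ℝ) ∉ Δ) :
    (LinearMap.range (evalHom hΔ).toLinearMap).topologicalClosure = ⊤ := by
  have hstar : ∀ F : SymFun, star (evalHom hΔ F) =
      evalHom hΔ (MvPolynomial.map (starRingEnd ℂ) F) := by
    intro F
    ext X
    rw [ContinuousMap.star_apply, evalHom_apply, evalHom_apply, evalConfig_eq, evalConfig_eq]
    induction F using MvPolynomial.induction_on with
    | C z => simp
    | add p r hp hr => simp only [map_add, star_add, hp, hr]
    | mul_X p i hp =>
      simp only [map_mul, MvPolynomial.aeval_X, MvPolynomial.map_X, star_mul', hp]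
      congr 1
      exact conj_configSums X i
  let A : StarSubalgebra ℂ C(Config Δ, ℂ) :=
    { (evalHom hΔ).range with
      star_mem' := by
        rintro _ ⟨F, rfl⟩
        exact ⟨_, (hstar F).symm⟩ }
  have hsep : A.SeparatesPoints := by
    intro X Y hXY
    by_contra h
    push Not at h
    refine hXY (configSums_injective hΔ h0 (funext fun k => ?_))
    have : evalHom hΔ (MvPolynomial.X k) X = evalHom hΔ (MvPolynomial.X k) Y :=
      h _ ⟨evalHom hΔ (MvPolynomial.X k), ⟨_, rfl⟩, rfl⟩
    rw [evalHom_apply, evalHom_apply, evalConfig_eq, evalConfig_eq, MvPolynomial.aeval_X,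
      MvPolynomial.aeval_X] at this
    exact this
  have h1 := ContinuousMap.starSubalgebra_topologicalClosure_eq_top_of_separatesPoints A hsep
  rw [eq_top_iff]
  intro f _
  have h2 : f ∈ A.topologicalClosure := by rw [h1]; trivial
  exact h2

end Grid


/-! ### Determining and convergence of measures by integrals -/

theorem norm_integral_le_of_forall_le {E : Type*} [MeasurableSpace E] {f : E → ℂ} {K : ℝ}
    (h : ∀ x, ‖f x‖ ≤ K) (P : ProbabilityMeasure E) : ‖∫ x, f x ∂(P : Measure E)‖ ≤ K := by
  have := norm_integral_le_of_norm_le_const (μ := (P : Measure E)) (Eventually.of_forall h)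
  simpa using this

section Limits

variable {E : Type*} [TopologicalSpace E] [CompactSpace E] [MeasurableSpace E] [BorelSpace E]

theorem ContinuousMap.integrable_probabilityMeasure (f : C(E, ℂ)) (P : ProbabilityMeasure E) :
    Integrable f (P : Measure E) :=
  Integrable.of_bound f.continuous.aestronglyMeasurable ‖f‖ (Eventually.of_forall f.norm_coe_le_norm)

/-- Integration of continuous functions against a probability measure. -/
noncomputable def integralFunctional (P : ProbabilityMeasure E) : C(E, ℂ) →L[ℂ] ℂ :=
  LinearMap.mkContinuous
    { toFun := fun f => ∫ x, f x ∂(P : Measure E)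
      map_add' := fun f g =>
        integral_add (f.integrable_probabilityMeasure P) (g.integrable_probabilityMeasure P)
      map_smul' := fun c f => integral_smul c _ } 1 fun f => by
    rw [one_mul]
    exact norm_integral_le_of_forall_le f.norm_coe_le_norm P

theorem integralFunctional_apply (P : ProbabilityMeasure E) (f : C(E, ℂ)) :
    integralFunctional P f = ∫ x, f x ∂(P : Measure E) := rfl

theorem tendsto_integral_continuousMap {ι : Type*} {F : Filter ι} {Q : ι → ProbabilityMeasure E}
    {P : ProbabilityMeasure E} (h : Tendsto Q F (𝓝 P)) (f : C(E, ℂ)) :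
    Tendsto (fun i => ∫ x, f x ∂(Q i : Measure E)) F (𝓝 (∫ x, f x ∂(P : Measure E))) :=
  (ProbabilityMeasure.tendsto_iff_forall_integral_rclike_tendsto ℂ).1 h
    (BoundedContinuousFunction.mkOfCompact f)

/-- By compactness of `E` the integrands converge uniformly, so the parameter can be frozen at its
limit even though the measures vary. -/
theorem tendsto_integral_param {A : Type*} [TopologicalSpace A] {f : A → E → ℂ}
    (hf : Continuous (Function.uncurry f)) {ι : Type*} {F : Filter ι} {z : ι → A} {z₀ : A}
    (hz : Tendsto z F (𝓝 z₀)) {Q : ι → ProbabilityMeasure E} {L : ℂ}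
    (h : Tendsto (fun i => ∫ x, f (z i) x ∂(Q i : Measure E)) F (𝓝 L)) :
    Tendsto (fun i => ∫ x, f z₀ x ∂(Q i : Measure E)) F (𝓝 L) := by
  have hc : ∀ y, Continuous (f y) := fun y => hf.comp (Continuous.prodMk_right y)
  have h1 : Tendsto (fun i => ∫ x, f z₀ x ∂(Q i : Measure E) -
      ∫ x, f (z i) x ∂(Q i : Measure E)) F (𝓝 0) := by
    refine Metric.tendsto_nhds.2 fun ε hε => ?_
    obtain ⟨v, hv, hv'⟩ := isCompact_univ.mem_uniformity_of_prod (s := Set.univ) (q := z₀)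
      hf.continuousOn (Set.mem_univ _) (Metric.dist_mem_uniformity (half_pos hε))
    rw [nhdsWithin_univ] at hv
    filter_upwards [hz hv] with i hi
    have hint : ∀ y, Integrable (f y) (Q i : Measure E) := fun y =>
      (⟨f y, hc y⟩ : C(E, ℂ)).integrable_probabilityMeasure (Q i)
    rw [dist_zero_right, ← integral_sub (hint z₀) (hint (z i))]
    refine (norm_integral_le_of_forall_le (K := ε / 2) (fun x => ?_) (Q i)).trans_lt
      (half_lt_self hε)
    have h2 : dist (f (z i) x) (f z₀ x) < ε / 2 := hv' (z i) hi x (Set.mem_univ x)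
    rw [dist_comm, dist_eq_norm] at h2
    exact h2.le
  simpa using h1.add h

variable [HasOuterApproxClosed E] {ι : Type*} {G : ι → C(E, ℂ)}
  (hG : (Submodule.span ℂ (Set.range G)).topologicalClosure = ⊤)

include hG

theorem probabilityMeasure_eq_of_integral_eq {P P' : ProbabilityMeasure E}
    (h : ∀ i, ∫ x, G i x ∂(P : Measure E) = ∫ x, G i x ∂(P' : Measure E)) : P = P' := by
  have h1 : integralFunctional P = integralFunctional P' := by
    refine ContinuousLinearMap.ext_on (s := Set.range G)
      (Submodule.dense_iff_topologicalClosure_eq_top.2 hG) ?_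
    rintro _ ⟨i, rfl⟩
    exact h i
  have h3 : (P : Measure E) = P' := ext_of_forall_integral_eq_of_IsFiniteMeasure fun f => ?_
  · exact Subtype.ext h3
  have h2 := DFunLike.congr_fun h1 ⟨fun x => (f x : ℂ), Complex.continuous_ofReal.comp f.continuous⟩
  simp only [integralFunctional_apply, ContinuousMap.coe_mk, integral_complex_ofReal] at h2
  exact_mod_cast h2

/-- Probability measures on a compact space have cluster points. Each cluster point has the
integrals `L i`, and density of the span makes it unique. -/
theorem exists_tendsto_of_tendsto_integral [T2Space E] {Q : ℕ → ProbabilityMeasure E} {L : ι → ℂ}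
    (h : ∀ i, Tendsto (fun k => ∫ x, G i x ∂(Q k : Measure E)) atTop (𝓝 (L i))) :
    ∃ P, Tendsto Q atTop (𝓝 P) := by
  have hcl : ∀ P, MapClusterPt P atTop Q → ∀ i, ∫ x, G i x ∂(P : Measure E) = L i := by
    intro P hP i
    have h1 : Continuous fun P : ProbabilityMeasure E => ∫ x, G i x ∂(P : Measure E) :=
      continuous_iff_continuousAt.2 fun P => tendsto_integral_continuousMap tendsto_id (G i)
    have h2 := hP.continuousAt_comp h1.continuousAt
    have h3 : ClusterPt _ (𝓝 (L i)) := ClusterPt.mono h2 (h i)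
    have := h3.neBot
    exact eq_of_nhds_neBot h3
  obtain ⟨P, hP⟩ := exists_clusterPt_of_compactSpace (map Q atTop)
  refine ⟨P, le_nhds_of_unique_clusterPt fun P' hP' => ?_⟩
  exact probabilityMeasure_eq_of_integral_eq hG fun i => by rw [hcl P hP, hcl P' hP']

end Limits


/-! ### Configurations of the `q`-Racah ensembles -/

/-- The point of the limit grid closest to `racahPoint q a b n t`. -/
noncomputable def gridPoint (q a b : ℝ) (n t : ℕ) : ℝ :=
  if 2 * t < n then q ^ (t + 1) / a else q ^ ((n : ℤ) - t) / b

open Classical in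
/-- The configuration of the points of the limit grid with indices `f j`. -/
noncomputable def gridConfig (q a b : ℝ) (n : ℕ) {N : ℕ} (f : Fin N → ℕ) :
    Config (bigQJacobiGrid q a b) :=
  fun y => decide (∃ j, gridPoint q a b n (f j) = y)

theorem gridPoint_mem (q a b : ℝ) {n t : ℕ} (h : t < n) :
    gridPoint q a b n t ∈ bigQJacobiGrid q a b := by
  rw [gridPoint]
  split_ifs
  · exact ⟨t, Or.inr (by rw [pow_succ]; ring)⟩
  · refine ⟨n - t - 1, Or.inl ?_⟩
    have h1 : q ^ ((n : ℤ) - t) = q ^ (n - t - 1) * q := by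
      rw [← pow_succ, ← zpow_natCast]
      congr 1
      omega
    rw [h1]; ring

theorem gridPoint_injOn {q a b : ℝ} (hq₀ : 0 < q) (hq₁ : q < 1) (ha : 0 < a) (hb : b < 0) (n : ℕ) :
    Function.Injective (gridPoint q a b n) := by
  intro s t h
  have hpos : ∀ s : ℕ, 0 < q ^ (s + 1) / a := fun s => div_pos (pow_pos hq₀ _) ha
  have hneg : ∀ s : ℕ, q ^ ((n : ℤ) - s) / b < 0 := fun s =>
    div_neg_of_pos_of_neg (zpow_pos hq₀ _) hb
  rw [gridPoint, gridPoint] at h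
  split_ifs at h
  · have h1 := (div_left_inj' ha.ne').1 h
    have := pow_right_injective₀ hq₀ hq₁.ne h1
    omega
  · linarith [hpos s, hneg t]
  · linarith [hpos t, hneg s]
  · have h1 := (div_left_inj' hb.ne).1 h
    have := zpow_right_injective₀ hq₀ hq₁.ne h1
    omega

theorem configSums_gridConfig {q a b : ℝ} (hq₀ : 0 < q) (hq₁ : q < 1) (ha : 0 < a) (hb : b < 0)
    {n N : ℕ} {f : Fin N → ℕ} (hf : Function.Injective f) (hfn : ∀ j, f j < n) :
    configSums (gridConfig q a b n f) = psums fun j => (gridPoint q a b n (f j) : ℂ) := by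
  classical
  funext k
  set e : Fin N → bigQJacobiGrid q a b := fun j =>
    ⟨gridPoint q a b n (f j), gridPoint_mem q a b (hfn j)⟩ with he
  have hinj : Function.Injective e := fun i j h =>
    hf (gridPoint_injOn hq₀ hq₁ ha hb n (congrArg Subtype.val h))
  have h1 : ∀ y : bigQJacobiGrid q a b, gridConfig q a b n f y = true ↔ ∃ j, e j = y := by
    intro y
    simp [gridConfig, he, Subtype.ext_iff]
  rw [configSums, tsum_eq_sum (s := Finset.univ.image e), Finset.sum_image hinj.injOn, psums]
  · refine Finset.sum_congr rfl fun j _ => ?_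
    rw [if_pos ((h1 _).2 ⟨j, rfl⟩)]
  · intro y hy
    rw [if_neg]
    rw [h1]
    rintro ⟨j, hj⟩
    exact hy (Finset.mem_image.2 ⟨j, Finset.mem_univ _, hj⟩)

/-- The point is a sum of $q^{t+1}/a$ and $q^{n-t}/b$. Their product is $O(q^n)$, which handles the
cross terms, and the summand discarded by `gridPoint` is $O(q^{n/2})$. -/
theorem norm_racahPoint_pow_sub_le {q : ℝ} (hq₀ : 0 < q) (hq₁ : q < 1) (a b : ℝ) (k : ℕ) :
    ∃ C : ℝ, 0 ≤ C ∧ ∀ n t : ℕ, t < n →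
      ‖(racahPoint q a b n t : ℂ) ^ (k + 1) - (gridPoint q a b n t : ℂ) ^ (k + 1)‖ ≤
        C * √q ^ n := by
  set K : ℝ := |a⁻¹| + |b⁻¹| with hK
  have hK0 : 0 ≤ K := by positivity
  obtain ⟨D, hD0, hD⟩ := norm_add_pow_sub_le k K
  have hr0 : 0 < √q := Real.sqrt_pos.2 hq₀
  have hr1 : √q ≤ 1 := Real.sqrt_le_one.2 hq₁.le
  have hrq : ∀ m n : ℕ, n ≤ 2 * m → q ^ m ≤ √q ^ n := by
    intro m n h
    have h1 : q ^ m = √q ^ (2 * m) := by rw [pow_mul, Real.sq_sqrt hq₀.le]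
    rw [h1]
    exact pow_le_pow_of_le_one hr0.le hr1 h
  refine ⟨D * K ^ 2 + K ^ k * K, by positivity, fun n t ht => ?_⟩
  obtain ⟨m, rfl⟩ : ∃ m, n = t + m := ⟨n - t, by omega⟩
  have hz : q ^ (((t + m : ℕ) : ℤ) - t) = q ^ m := by
    rw [← zpow_natCast]
    congr 1
    push_cast; ring
  set u : ℝ := q ^ (t + 1) / a with hu
  set v : ℝ := q ^ m / b with hv
  have hau : |u| = q ^ (t + 1) * |a⁻¹| := by
    rw [hu, div_eq_mul_inv, abs_mul, abs_of_pos (pow_pos hq₀ _)]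
  have hav : |v| = q ^ m * |b⁻¹| := by
    rw [hv, div_eq_mul_inv, abs_mul, abs_of_pos (pow_pos hq₀ _)]
  have hq1 : ∀ m : ℕ, q ^ m ≤ 1 := fun m => pow_le_one₀ hq₀.le hq₁.le
  have hqp : ∀ m : ℕ, 0 < q ^ m := fun m => pow_pos hq₀ m
  have haK : |a⁻¹| ≤ K := le_add_of_nonneg_right (abs_nonneg _)
  have hbK : |b⁻¹| ≤ K := le_add_of_nonneg_left (abs_nonneg _)
  have huK : |u| ≤ q ^ (t + 1) * K := by rw [hau]; gcongr
  have hvK : |v| ≤ q ^ m * K := by rw [hav]; gcongr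
  have huK' : |u| ≤ K := huK.trans (mul_le_of_le_one_left hK0 (hq1 _))
  have hvK' : |v| ≤ K := hvK.trans (mul_le_of_le_one_left hK0 (hq1 _))
  have hx : (racahPoint q a b (t + m) t : ℂ) = (u : ℂ) + v := by
    rw [racahPoint, hz, ← hu, ← hv]
    push_cast; rfl
  have hnu : ‖(u : ℂ)‖ = |u| := by rw [Complex.norm_real, Real.norm_eq_abs]
  have hnv : ‖(v : ℂ)‖ = |v| := by rw [Complex.norm_real, Real.norm_eq_abs]
  have h1 : ‖(racahPoint q a b (t + m) t : ℂ) ^ (k + 1) - ((u : ℂ) ^ (k + 1) + (v : ℂ) ^ (k + 1))‖ ≤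
      D * K ^ 2 * √q ^ (t + m) := by
    rw [hx]
    refine (hD u v (by rwa [hnu]) (by rwa [hnv])).trans ?_
    rw [norm_mul, hnu, hnv, mul_assoc]
    refine mul_le_mul_of_nonneg_left ?_ hD0
    calc |u| * |v| ≤ (q ^ (t + 1) * K) * (q ^ m * K) :=
          mul_le_mul huK hvK (abs_nonneg _) (by positivity)
      _ = K ^ 2 * q ^ (t + 1 + m) := by rw [pow_add q (t + 1) m]; ring
      _ ≤ K ^ 2 * √q ^ (t + m) :=
          mul_le_mul_of_nonneg_left (hrq _ _ (by omega)) (sq_nonneg _)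
  have hpow : ∀ (y : ℝ) (m' : ℕ), |y| ≤ K → |y| ≤ q ^ m' * K → t + m ≤ 2 * m' →
      ‖(y : ℂ) ^ (k + 1)‖ ≤ K ^ k * K * √q ^ (t + m) := by
    intro y m' h2 h3 h4
    rw [norm_pow, Complex.norm_real, Real.norm_eq_abs, pow_succ]
    calc |y| ^ k * |y| ≤ K ^ k * (q ^ m' * K) := by gcongr
      _ ≤ K ^ k * (√q ^ (t + m) * K) := by
          have := hrq _ _ h4
          gcongr
      _ = _ := by ring
  have h2 : ‖((u : ℂ) ^ (k + 1) + (v : ℂ) ^ (k + 1)) -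
      (gridPoint q a b (t + m) t : ℂ) ^ (k + 1)‖ ≤ K ^ k * K * √q ^ (t + m) := by
    rw [gridPoint, hz]
    split_ifs with h
    · rw [add_sub_cancel_left]
      exact hpow v m hvK' hvK (by omega)
    · rw [add_sub_cancel_right]
      exact hpow u (t + 1) huK' huK (by omega)
  have h3 := norm_sub_le_norm_sub_add_norm_sub
    ((racahPoint q a b (t + m) t : ℂ) ^ (k + 1)) ((u : ℂ) ^ (k + 1) + (v : ℂ) ^ (k + 1))
    ((gridPoint q a b (t + m) t : ℂ) ^ (k + 1))
  linarith

theorem norm_psums_sub_le {q : ℝ} (hq₀ : 0 < q) (hq₁ : q < 1) (a b : ℝ) (k : ℕ) :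
    ∃ C : ℝ, 0 ≤ C ∧ ∀ (M N : ℕ) (f : Fin N → ℕ), (∀ j, f j < N + 2 * M) →
      ‖psums (fun j => (racahPoint q a b (N + 2 * M) (f j) : ℂ)) k -
        psums (fun j => (gridPoint q a b (N + 2 * M) (f j) : ℂ)) k‖ ≤ C * (N * √q ^ N) := by
  obtain ⟨C, hC0, hC⟩ := norm_racahPoint_pow_sub_le hq₀ hq₁ a b k
  refine ⟨C, hC0, fun M N f hf => ?_⟩
  rw [psums, psums, ← Finset.sum_sub_distrib]
  refine (norm_sum_le _ _).trans ?_
  refine (Finset.sum_le_card_nsmul _ _ (C * √q ^ N) fun j _ => ?_).trans ?_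
  · refine (hC _ _ (hf j)).trans (mul_le_mul_of_nonneg_left ?_ hC0)
    exact pow_le_pow_of_le_one (Real.sqrt_nonneg q) (Real.sqrt_le_one.2 hq₁.le) (by omega)
  · rw [Finset.card_univ, Fintype.card_fin, nsmul_eq_mul]
    exact le_of_eq (by ring)

section Limit

variable {q a b : ℝ} {c d : ℂ} (hq₀ : 0 < q) (hq₁ : q < 1) (H : RacahPositive q a b c d)

include hq₀ hq₁ H

theorem RacahPositive.summable : Summable fun x : bigQJacobiGrid q a b => |(x : ℝ)| :=
  summable_doubleGrid hq₀ hq₁ (mul_ne_zero (inv_ne_zero H.hb.ne) hq₀.ne')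
    (mul_ne_zero (inv_ne_zero H.ha.ne') hq₀.ne')

omit hq₁ in
theorem RacahPositive.zero_notMem : (0 : ℝ) ∉ bigQJacobiGrid q a b := by
  rintro ⟨n, h | h⟩
  · exact mul_ne_zero (mul_ne_zero (inv_ne_zero H.hb.ne) hq₀.ne') (pow_ne_zero _ hq₀.ne') h.symm
  · exact mul_ne_zero (mul_ne_zero (inv_ne_zero H.ha.ne') hq₀.ne') (pow_ne_zero _ hq₀.ne') h.symm

/-- The functions `scaledFun` on the space of configurations. -/
noncomputable def scaledMap (δ : ℂ) (l : YoungDiagram) : C(Config (bigQJacobiGrid q a b), ℂ) :=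
  evalHom (H.summable hq₀ hq₁) (scaledFun q a b c d δ l)

theorem scaledMap_apply (δ : ℂ) (l : YoungDiagram) (X : Config (bigQJacobiGrid q a b)) :
    scaledMap hq₀ hq₁ H δ l X =
      jtComb l (scaledCoef q a b c d δ l) (limitNodeSums q c δ) (configSums X) := by
  rw [scaledMap, evalHom_apply, evalConfig_eq, aeval_scaledFun]

theorem scaledMap_bot (δ : ℂ) : scaledMap hq₀ hq₁ H δ ⊥ = 1 := by
  rw [scaledMap, scaledFun_bot, map_one]

theorem span_scaledMap (δ : ℂ) :
    (Submodule.span ℂ (Set.range (scaledMap hq₀ hq₁ H δ))).topologicalClosure = ⊤ := by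
  have h1 : Set.range (scaledMap hq₀ hq₁ H δ) =
      (evalHom (H.summable hq₀ hq₁)).toLinearMap '' Set.range (scaledFun q a b c d δ) := by
    rw [← Set.range_comp]
    rfl
  rw [h1, Submodule.span_image, span_scaledFun, Submodule.map_top]
  exact topologicalClosure_range_evalHom _ (H.zero_notMem hq₀)

end Limit


/-! ### The limit of the `q`-Racah ensembles -/

theorem jtComb_congr {l : YoungDiagram} {κ κ' : YoungDiagram → ℂ} (h : ∀ m ≤ l, κ m = κ' m)
    (τ : ℤ → ℕ → ℂ) (P : ℕ → ℂ) : jtComb l κ τ P = jtComb l κ' τ P :=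
  Finset.sum_congr rfl fun m hm => by
    rw [h m (by simpa using hm)]

/-- The product of two combinations of interpolation functions at perturbed power sums. -/
noncomputable def jtProd {Δ : Set ℝ} (l m : YoungDiagram)
    (z : (YoungDiagram → ℂ) × (YoungDiagram → ℂ) × (ℤ → ℕ → ℂ) × (ℕ → ℂ)) (X : Config Δ) : ℂ :=
  jtComb l z.1 z.2.2.1 (z.2.2.2 + configSums X) *
    (starRingEnd ℂ) (jtComb m z.2.1 z.2.2.1 (z.2.2.2 + configSums X))

theorem continuous_jtProd {Δ : Set ℝ} (hΔ : Summable fun x : Δ => |(x : ℝ)|)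
    (l m : YoungDiagram) : Continuous (Function.uncurry (jtProd (Δ := Δ) l m)) := by
  have hX := continuous_configSums hΔ
  have h1 : Continuous fun y : ((YoungDiagram → ℂ) × (YoungDiagram → ℂ) × (ℤ → ℕ → ℂ) ×
      (ℕ → ℂ)) × Config Δ => y.1.2.2.2 + configSums y.2 :=
    (continuous_fst.snd.snd.snd).add (hX.comp continuous_snd)
  have h2 := Continuous.comp' (continuous_jtComb l)
    ((continuous_fst.fst).prodMk ((continuous_fst.snd.snd.fst).prodMk h1))
  have h3 := Continuous.comp' (continuous_jtComb m)
    ((continuous_fst.snd.fst).prodMk ((continuous_fst.snd.snd.fst).prodMk h1))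
  exact h2.mul (Complex.continuous_conj.comp h3)

open Classical in
/-- The correction factors, extended by `1`. -/
noncomputable def correctedCoef (q a b : ℝ) (c d δ : ℂ) (N : ℕ) (l m : YoungDiagram) : ℂ :=
  (if m ≤ l then racahCorrection q N l m else 1) * scaledCoef q a b c d δ l m

theorem tendsto_correctedCoef {q : ℝ} (hq₀ : 0 < q) (hq₁ : q < 1) (a b : ℝ) (c d δ : ℂ)
    (l : YoungDiagram) : Tendsto (fun N => correctedCoef q a b c d δ N l) atTop
      (𝓝 (scaledCoef q a b c d δ l)) := by
  classical
  refine tendsto_pi_nhds.2 fun m => ?_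
  have h1 : Tendsto (fun N => if m ≤ l then racahCorrection q N l m else 1) atTop (𝓝 1) := by
    split_ifs with h
    · exact tendsto_racahCorrection hq₀ hq₁ h
    · exact tendsto_const_nhds
  simpa [correctedCoef] using h1.mul_const (scaledCoef q a b c d δ l m)

theorem racahMulti_eq (q a b : ℝ) (c d δ : ℂ) (N : ℕ) (l : YoungDiagram) (P : ℕ → ℂ) :
    racahMulti q a b c d δ N l P = jtComb l (correctedCoef q a b c d δ N l)
      (fun e k => nodeSums (racahNode q c δ N) N e k) P :=
  jtComb_congr (fun m hm => by rw [correctedCoef, if_pos hm]) _ _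

section Limit

variable {q a b : ℝ} {c d : ℂ} (hq₀ : 0 < q) (hq₁ : q < 1) (H : RacahPositive q a b c d)

include hq₀ hq₁ H

-- Replacing finite grid points by limit grid points, finite node sums by their limits and the
-- correction factors by $1$ changes the integrands by a uniformly small amount. The exact
-- orthogonality relations thus become relations in the limit.
open Classical in
theorem tendsto_sum_racah_ensemble (M : ℕ) {W : ∀ N : ℕ, (Fin N → ℕ) → ℝ}
    (hW0 : ∀ N, ∀ f ∈ Fintype.piFinset fun _ => Finset.range (N + 2 * M), 0 ≤ W N f)
    (hW1 : ∀ N, ∑ f ∈ Fintype.piFinset fun _ => Finset.range (N + 2 * M), W N f = 1)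
    (hWinj : ∀ N f, ¬ Function.Injective f → W N f = 0)
    (hWorth : ∀ N, ∀ l m : YoungDiagram, l.colLen 0 + 1 ≤ N → m.colLen 0 + 1 ≤ N →
        ∑ f ∈ Fintype.piFinset fun _ => Finset.range (N + 2 * M), (W N f : ℂ) *
          (racahMulti q a b c d (deltaPar q a b M) N l
              (psums fun j => (racahPoint q a b (N + 2 * M) (f j) : ℂ)) *
            (starRingEnd ℂ) (racahMulti q a b c d (deltaPar q a b M) N m
              (psums fun j => (racahPoint q a b (N + 2 * M) (f j) : ℂ)))) =
          if l = m then racahMultiNorm q a b c d (deltaPar q a b M) N l else 0)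
    (l m : YoungDiagram) :
    Tendsto (fun N => ∑ f ∈ Fintype.piFinset fun _ : Fin N => Finset.range (N + 2 * M),
      (W N f : ℂ) * (scaledMap hq₀ hq₁ H (deltaPar q a b M) l (gridConfig q a b (N + 2 * M) f) *
        (starRingEnd ℂ) (scaledMap hq₀ hq₁ H (deltaPar q a b M) m
          (gridConfig q a b (N + 2 * M) f)))) atTop
      (𝓝 (if l = m then limitNorm q a b c d (deltaPar q a b M) l else 0)) := by
  set δ : ℂ := (deltaPar q a b M : ℂ)
  -- A filter on pairs $(N,f)$ in which $N\to\infty$ and $f$ is any admissible tuple. Convergence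
  -- along it is uniform in $f$.
  set L : Filter (Σ N : ℕ, (Fin N → ℕ)) :=
    comap Sigma.fst atTop ⊓ 𝓟 {p | ∀ j, p.2 j < p.1 + 2 * M} with hL
  have hLfst : Tendsto (Sigma.fst : (Σ N : ℕ, (Fin N → ℕ)) → ℕ) L atTop :=
    tendsto_comap.mono_left inf_le_left
  set err : (Σ N : ℕ, (Fin N → ℕ)) → ℕ → ℂ := fun p =>
    (psums fun j => (racahPoint q a b (p.1 + 2 * M) (p.2 j) : ℂ)) -
      psums fun j => (gridPoint q a b (p.1 + 2 * M) (p.2 j) : ℂ) with herr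
  have herr0 : Tendsto err L (𝓝 0) := by
    refine tendsto_pi_nhds.2 fun k => ?_
    obtain ⟨C, hC0, hC⟩ := norm_psums_sub_le hq₀ hq₁ a b k
    have h1 : Tendsto (fun N : ℕ => C * (N * √q ^ N)) atTop (𝓝 0) := by
      have := (tendsto_self_mul_const_pow_of_lt_one (Real.sqrt_nonneg q)
        ((Real.sqrt_lt' one_pos).2 (by simpa using hq₁))).const_mul C
      rwa [mul_zero] at this
    refine squeeze_zero_norm' ?_ (h1.comp hLfst)
    refine eventually_inf_principal.2 (Eventually.of_forall fun p hp => ?_)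
    exact hC M p.1 p.2 hp
  set z : (Σ N : ℕ, (Fin N → ℕ)) →
      (YoungDiagram → ℂ) × (YoungDiagram → ℂ) × (ℤ → ℕ → ℂ) × (ℕ → ℂ) := fun p =>
    (correctedCoef q a b c d δ p.1 l, correctedCoef q a b c d δ p.1 m,
      fun e k => nodeSums (racahNode q c δ p.1) p.1 e k, err p) with hz
  set z₀ : (YoungDiagram → ℂ) × (YoungDiagram → ℂ) × (ℤ → ℕ → ℂ) × (ℕ → ℂ) :=
    (scaledCoef q a b c d δ l, scaledCoef q a b c d δ m, limitNodeSums q c δ, 0)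
  have hzlim : Tendsto z L (𝓝 z₀) := by
    have hτ : Tendsto (fun N : ℕ => fun (e : ℤ) (k : ℕ) => nodeSums (racahNode q c δ N) N e k)
        atTop (𝓝 (limitNodeSums q c δ)) :=
      tendsto_pi_nhds.2 fun e => tendsto_pi_nhds.2 fun k => tendsto_nodeSums hq₀ hq₁ c δ e k
    exact ((tendsto_correctedCoef hq₀ hq₁ a b c d δ l).comp hLfst).prodMk_nhds
      (((tendsto_correctedCoef hq₀ hq₁ a b c d δ m).comp hLfst).prodMk_nhds
        ((hτ.comp hLfst).prodMk_nhds herr0))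
  have hz0 : ∀ X : Config (bigQJacobiGrid q a b), jtProd l m z₀ X =
      scaledMap hq₀ hq₁ H δ l X * (starRingEnd ℂ) (scaledMap hq₀ hq₁ H δ m X) := by
    intro X
    rw [scaledMap_apply, scaledMap_apply, jtProd, zero_add]
  have hzN : ∀ (N : ℕ) (f : Fin N → ℕ), Function.Injective f → (∀ j, f j < N + 2 * M) →
      jtProd l m (z ⟨N, f⟩) (gridConfig q a b (N + 2 * M) f) =
        racahMulti q a b c d δ N l (psums fun j => (racahPoint q a b (N + 2 * M) (f j) : ℂ)) *
          (starRingEnd ℂ) (racahMulti q a b c d δ N m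
            (psums fun j => (racahPoint q a b (N + 2 * M) (f j) : ℂ))) := by
    intro N f hf hfn
    rw [racahMulti_eq, racahMulti_eq, jtProd,
      configSums_gridConfig hq₀ hq₁ H.ha H.hb hf hfn]
    simp only [hz, herr, sub_add_cancel]
  have hnorm : Tendsto (fun N => if l = m then racahMultiNorm q a b c d δ N l else 0) atTop
      (𝓝 (if l = m then limitNorm q a b c d δ l else 0)) := by
    split_ifs
    · exact tendsto_racahMultiNorm hq₀ hq₁ a b c d δ l
    · exact tendsto_const_nhds
  have hdiff : Tendsto (fun N => (∑ f ∈ Fintype.piFinset fun _ : Fin N =>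
      Finset.range (N + 2 * M), (W N f : ℂ) *
        (scaledMap hq₀ hq₁ H δ l (gridConfig q a b (N + 2 * M) f) *
          (starRingEnd ℂ) (scaledMap hq₀ hq₁ H δ m (gridConfig q a b (N + 2 * M) f)))) -
      if l = m then racahMultiNorm q a b c d δ N l else 0) atTop (𝓝 0) := by
    refine Metric.tendsto_nhds.2 fun ε hε => ?_
    -- Compactness of the configuration space gives one neighbourhood of the limiting parameters
    -- that works for all configurations.
    obtain ⟨v, hv, hv'⟩ := isCompact_univ.mem_uniformity_of_prod (s := Set.univ) (q := z₀)
      (continuous_jtProd (H.summable hq₀ hq₁) l m).continuousOn (Set.mem_univ _)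
      (Metric.dist_mem_uniformity (half_pos hε))
    rw [nhdsWithin_univ] at hv
    have hev := eventually_comap.1 (eventually_inf_principal.1 (hzlim hv))
    filter_upwards [hev, eventually_ge_atTop (l.colLen 0 + 1),
      eventually_ge_atTop (m.colLen 0 + 1)] with N hN hl hm
    rw [dist_zero_right, ← hWorth N l m hl hm, ← Finset.sum_sub_distrib]
    refine (norm_sum_le _ _).trans_lt ?_
    have hle : ∀ f ∈ Fintype.piFinset fun _ : Fin N => Finset.range (N + 2 * M),
        ‖(W N f : ℂ) * (scaledMap hq₀ hq₁ H δ l (gridConfig q a b (N + 2 * M) f) *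
          (starRingEnd ℂ) (scaledMap hq₀ hq₁ H δ m (gridConfig q a b (N + 2 * M) f))) -
        (W N f : ℂ) * (racahMulti q a b c d δ N l
              (psums fun j => (racahPoint q a b (N + 2 * M) (f j) : ℂ)) *
            (starRingEnd ℂ) (racahMulti q a b c d δ N m
              (psums fun j => (racahPoint q a b (N + 2 * M) (f j) : ℂ))))‖ ≤ W N f * (ε / 2) := by
      intro f hf
      have hfn : ∀ j, f j < N + 2 * M := fun j =>
        Finset.mem_range.1 (Fintype.mem_piFinset.1 hf j)
      by_cases hinj : Function.Injective f
      · rw [← mul_sub, norm_mul, Complex.norm_real, Real.norm_of_nonneg (hW0 N f hf),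
          ← hz0, ← hzN N f hinj hfn]
        refine mul_le_mul_of_nonneg_left ?_ (hW0 N f hf)
        have h2 : dist (jtProd l m (z ⟨N, f⟩) (gridConfig q a b (N + 2 * M) f))
            (jtProd l m z₀ (gridConfig q a b (N + 2 * M) f)) < ε / 2 :=
          hv' (z ⟨N, f⟩) (hN ⟨N, f⟩ rfl hfn) _ (Set.mem_univ _)
        rw [dist_comm, dist_eq_norm] at h2
        exact h2.le
      -- A configuration does not record multiplicities, so tuples with repetitions could not be
      -- compared; they carry no weight.
      · simp [hWinj N f hinj]
    refine (Finset.sum_le_sum hle).trans_lt ?_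
    rw [← Finset.sum_mul, hW1, one_mul]
    exact half_lt_self hε
  have := hdiff.add hnorm
  simpa using this

-- The passage $N\to\infty$ at fixed $M$. Relations against $\Phi_\emptyset=1$ already force weak
-- convergence of the ensembles, and the remaining relations then pass to the limit.
open Classical in
theorem exists_scaled_measure (M : ℕ) :
    ∃ Q : ProbabilityMeasure (Config (bigQJacobiGrid q a b)), ∀ l m : YoungDiagram,
      ∫ X, scaledMap hq₀ hq₁ H (deltaPar q a b M) l X *
        (starRingEnd ℂ) (scaledMap hq₀ hq₁ H (deltaPar q a b M) m X)
          ∂(Q : Measure (Config (bigQJacobiGrid q a b))) =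
        if l = m then limitNorm q a b c d (deltaPar q a b M) l else 0 := by
  choose W hW0 hW1 hWinj hWorth using exists_racah_ensemble hq₀ hq₁ H M
  have hlim := tendsto_sum_racah_ensemble hq₀ hq₁ H M hW0 hW1 hWinj hWorth
  set δ : ℂ := (deltaPar q a b M : ℂ)
  set G : ∀ N, Finset (Fin N → ℕ) := fun N => Fintype.piFinset fun _ => Finset.range (N + 2 * M)
  set μ : ℕ → Measure (Config (bigQJacobiGrid q a b)) := fun N => ∑ f ∈ G N,
    ENNReal.ofReal (W N f) • Measure.dirac (gridConfig q a b (N + 2 * M) f) with hμ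
  have hprob : ∀ N, IsProbabilityMeasure (μ N) := by
    intro N
    constructor
    simp only [hμ, Measure.coe_finsetSum, Finset.sum_apply, Measure.smul_apply, measure_univ,
      smul_eq_mul, mul_one]
    rw [← ENNReal.ofReal_sum_of_nonneg (hW0 N), hW1, ENNReal.ofReal_one]
  set Q : ℕ → ProbabilityMeasure (Config (bigQJacobiGrid q a b)) := fun N => ⟨μ N, hprob N⟩
  have hint : ∀ (F : C(Config (bigQJacobiGrid q a b), ℂ)) N,
      ∫ X, F X ∂(Q N : Measure (Config (bigQJacobiGrid q a b))) =
        ∑ f ∈ G N, (W N f : ℂ) * F (gridConfig q a b (N + 2 * M) f) := by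
    intro F N
    have h1 : ((Q N : Measure (Config (bigQJacobiGrid q a b)))) = μ N := rfl
    rw [h1, hμ, integral_finsetSum_measure]
    · refine Finset.sum_congr rfl fun f hf => ?_
      rw [integral_smul_measure, integral_dirac, ENNReal.toReal_ofReal (hW0 N f hf),
        Complex.real_smul]
    · intro f _
      refine Integrable.smul_measure ?_ ENNReal.ofReal_ne_top
      exact F.integrable_probabilityMeasure ⟨Measure.dirac _, inferInstance⟩
  set Φ := scaledMap hq₀ hq₁ H δ
  have hlim' : ∀ l m, Tendsto (fun N => ∫ X, (Φ l * star (Φ m)) X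
      ∂(Q N : Measure (Config (bigQJacobiGrid q a b)))) atTop
      (𝓝 (if l = m then limitNorm q a b c d δ l else 0)) := by
    intro l m
    simp only [hint]
    exact hlim l m
  obtain ⟨P, hP⟩ := exists_tendsto_of_tendsto_integral (span_scaledMap hq₀ hq₁ H δ) (Q := Q)
    (L := fun l => if l = ⊥ then limitNorm q a b c d δ l else 0) fun l => by
      have := hlim' l ⊥
      simpa [Φ, scaledMap_bot] using this
  refine ⟨P, fun l m => ?_⟩
  exact tendsto_nhds_unique (tendsto_integral_continuousMap hP (Φ l * star (Φ m))) (hlim' l m)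

end Limit


/-! ### The limit measure -/

theorem tendsto_deltaPar {q : ℝ} (hq₀ : 0 < q) (hq₁ : q < 1) (a b : ℝ) :
    Tendsto (fun M => (deltaPar q a b M : ℂ)) atTop (𝓝 0) := by
  have h1 : Tendsto (fun M : ℕ => q ^ (2 * M + 2)) atTop (𝓝 0) :=
    (tendsto_pow_atTop_nhds_zero_of_lt_one hq₀.le hq₁).comp
      (tendsto_atTop_mono (fun M => by omega : ∀ M : ℕ, M ≤ 2 * M + 2) tendsto_id)
  have h2 := h1.div_const (-(a * b))
  rw [zero_div] at h2
  have h3 := (Complex.continuous_ofReal.tendsto 0).comp h2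
  rwa [Complex.ofReal_zero] at h3

theorem continuous_scaledCoef (q a b : ℝ) (c d : ℂ) (l : YoungDiagram) :
    Continuous fun δ => scaledCoef q a b c d δ l := by
  refine continuous_pi fun m => continuous_const.mul ?_
  exact (continuous_racahDet q (c / a * q) (c / b * q) (q ^ 2 * (c * d / (a * b))) l m).comp
    ((continuous_neg.mul continuous_const).mul continuous_const)

theorem continuous_limitNodeSums (q : ℝ) (c : ℂ) : Continuous fun δ => limitNodeSums q c δ := by
  refine continuous_pi fun e => continuous_pi fun k => ?_
  unfold limitNodeSums
  fun_prop

theorem limitNorm_bot (q a b : ℝ) (c d δ : ℂ) : limitNorm q a b c d δ ⊥ = 1 := by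
  have h0 : (⊥ : YoungDiagram).colLen 0 = 0 := by
    by_contra h
    exact YoungDiagram.notMem_bot _ (YoungDiagram.mem_iff_lt_colLen.2 (Nat.pos_of_ne_zero h))
  rw [limitNorm, h0, Finset.prod_range_zero]

section Limit

variable {q a b : ℝ} {c d : ℂ} (hq₀ : 0 < q) (hq₁ : q < 1) (H : RacahPositive q a b c d)

include hq₀ hq₁ H

-- The passage $M\to\infty$. Coefficients, node sums and norms are continuous at $\delta=0$, and all
-- the measures live on the same compact space, so the existence of the limit measure and the
-- convergence to it come together.
open Classical in
theorem exists_limit_measure {Q : ℕ → ProbabilityMeasure (Config (bigQJacobiGrid q a b))}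
    (hQ : ∀ (M : ℕ) (l m : YoungDiagram),
      ∫ X, scaledMap hq₀ hq₁ H (deltaPar q a b M) l X *
        (starRingEnd ℂ) (scaledMap hq₀ hq₁ H (deltaPar q a b M) m X)
          ∂(Q M : Measure (Config (bigQJacobiGrid q a b))) =
        if l = m then limitNorm q a b c d (deltaPar q a b M) l else 0) :
    ∃ P : ProbabilityMeasure (Config (bigQJacobiGrid q a b)), Tendsto Q atTop (𝓝 P) ∧
      ∀ l m : YoungDiagram, ∫ X, scaledMap hq₀ hq₁ H 0 l X *
        (starRingEnd ℂ) (scaledMap hq₀ hq₁ H 0 m X)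
          ∂(P : Measure (Config (bigQJacobiGrid q a b))) =
        if l = m then limitNorm q a b c d 0 l else 0 := by
  have hδ := tendsto_deltaPar hq₀ hq₁ a b
  set Φ := scaledMap hq₀ hq₁ H 0
  have hlim : ∀ l m, Tendsto (fun M => ∫ X, (Φ l * star (Φ m)) X
      ∂(Q M : Measure (Config (bigQJacobiGrid q a b)))) atTop
      (𝓝 (if l = m then limitNorm q a b c d 0 l else 0)) := by
    intro l m
    set z : ℂ → (YoungDiagram → ℂ) × (YoungDiagram → ℂ) × (ℤ → ℕ → ℂ) × (ℕ → ℂ) := fun δ =>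
      (scaledCoef q a b c d δ l, scaledCoef q a b c d δ m, limitNodeSums q c δ, 0) with hz
    have hzc : Continuous z := (continuous_scaledCoef q a b c d l).prodMk
      ((continuous_scaledCoef q a b c d m).prodMk
        ((continuous_limitNodeSums q c).prodMk continuous_const))
    have hzX : ∀ δ (X : Config (bigQJacobiGrid q a b)), jtProd l m (z δ) X =
        scaledMap hq₀ hq₁ H δ l X * (starRingEnd ℂ) (scaledMap hq₀ hq₁ H δ m X) := by
      intro δ X
      rw [scaledMap_apply, scaledMap_apply, jtProd, zero_add]
    have h1 := tendsto_integral_param (continuous_jtProd (H.summable hq₀ hq₁) l m)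
      (z := fun M => z (deltaPar q a b M)) (z₀ := z 0) (Q := Q)
      (L := if l = m then limitNorm q a b c d 0 l else 0) ((hzc.tendsto 0).comp hδ) (by
        simp only [hzX, hQ]
        split_ifs
        · exact ((continuous_limitNorm q a b c d l).tendsto 0).comp hδ
        · exact tendsto_const_nhds)
    simp only [hzX] at h1
    exact h1
  obtain ⟨P, hP⟩ := exists_tendsto_of_tendsto_integral (span_scaledMap hq₀ hq₁ H 0) (Q := Q)
    (L := fun l => if l = ⊥ then limitNorm q a b c d 0 l else 0) fun l => by
      have := hlim l ⊥
      simpa [Φ, scaledMap_bot] using this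
  exact ⟨P, hP, fun l m =>
    tendsto_nhds_unique (tendsto_integral_continuousMap hP (Φ l * star (Φ m))) (hlim l m)⟩

end Limit

/-! ### Big `q`-Jacobi symmetric functions -/

/-- Dilation by $c$ moves the type A nodes $q^k$ to $c^{-1}q^k$ at the cost of $c^{|\mu|}$, and at
$\delta=0$ one of the Pochhammer symbols of the $q$-Racah coefficient is identically $1$. -/
theorem aeval_bigQJacobiFun {q : ℝ} (hq₀ : 0 < q) (hq₁ : q < 1) (a b : ℝ) {c : ℂ} (hc : c ≠ 0)
    (d : ℂ) (l : YoungDiagram) (P : ℕ → ℂ) :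
    MvPolynomial.aeval P (bigQJacobiFun q a b c d l) =
      MvPolynomial.aeval P (scaledFun q a b c d 0 l) := by
  have hq : (q : ℂ) ≠ 0 := by exact_mod_cast hq₀.ne'
  rw [aeval_scaledFun, bigQJacobiFun, jtComb, map_sum]
  refine Finset.sum_congr rfl fun m _ => ?_
  have h1 : MvPolynomial.aeval P (SymFun.dilate c (interpA q m)) =
      c ^ m.card * jtDet m fun e k => P k - limitNodeSums q c 0 e k := by
    rw [← jtDet_scale hc, interpA_eq hq₀ hq₁, SymFun.dilate, ← AlgHom.comp_apply,
      MvPolynomial.comp_aeval]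
    have h2 : (fun i => (MvPolynomial.aeval P) (MvPolynomial.C (c ^ (i + 1)) * MvPolynomial.X i)) =
        fun i => c ^ (i + 1) * P i := by
      funext i
      simp
    rw [h2, aeval_jtFun]
    congr 1
    funext e k
    rw [mul_sub, limitNodeSums, limitNodeSums]
    congr 1
    have : c ^ (k + 1) * c⁻¹ ^ (k + 1) = 1 := by rw [← mul_pow, mul_inv_cancel₀ hc, one_pow]
    simp only [zero_mul, neg_zero, inv_one, one_pow, zero_pow (Nat.succ_ne_zero k), add_zero]
    rw [← mul_div_assoc, ← mul_assoc, this]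
  have h3 : sigmaBigQJacobi q a b c d l m * c ^ m.card = scaledCoef q a b c d 0 l m := by
    rw [sigmaBigQJacobi, scaledCoef, racahDet, mul_right_comm, sub_eq_add_neg, zpow_add₀ hc,
      zpow_natCast, mul_comm (c ^ (-(l.card : ℤ)))]
    congr 2
    ext j k
    simp only [Matrix.of_apply, racahEntry]
    have e1 : (l.rowLen j : ℤ) - j - m.rowLen k + k =
        ((l.rowLen j : ℤ) - j) - ((m.rowLen k : ℤ) - k) := by ring
    have e2 : (q : ℂ) ^ ((l.rowLen j : ℤ) + m.rowLen k + 1 - j - k) =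
        (q : ℂ) ^ 2 * (q : ℂ) ^ (((l.rowLen j : ℤ) - j) + ((m.rowLen k : ℤ) - k) - 1) := by
      rw [← zpow_natCast, ← zpow_add₀ hq]
      congr 1
      push_cast; ring
    have e3 : ∀ n : ℕ, qPoch 0 q n = 1 := fun n => by simp [qPoch]
    rw [e1, e2, neg_zero, zero_mul, zero_mul, zero_mul, e3, one_mul, ← mul_assoc,
      mul_comm (c * d / (a * b)) ((q : ℂ) ^ 2)]
  rw [map_smul, smul_eq_mul, h1, ← mul_assoc, h3]

/-! ### Rescaled configurations -/

section Rescale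

variable {Δ Δ' : Set ℝ} {ε : ℝ} (hε : ε ≠ 0) (h : ∀ x, x ∈ Δ ↔ ε * x ∈ Δ')

include hε h

theorem rescale_apply (X : Config Δ) (x : Δ) :
    Config.rescale Δ' ε X ⟨ε * x, (h x).1 x.2⟩ = X x := by
  rw [Bool.eq_iff_iff]
  simp only [Config.rescale, decide_eq_true_eq]
  constructor
  · rintro ⟨y, hy, hxy⟩
    have : y = x := Subtype.ext (mul_left_cancel₀ hε hxy)
    rwa [← this]
  · exact fun hx => ⟨x, hx, rfl⟩

theorem rescale_inv_rescale (X : Config Δ) :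
    Config.rescale Δ ε⁻¹ (Config.rescale Δ' ε X) = X := by
  funext x
  have h' : ∀ y, y ∈ Δ' ↔ ε⁻¹ * y ∈ Δ := fun y => by
    rw [h, mul_inv_cancel_left₀ hε]
  have h1 := rescale_apply (inv_ne_zero hε) h' (Config.rescale Δ' ε X) ⟨ε * x, (h x).1 x.2⟩
  rw [rescale_apply hε h] at h1
  rw [← h1]
  congr 1
  exact Subtype.ext (inv_mul_cancel_left₀ hε _).symm

theorem configSums_rescale (X : Config Δ) (k : ℕ) :
    configSums (Config.rescale Δ' ε X) k = (ε : ℂ) ^ (k + 1) * configSums X k := by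
  let e : Δ ≃ Δ' :=
    { toFun := fun x => ⟨ε * x, (h x).1 x.2⟩
      invFun := fun y => ⟨ε⁻¹ * y, by rw [h, mul_inv_cancel_left₀ hε]; exact y.2⟩
      left_inv := fun x => Subtype.ext (inv_mul_cancel_left₀ hε _)
      right_inv := fun y => Subtype.ext (mul_inv_cancel_left₀ hε _) }
  rw [configSums, ← e.tsum_eq, configSums, ← tsum_mul_left]
  refine tsum_congr fun x => ?_
  have h1 : Config.rescale Δ' ε X (e x) = X x := rescale_apply hε h X x
  rw [h1]
  split_ifs
  · have h2 : ((e x : Δ') : ℝ) = ε * x := rfl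
    rw [h2]
    push_cast
    ring
  · rw [mul_zero]

end Rescale

theorem mul_mem_doubleGrid {q l r ε : ℝ} (hε : ε ≠ 0) (x : ℝ) :
    x ∈ doubleGrid q l r ↔ ε * x ∈ doubleGrid q (ε * l) (ε * r) := by
  refine exists_congr fun n => ?_
  rw [mul_assoc, mul_assoc, mul_right_inj' hε, mul_right_inj' hε]

theorem epsPar_pos {q a b : ℝ} (hq₀ : 0 < q) (hab : a * b < 0) (M : ℕ) : 0 < epsPar q a b M :=
  div_pos (pow_pos hq₀ _) (Real.sqrt_pos.2 (by linarith))

theorem epsPar_sq {q a b : ℝ} (hab : a * b < 0) (M : ℕ) :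
    epsPar q a b M ^ 2 = deltaPar q a b M := by
  rw [epsPar, deltaPar, div_pow, Real.sq_sqrt (by linarith), ← pow_mul]
  congr 2
  ring

/-- The endpoints match because $\varepsilon\zeta q^{-M}=q/a$ and
$-\varepsilon\zeta^{-1}q^{-M}=q/b$: the choice $L=M$, $R=-M$ cancels the power $q^M$ in
$\varepsilon$. -/
theorem mem_qRacahGrid_iff {q a b : ℝ} (hq₀ : 0 < q) (ha : 0 < a) (hb : b < 0) (M : ℕ) (x : ℝ) :
    x ∈ qRacahGrid q (zetaPar a b) (M : ℤ) (-(M : ℤ)) ↔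
      epsPar q a b M * x ∈ bigQJacobiGrid q a b := by
  have hab : a * b < 0 := mul_neg_of_pos_of_neg ha hb
  have hq : q ^ (M + 1) * q ^ (-(M : ℤ)) = q := by
    rw [← zpow_natCast, ← zpow_add₀ hq₀.ne']
    simp
  have hs : 0 < √(-(a * b)) := Real.sqrt_pos.2 (by linarith)
  have hz : zetaPar a b = √(-(a * b)) / a := by
    rw [zetaPar, show -b / a = -(a * b) / a ^ 2 by field_simp, Real.sqrt_div (by linarith),
      Real.sqrt_sq ha.le]
  have hs2 : √(-(a * b)) * √(-(a * b)) = -(a * b) := Real.mul_self_sqrt (by linarith)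
  have hr : epsPar q a b M * (zetaPar a b * q ^ (-(M : ℤ))) = a⁻¹ * q := by
    rw [epsPar, hz]
    calc _ = (q ^ (M + 1) * q ^ (-(M : ℤ))) * (√(-(a * b)) / √(-(a * b))) / a := by ring
      _ = _ := by rw [hq, div_self hs.ne']; ring
  have hl : epsPar q a b M * -((zetaPar a b)⁻¹ * q ^ (-(M : ℤ))) = b⁻¹ * q := by
    rw [epsPar, hz]
    calc _ = -((q ^ (M + 1) * q ^ (-(M : ℤ))) * a / (√(-(a * b)) * √(-(a * b)))) := by
          rw [inv_div]; ring
      _ = _ := by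
        rw [hq, hs2]
        field_simp
  rw [qRacahGrid, mul_mem_doubleGrid (epsPar_pos hq₀ hab M).ne', hl, hr]

/-- `q`-Racah symmetric functions in terms of `scaledFun`. -/
theorem aeval_qRacahFun {q : ℝ} (hq₀ : 0 < q) (hq₁ : q < 1) {a b : ℝ} (ha : a ≠ 0) (hb : b ≠ 0)
    {c : ℂ} (hc : c ≠ 0) (d : ℂ) {ε : ℝ} (hε : ε ≠ 0) (l : YoungDiagram) (P : ℕ → ℂ) :
    (ε : ℂ) ^ l.card * MvPolynomial.aeval P
      (qRacahFun q (ε * c) (ε * d) (-q / (ε * a)) (-q / (ε * b)) l) =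
      MvPolynomial.aeval (fun k => (ε : ℂ) ^ (k + 1) * P k)
        (scaledFun q a b c d ((ε ^ 2 : ℝ) : ℂ) l) := by
  have hq : (q : ℂ) ≠ 0 := by exact_mod_cast hq₀.ne'
  have ha' : (a : ℂ) ≠ 0 := by exact_mod_cast ha
  have hb' : (b : ℂ) ≠ 0 := by exact_mod_cast hb
  have hε' : (ε : ℂ) ≠ 0 := by exact_mod_cast hε
  rw [aeval_scaledFun, qRacahFun, jtComb, map_sum, Finset.mul_sum]
  refine Finset.sum_congr rfl fun m _ => ?_
  -- Multiplying the nodes for $s_0=\varepsilon c$ by $\varepsilon$ gives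
  -- $c^{-1}q^{N-i-1}-\varepsilon^2cq^i$, that is, $\delta=\varepsilon^2$.
  have h1 : (jtDet m fun e k => (ε : ℂ) ^ (k + 1) * P k - limitNodeSums q c ((ε ^ 2 : ℝ) : ℂ) e k) =
      (ε : ℂ) ^ m.card * jtDet m fun e k => P k - limitNodeSums q (ε * c) 1 e k := by
    rw [← jtDet_scale hε']
    congr 1
    funext e k
    rw [mul_sub, limitNodeSums, limitNodeSums]
    congr 1
    rw [← mul_div_assoc]
    congr 1
    have e1 : (ε : ℂ) * (ε * c)⁻¹ = c⁻¹ := by field_simp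
    have e2 : -(((ε ^ 2 : ℝ) : ℂ) * c) = ε * -(1 * (ε * c)) := by push_cast; ring
    rw [e2, ← e1, mul_pow, mul_pow]
    ring
  have h2 : (ε : ℂ) ^ l.card * sigmaQRacah q (ε * c) (ε * d) (-q / (ε * a)) (-q / (ε * b)) l m =
      scaledCoef q a b c d ((ε ^ 2 : ℝ) : ℂ) l m * (ε : ℂ) ^ m.card := by
    have e0 : (ε : ℂ) ^ l.card * (ε : ℂ) ^ ((m.card : ℤ) - l.card) = (ε : ℂ) ^ m.card := by
      rw [← zpow_natCast, ← zpow_natCast, ← zpow_add₀ hε']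
      congr 1
      ring
    have e1 : -(ε * c) * (ε * d) = -((ε ^ 2 : ℝ) : ℂ) * c * d := by push_cast; ring
    have e2 : -(ε * c) * (-q / (ε * a)) = c / a * q := by field_simp
    have e3 : -(ε * c) * (-q / (ε * b)) = c / b * q := by field_simp
    have e4 : (ε * c) * (ε * d) * (-q / (ε * a)) * (-q / (ε * b)) =
        (q : ℂ) ^ 2 * (c * d / (a * b)) := by field_simp
    have e5 : (Matrix.of fun j k : Fin (l.colLen 0) =>
        let n : ℤ := (l.rowLen j : ℤ) - j - m.rowLen k + k
        let u : ℂ := (q : ℂ) ^ ((m.rowLen k : ℤ) - k)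
        if n < 0 then 0 else
          (qPoch (-(ε * c) * (ε * d) * u) q n.toNat *
            qPoch (-(ε * c) * (-q / (ε * a)) * u) q n.toNat *
              qPoch (-(ε * c) * (-q / (ε * b)) * u) q n.toNat) /
            (u ^ n * qPoch q q n.toNat *
              qPoch ((ε * c) * (ε * d) * (-q / (ε * a)) * (-q / (ε * b)) *
                (q : ℂ) ^ ((l.rowLen j : ℤ) + m.rowLen k - 1 - j - k)) q n.toNat)) =
        Matrix.of fun j k : Fin (l.colLen 0) => racahEntry q (-((ε ^ 2 : ℝ) : ℂ) * c * d)
          (c / a * q) (c / b * q) ((q : ℂ) ^ 2 * (c * d / (a * b)))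
          ((l.rowLen j : ℤ) - j) ((m.rowLen k : ℤ) - k) := by
      ext j k
      simp only [Matrix.of_apply, racahEntry]
      rw [e1, e2, e3, e4, show (l.rowLen j : ℤ) - j - m.rowLen k + k =
        ((l.rowLen j : ℤ) - j) - ((m.rowLen k : ℤ) - k) by ring,
        show (l.rowLen j : ℤ) + m.rowLen k - 1 - j - k =
        ((l.rowLen j : ℤ) - j) + ((m.rowLen k : ℤ) - k) - 1 by ring]
    rw [sigmaQRacah, e5, scaledCoef, racahDet, mul_zpow, ← e0]
    ring
  rw [map_smul, smul_eq_mul, interpBC_eq hq₀ hq₁, aeval_jtFun, h1, ← mul_assoc, h2, mul_assoc]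


/-! ### Characterization of the orthogonality measures -/

section Characterization

variable {q a b : ℝ} {c d : ℂ} (hq₀ : 0 < q) (hq₁ : q < 1) (H : RacahPositive q a b c d)

include hq₀ hq₁ H

theorem evalConfig_bigQJacobiFun (l : YoungDiagram) (X : Config (bigQJacobiGrid q a b)) :
    (bigQJacobiFun q a b c d l).evalConfig X = scaledMap hq₀ hq₁ H 0 l X := by
  rw [evalConfig_eq, aeval_bigQJacobiFun hq₀ hq₁ a b H.hc, aeval_scaledFun, scaledMap_apply]

/-- A probability measure is determined by the integrals of the functions `scaledMap`. -/
theorem eq_of_integral_scaledMap (δ : ℂ) {P P' : ProbabilityMeasure (Config (bigQJacobiGrid q a b))}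
    {L : YoungDiagram → ℂ}
    (hP : ∀ l, ∫ X, scaledMap hq₀ hq₁ H δ l X
      ∂(P : Measure (Config (bigQJacobiGrid q a b))) = L l)
    (hP' : ∀ l, ∫ X, scaledMap hq₀ hq₁ H δ l X
      ∂(P' : Measure (Config (bigQJacobiGrid q a b))) = L l) : P = P' :=
  probabilityMeasure_eq_of_integral_eq (span_scaledMap hq₀ hq₁ H δ) fun l => by rw [hP, hP']

/-- Orthogonality to $\Phi_\emptyset=1$ says that every other $\Phi_l$ has integral zero. Thus the
basis property determines the measure. -/
theorem IsBigQJacobiMeasure.integral_scaledMap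
    {P : ProbabilityMeasure (Config (bigQJacobiGrid q a b))}
    (h : IsBigQJacobiMeasure q a b c d P) (l : YoungDiagram) :
    ∫ X, scaledMap hq₀ hq₁ H 0 l X ∂(P : Measure (Config (bigQJacobiGrid q a b))) =
      Set.indicator {⊥} (fun _ => (1 : ℂ)) l := by
  obtain ⟨e, he, -, horth, -⟩ := h
  have h1 : ∀ l, e l = ContinuousMap.toLp 2 (P : Measure (Config (bigQJacobiGrid q a b))) ℂ
      (scaledMap hq₀ hq₁ H 0 l) := by
    intro l
    refine Lp.ext ((he l).trans ?_)
    filter_upwards [ContinuousMap.coeFn_toLp (p := 2) (𝕜 := ℂ)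
      (P : Measure (Config (bigQJacobiGrid q a b))) (scaledMap hq₀ hq₁ H 0 l)] with X hX
    rw [hX, evalConfig_bigQJacobiFun hq₀ hq₁ H]
  by_cases hl : l = ⊥
  · subst hl
    rw [Set.indicator_of_mem (Set.mem_singleton _), scaledMap_bot]
    simp
  · rw [Set.indicator_of_notMem (by simpa using hl)]
    have h2 := horth ⊥ l (Ne.symm hl)
    rw [h1, h1, ContinuousMap.inner_toLp, scaledMap_bot] at h2
    simpa using h2

-- Nonzero norms make the vectors nonzero. Completeness follows from uniform density of the span,
-- since continuous functions are dense in $L^2$.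
open Classical in
theorem isBigQJacobiMeasure_of_integral {P : ProbabilityMeasure (Config (bigQJacobiGrid q a b))}
    (hP : ∀ l m : YoungDiagram, ∫ X, scaledMap hq₀ hq₁ H 0 l X *
        (starRingEnd ℂ) (scaledMap hq₀ hq₁ H 0 m X)
          ∂(P : Measure (Config (bigQJacobiGrid q a b))) =
        if l = m then limitNorm q a b c d 0 l else 0) : IsBigQJacobiMeasure q a b c d P := by
  set μ := (P : Measure (Config (bigQJacobiGrid q a b)))
  have hinner : ∀ l m, inner ℂ (ContinuousMap.toLp 2 μ ℂ (scaledMap hq₀ hq₁ H 0 l))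
      (ContinuousMap.toLp 2 μ ℂ (scaledMap hq₀ hq₁ H 0 m)) =
        if m = l then limitNorm q a b c d 0 m else 0 := by
    intro l m
    rw [ContinuousMap.inner_toLp, hP]
  refine ⟨fun l => ContinuousMap.toLp 2 μ ℂ (scaledMap hq₀ hq₁ H 0 l), fun l => ?_, fun l h => ?_,
    fun l m hlm => ?_, ?_⟩
  · filter_upwards [ContinuousMap.coeFn_toLp (p := 2) (𝕜 := ℂ) μ (scaledMap hq₀ hq₁ H 0 l)]
      with X hX
    rw [hX, evalConfig_bigQJacobiFun hq₀ hq₁ H]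
  · have h1 := hinner l l
    change ContinuousMap.toLp 2 μ ℂ (scaledMap hq₀ hq₁ H 0 l) = 0 at h
    rw [h, inner_zero_left, if_pos rfl] at h1
    exact limitNorm_zero_ne_zero hq₀ hq₁ H l h1.symm
  · rw [hinner, if_neg (Ne.symm hlm)]
  · have hdense : Dense (Submodule.span ℂ (Set.range (scaledMap hq₀ hq₁ H 0)) :
        Set C(Config (bigQJacobiGrid q a b), ℂ)) :=
      Submodule.dense_iff_topologicalClosure_eq_top.2 (span_scaledMap hq₀ hq₁ H 0)
    have h1 := (ContinuousMap.toLp_denseRange ℂ μ ℂ (p := 2) (by norm_num)).dense_image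
      (ContinuousMap.toLp 2 μ ℂ).continuous hdense
    refine Submodule.dense_iff_topologicalClosure_eq_top.1 ?_
    have h2 : (Set.range fun l => ContinuousMap.toLp 2 μ ℂ (scaledMap hq₀ hq₁ H 0 l)) =
        (ContinuousMap.toLp 2 μ ℂ).toLinearMap '' Set.range (scaledMap hq₀ hq₁ H 0) := by
      rw [← Set.range_comp]
      rfl
    rw [h2, Submodule.span_image]
    exact h1

theorem evalConfig_qRacahFun (M : ℕ) (l : YoungDiagram)
    (X : Config (qRacahGrid q (zetaPar a b) (M : ℤ) (-(M : ℤ)))) :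
    (epsPar q a b M : ℂ) ^ l.card * (qRacahFun q (epsPar q a b M * c) (epsPar q a b M * d)
      (-q / (epsPar q a b M * a)) (-q / (epsPar q a b M * b)) l).evalConfig X =
      scaledMap hq₀ hq₁ H (deltaPar q a b M) l
        (Config.rescale (bigQJacobiGrid q a b) (epsPar q a b M) X) := by
  have hab : a * b < 0 := mul_neg_of_pos_of_neg H.ha H.hb
  have hε := (epsPar_pos hq₀ hab M).ne'
  have h1 : configSums (Config.rescale (bigQJacobiGrid q a b) (epsPar q a b M) X) =
      fun k => (epsPar q a b M : ℂ) ^ (k + 1) * configSums X k :=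
    funext fun k => configSums_rescale hε (mem_qRacahGrid_iff hq₀ H.ha H.hb M) X k
  rw [evalConfig_eq, aeval_qRacahFun hq₀ hq₁ H.ha.ne' H.hb.ne H.hc d hε, epsPar_sq hab,
    scaledMap_apply, h1, aeval_scaledFun]

/-- The factor $\varepsilon^{|l|}$ between the two functions is irrelevant: the prescribed integral
is zero unless $l$ is empty, and then the factor is $1$. Integrability is automatic for continuous
functions on a compact space. -/
theorem isQRacahMeasureAt_iff (M : ℕ)
    (P : ProbabilityMeasure (Config (qRacahGrid q (zetaPar a b) (M : ℤ) (-(M : ℤ))))) :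
    IsQRacahMeasureAt q a b c d M P ↔ ∀ l, ∫ X, scaledMap hq₀ hq₁ H (deltaPar q a b M) l X
      ∂((P.map (Config.measurable_rescale (bigQJacobiGrid q a b) (epsPar q a b M)).aemeasurable :
        ProbabilityMeasure (Config (bigQJacobiGrid q a b))) :
          Measure (Config (bigQJacobiGrid q a b))) = Set.indicator {⊥} (fun _ => (1 : ℂ)) l := by
  have hab : a * b < 0 := mul_neg_of_pos_of_neg H.ha H.hb
  have hε : (epsPar q a b M : ℂ) ≠ 0 := by exact_mod_cast (epsPar_pos hq₀ hab M).ne'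
  have hmeas := Config.measurable_rescale (Δ := qRacahGrid q (zetaPar a b) (M : ℤ) (-(M : ℤ)))
    (bigQJacobiGrid q a b) (epsPar q a b M)
  refine forall_congr' fun l => ?_
  have hpow : (epsPar q a b M : ℂ) ^ l.card ≠ 0 := pow_ne_zero _ hε
  have h1 : ∀ X, (qRacahFun q (epsPar q a b M * c) (epsPar q a b M * d)
      (-q / (epsPar q a b M * a)) (-q / (epsPar q a b M * b)) l).evalConfig X =
      ((epsPar q a b M : ℂ) ^ l.card)⁻¹ * scaledMap hq₀ hq₁ H (deltaPar q a b M) l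
        (Config.rescale (bigQJacobiGrid q a b) (epsPar q a b M) X) := fun X => by
    rw [← evalConfig_qRacahFun hq₀ hq₁ H, inv_mul_cancel_left₀ hpow]
  have hint : Integrable (scaledMap hq₀ hq₁ H (deltaPar q a b M) l)
      ((P : Measure (Config (qRacahGrid q (zetaPar a b) (M : ℤ) (-(M : ℤ))))).map
        (Config.rescale (bigQJacobiGrid q a b) (epsPar q a b M))) :=
    ContinuousMap.integrable_probabilityMeasure _ (P.map hmeas.aemeasurable)
  have hint' := (integrable_map_measure hint.aestronglyMeasurable hmeas.aemeasurable).1 hint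
  have hind : ((epsPar q a b M : ℂ) ^ l.card)⁻¹ * Set.indicator {⊥} (fun _ => (1 : ℂ)) l =
      Set.indicator {⊥} (fun _ => (1 : ℂ)) l := by
    by_cases hl : l = ⊥
    · subst hl
      simp [YoungDiagram.card]
    · rw [Set.indicator_of_notMem (by simpa using hl), mul_zero]
  rw [ProbabilityMeasure.toMeasure_map, integral_map hmeas.aemeasurable hint.aestronglyMeasurable]
  simp only [h1, integral_const_mul]
  constructor
  · rintro ⟨-, h⟩
    rw [← hind] at h
    exact mul_left_cancel₀ (inv_ne_zero hpow) h
  · intro h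
    exact ⟨hint'.const_mul _, by rw [h, hind]⟩

omit hq₁ in
theorem exists_map_rescale_eq (M : ℕ) (Q : ProbabilityMeasure (Config (bigQJacobiGrid q a b))) :
    ∃ P : ProbabilityMeasure (Config (qRacahGrid q (zetaPar a b) (M : ℤ) (-(M : ℤ)))),
      P.map (Config.measurable_rescale (bigQJacobiGrid q a b) (epsPar q a b M)).aemeasurable =
        Q := by
  have hab : a * b < 0 := mul_neg_of_pos_of_neg H.ha H.hb
  have hε := (epsPar_pos hq₀ hab M).ne'
  have hmem := mem_qRacahGrid_iff hq₀ H.ha H.hb M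
  refine ⟨Q.map (Config.measurable_rescale (qRacahGrid q (zetaPar a b) (M : ℤ) (-(M : ℤ)))
    (epsPar q a b M)⁻¹).aemeasurable, Subtype.ext ?_⟩
  change ((Q : Measure (Config (bigQJacobiGrid q a b))).map _).map _ = _
  rw [Measure.map_map (Config.measurable_rescale _ _) (Config.measurable_rescale _ _)]
  have h1 : Config.rescale (bigQJacobiGrid q a b) (epsPar q a b M) ∘
      Config.rescale (Δ := bigQJacobiGrid q a b) (qRacahGrid q (zetaPar a b) (M : ℤ) (-(M : ℤ)))
        (epsPar q a b M)⁻¹ = id := by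
    funext X
    have h2 := rescale_inv_rescale (inv_ne_zero hε)
      (fun y => by rw [hmem, mul_inv_cancel_left₀ hε] :
        ∀ y, y ∈ bigQJacobiGrid q a b ↔
          (epsPar q a b M)⁻¹ * y ∈ qRacahGrid q (zetaPar a b) (M : ℤ) (-(M : ℤ))) X
    rwa [inv_inv] at h2
  rw [h1, Measure.map_id]
  rfl

omit hq₁ in
theorem map_rescale_injective (M : ℕ)
    {P P' : ProbabilityMeasure (Config (qRacahGrid q (zetaPar a b) (M : ℤ) (-(M : ℤ))))}
    (h : P.map (Config.measurable_rescale (bigQJacobiGrid q a b) (epsPar q a b M)).aemeasurable =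
      P'.map (Config.measurable_rescale (bigQJacobiGrid q a b) (epsPar q a b M)).aemeasurable) :
    P = P' := by
  have hab : a * b < 0 := mul_neg_of_pos_of_neg H.ha H.hb
  have hε := (epsPar_pos hq₀ hab M).ne'
  have hmem := mem_qRacahGrid_iff hq₀ H.ha H.hb M
  have h1 : Config.rescale (qRacahGrid q (zetaPar a b) (M : ℤ) (-(M : ℤ))) (epsPar q a b M)⁻¹ ∘
      Config.rescale (Δ := qRacahGrid q (zetaPar a b) (M : ℤ) (-(M : ℤ))) (bigQJacobiGrid q a b)
        (epsPar q a b M) = id := funext fun X => rescale_inv_rescale hε hmem X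
  have h2 : ∀ P : ProbabilityMeasure (Config (qRacahGrid q (zetaPar a b) (M : ℤ) (-(M : ℤ)))),
      ((P : Measure (Config (qRacahGrid q (zetaPar a b) (M : ℤ) (-(M : ℤ))))).map
        (Config.rescale (bigQJacobiGrid q a b) (epsPar q a b M))).map
        (Config.rescale (qRacahGrid q (zetaPar a b) (M : ℤ) (-(M : ℤ))) (epsPar q a b M)⁻¹) = P := by
    intro P
    rw [Measure.map_map (Config.measurable_rescale _ _) (Config.measurable_rescale _ _), h1,
      Measure.map_id]
  have h3 : (P : Measure (Config (qRacahGrid q (zetaPar a b) (M : ℤ) (-(M : ℤ))))).map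
      (Config.rescale (bigQJacobiGrid q a b) (epsPar q a b M)) =
      (P' : Measure (Config (qRacahGrid q (zetaPar a b) (M : ℤ) (-(M : ℤ))))).map
      (Config.rescale (bigQJacobiGrid q a b) (epsPar q a b M)) := congrArg Subtype.val h
  have h4 : (P : Measure (Config (qRacahGrid q (zetaPar a b) (M : ℤ) (-(M : ℤ))))) = P' := by
    rw [← h2 P, h3, h2 P']
  exact Subtype.ext h4

end Characterization

theorem mainTheorem6 (q a b : ℝ) (c d : ℂ) (hq₀ : 0 < q) (hq₁ : q < 1)
    (h : BigQJacobiAdmissible q a b c d) :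
    (∀ M : ℕ, ∃! P, IsQRacahMeasureAt q a b c d M P) ∧
    (∃! P, IsBigQJacobiMeasure q a b c d P) ∧
    ∀ (P : ∀ M : ℕ,
        ProbabilityMeasure (Config (qRacahGrid q (zetaPar a b) (M : ℤ) (-(M : ℤ)))))
      (Pinf : ProbabilityMeasure (Config (bigQJacobiGrid q a b))),
      (∀ M, IsQRacahMeasureAt q a b c d M (P M)) →
      IsBigQJacobiMeasure q a b c d Pinf →
      Tendsto
        (fun M => (P M).map
          (Config.measurable_rescale (bigQJacobiGrid q a b) (epsPar q a b M)).aemeasurable)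
        atTop (𝓝 Pinf) := by
  have H := h.racahPositive hq₀ hq₁
  -- These measures on the limit grid turn out to be the pushforwards of the $q$-Racah measures, so
  -- their convergence is the claimed limit transition.
  choose Q hQ using exists_scaled_measure hq₀ hq₁ H
  obtain ⟨Qinf, hlim, hQinf⟩ := exists_limit_measure hq₀ hq₁ H hQ
  have hQ1 : ∀ M l, ∫ X, scaledMap hq₀ hq₁ H (deltaPar q a b M) l X
      ∂(Q M : Measure (Config (bigQJacobiGrid q a b))) =
        Set.indicator {⊥} (fun _ => (1 : ℂ)) l := by
    intro M l
    have h1 := hQ M l ⊥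
    rw [scaledMap_bot] at h1
    simp only [ContinuousMap.one_apply, map_one, mul_one] at h1
    rw [h1]
    by_cases hl : l = ⊥
    · subst hl
      simp [limitNorm_bot]
    · simp [hl]
  have hbqJ := isBigQJacobiMeasure_of_integral hq₀ hq₁ H hQinf
  have huniq : ∀ P, IsBigQJacobiMeasure q a b c d P → P = Qinf := fun P hP =>
    eq_of_integral_scaledMap hq₀ hq₁ H 0 (hP.integral_scaledMap hq₀ hq₁ H)
      (hbqJ.integral_scaledMap hq₀ hq₁ H)
  have hmap : ∀ M P, IsQRacahMeasureAt q a b c d M P → P.map (Config.measurable_rescale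
      (bigQJacobiGrid q a b) (epsPar q a b M)).aemeasurable = Q M := fun M P hP =>
    eq_of_integral_scaledMap hq₀ hq₁ H (deltaPar q a b M)
      ((isQRacahMeasureAt_iff hq₀ hq₁ H M P).1 hP) (hQ1 M)
  refine ⟨fun M => ?_, ⟨Qinf, hbqJ, huniq⟩, fun P Pinf hP hPinf => ?_⟩
  · obtain ⟨P, hP⟩ := exists_map_rescale_eq hq₀ H M (Q M)
    refine ⟨P, (isQRacahMeasureAt_iff hq₀ hq₁ H M P).2 fun l => ?_, fun P' hP' => ?_⟩
    · rw [hP, hQ1]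
    · exact map_rescale_injective hq₀ H M ((hmap M P' hP').trans hP.symm)
  · rw [huniq Pinf hPinf]
    exact hlim.congr fun M => (hmap M (P M) (hP M)).symm
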